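/- **Conventions.** A *separable Frobenius functor* between monoidal categories is a functor $F$ with a monoidal structure $\varphi_{x,y}:Fx\otimes Fy\to F(x\otimes y)$, $\varphi_0:\top\to F\top$ and a comonoidal structure $\psi_{x,y}:F(x\otimes y)\to Fx\otimes Fy$, $\psi_0:F\top\to\top$ such that $(Fx\otimes\varphi_{y,z})(\psi_{x,y}\otimes Fz)=\psi_{x,y\otimes z}\varphi_{x\otimes y,z}$, $(\varphi_{x,y}\otimes Fz)(Fx\otimes\psi_{y,z})=\psi_{x\otimes y,z}\varphi_{x,y\otimes z}$ and $\varphi_{x,y}\psi_{x,y}=1$ (associativities suppressed). A category $\mathcal V$ is *braided monoidally complete* if it is braided monoidal, has all small limits, and $b\otimes-$ and $-\otimes b$ preserve them for every $b\in\mathcal V$. Let $\mathbb K$ be the 2-category whose objects are the braided monoidally complete categories, whose 1-cells are the separable Frobenius functors that are braided both as monoidal and as comonoidal functors, and whose 2-cells are the natural transformations that are both monoidal and comonoidal. Write $\beta$ for the braidings. **The 2-functor $\mathbf{sfmon}/\!\!/{-}$.** For $\mathcal V\in\mathbb K$, an object of $\mathbf{sfmon}/\!\!/\mathcal V$ is a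 separable Frobenius functor $F:A\to\mathcal V$ with $A$ a small monoidal category, such that every $Fa$ has a dual ${}^*(Fa)$ with evaluation ${}^*(Fa)\otimes Fa\to\top$ and coevaluation $\top\to Fa\otimes{}^*(Fa)$. A morphism $F\to G$ is a pair $(H,\theta)$ of a separable Frobenius functor $H$ between the domains and an invertible monoidal and comonoidal transformation $\theta:GH\cong F$ (strictly commuting triangles $GH=F$ are the case $\theta=1$); composition is by pasting. A 1-cell $\Phi:\mathcal V\to\mathcal W$ acts by $F\mapsto\Phi F$, $(H,\theta)\mapsto(H,\Phi\theta)$. A 2-cell $\alpha:\Phi\Rightarrow\Psi$ gives, for every $F$, the morphism $(1,\alpha F):\Psi F\to\Phi F$; here $\alpha F$ is invertible because each $Fa$ has a dual. **The 2-functor $\mathbf{wba}$.** A *weak bialgebra* in $\mathcal V$ is an object $B$ with an algebra structure $(\mu,\eta)$ and a coalgebra structure $(\Delta,\epsilon)$ such that, in Sweedler notation, with $1_1\otimes 1_2=\Delta\eta$ and a second copy $1_{1'}\otimes 1_{2'}$ of it, $\Delta(ab)=\Delta(a)\Delta(b)$; $1_1\otimes1_2\otimes1_3=1_1\otimes1_21_{1'}\otimes1_{2'}=1_1\otimes1_{1'}1_2\otimes1_{2'}$;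 $\epsilon(abc)=\epsilon(ab_1)\epsilon(b_2c)=\epsilon(ab_2)\epsilon(b_1c)$, where the product of $B\otimes B$ in the first axiom uses $\beta_{B,B}$, and the crossings in the other two axioms are $\beta_{B,B}^{-1}$. Its four canonical idempotents are $h\mapsto1_1\epsilon(1_2h)$, $h\mapsto\epsilon(h1_1)1_2$, $h\mapsto\epsilon(1_1h)1_2$ and $h\mapsto1_1\epsilon(h1_2)$, where $1_2$ is moved past $h$ in the third, and $h$ past $1_1$ in the fourth, by $\beta_{B,B}$. A *weak morphism* $f:B\to C$ preserves $\mu$ and $\eta$, commutes with the four idempotents, and satisfies $\Delta(f(h))=\Delta(1)\cdot(f\otimes f)\Delta(h)=(f\otimes f)\Delta(h)\cdot\Delta(1)$. A *strong morphism* preserves $\mu,\eta,\Delta,\epsilon$. Weak bialgebras and weak morphisms form $\mathbf{wba}\,\mathcal V$. A 1-cell $\Phi$ sends $B$ to $\Phi B$ with structure maps $(\Phi\mu)\varphi,\ (\Phi\eta)\varphi_0,\ \psi(\Phi\Delta),\ \psi_0(\Phi\epsilon)$, and a 2-cell $\alpha$ acts by $\alpha_B:\Phi B\to\Psi B$. **The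 functors $\tan_{\mathcal V}$.** For $F\in\mathbf{sfmon}/\!\!/\mathcal V$ let $\tan F=\int_{a}Fa\otimes{}^*(Fa)$, with canonical action $\alpha_x:\tan F\otimes Fx\to Fx$. For every object $X$, morphisms $f:X\to\tan F$ correspond bijectively to families $X\otimes Fx\to Fx$ natural in $x$, by $f\mapsto\alpha_x(f\otimes Fx)$; this family is the *discharged form* of $f$. Multiplication and unit of $\tan F$ have discharged forms $\alpha_x(\tan F\otimes\alpha_x)$ and $1$; the counit is $\tan F\to\tan F\otimes F\top\xrightarrow{\alpha_\top}F\top\xrightarrow{\psi_0}\top$, whose first map is $\tan F\otimes\varphi_0$; the comultiplication is the unique $\Delta$ such that, for all $x,y$, $(\alpha_x\otimes\alpha_y)(\tan F\otimes\beta_{\tan F,Fx}\otimes Fy)(\Delta\otimes Fx\otimes Fy)=\psi_{x,y}\,\alpha_{x\otimes y}(\tan F\otimes\varphi_{x,y})$. For $(H,\theta):F\to G$ let $\tan(H,\theta):\tan G\to\tan F$ be the morphism with discharged form $\theta_x\,\alpha^G_{Hx}(\tan G\otimes\theta_x^{-1})$. **Proposition.** All of this is well defined: $\Delta$ exists and is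 unique, $\tan F$ is a weak bialgebra, $\tan(H,\theta)$ is a weak morphism, and 1-cells of $\mathbb K$ preserve weak bialgebras and weak morphisms; so there are functors $\tan_{\mathcal V}:\mathbf{sfmon}/\!\!/\mathcal V\to(\mathbf{wba}\,\mathcal V)^{\mathrm{op}}$, and (up to the canonical isomorphisms) 2-functors $\mathbf{sfmon}/\!\!/{-}$ and $(\mathbf{wba}\,-)^{\mathrm{op}}$, both contravariant on 2-cells. The functors $\tan_{\mathcal V}$ are the components of a lax natural transformation between the 2-functors $(\mathbf{sfmon}/\!\!/{-})^{\mathrm{op}}$ and $\mathbf{wba}\,-$ from $\mathbb K$ to $\mathbf{Cat}$, with structure 2-cells $\rho_\Phi:\mathbf{wba}(\Phi)\circ\tan_{\mathcal V}\Rightarrow\tan_{\mathcal W}\circ(\mathbf{sfmon}/\!\!/\Phi)^{\mathrm{op}}$ for $\Phi:\mathcal V\to\mathcal W$. The component $\rho_{\Phi,F}:\Phi\tan F\to\tan\Phi F$ is the morphism with discharged form $\Phi\tan F\otimes\Phi Fx\xrightarrow{\varphi}\Phi(\tan F\otimes Fx)\xrightarrow{\Phi\alpha_x}\Phi Fx$,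 and it is a strong morphism of weak bialgebras. -/

import Mathlib

open CategoryTheory MonoidalCategory Limits Opposite

universe v u v₁ u₁ v₂ u₂ v₃ u₃

namespace Tannaka

open Functor.LaxMonoidal Functor.OplaxMonoidal

/-- A separable Frobenius monoidal functor: a functor with a monoidal and a comonoidal structure
that satisfy the Frobenius and the separability equations. -/
structure SFFunctor (C : Type u₁) [Category.{v₁} C] [MonoidalCategory C]
    (D : Type u₂) [Category.{v₂} D] [MonoidalCategory D] where
  functor : C ⥤ D
  lax : functor.LaxMonoidal
  oplax : functor.OplaxMonoidal
  frobenius_left (X Y Z : C) :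
    δ functor X Y ▷ functor.obj Z ≫ (α_ _ _ _).hom ≫ functor.obj X ◁ μ functor Y Z =
      μ functor (X ⊗ Y) Z ≫ functor.map (α_ X Y Z).hom ≫ δ functor X (Y ⊗ Z)
  frobenius_right (X Y Z : C) :
    functor.obj X ◁ δ functor Y Z ≫ (α_ _ _ _).inv ≫ μ functor X Y ▷ functor.obj Z =
      μ functor X (Y ⊗ Z) ≫ functor.map (α_ X Y Z).inv ≫ δ functor (X ⊗ Y) Z
  separable (X Y : C) : δ functor X Y ≫ μ functor X Y = 𝟙 (functor.obj (X ⊗ Y))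

attribute [instance] SFFunctor.lax SFFunctor.oplax

namespace SFFunctor

variable {C : Type u₁} [Category.{v₁} C] [MonoidalCategory C]
  {D : Type u₂} [Category.{v₂} D] [MonoidalCategory D]
  {E : Type u₃} [Category.{v₃} E] [MonoidalCategory E]

lemma ext_structure {F G : SFFunctor C D} (h : F.functor = G.functor)
    (hε : ε F.functor ≫ eqToHom (by rw [h]) = ε G.functor)
    (hμ : ∀ X Y, μ F.functor X Y ≫ eqToHom (by rw [h]) = eqToHom (by rw [h]) ≫ μ G.functor X Y)
    (hη : η F.functor = eqToHom (by rw [h]) ≫ η G.functor)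
    (hδ : ∀ X Y, δ F.functor X Y ≫ eqToHom (by rw [h]) = eqToHom (by rw [h]) ≫ δ G.functor X Y) :
    F = G := by
  obtain ⟨F, l, o, _, _, _⟩ := F
  obtain ⟨G, l', o', _, _, _⟩ := G
  dsimp at h
  subst h
  have h1 : l = l' := by
    ext
    · simpa using hε
    · rename_i X Y
      simpa using hμ X Y
  have h2 : o = o' := by
    ext
    · simpa using hη
    · rename_i X Y
      simpa using hδ X Y
  subst h1 h2
  rfl

/-- The identity functor as a separable Frobenius monoidal functor. -/
abbrev id (C : Type u₁) [Category.{v₁} C] [MonoidalCategory C] : SFFunctor C C where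
  functor := 𝟭 C
  lax := Functor.LaxMonoidal.id
  oplax := Functor.OplaxMonoidal.id
  frobenius_left X Y Z := by simp
  frobenius_right X Y Z := by simp
  separable X Y := by simp

/-- Composition of separable Frobenius monoidal functors (in diagrammatic order). -/
abbrev comp (F : SFFunctor C D) (G : SFFunctor D E) : SFFunctor C E where
  functor := F.functor ⋙ G.functor
  lax := Functor.LaxMonoidal.comp F.functor G.functor
  oplax := Functor.OplaxMonoidal.comp F.functor G.functor
  frobenius_left X Y Z := by
    have h1 := G.frobenius_left (F.functor.obj X) (F.functor.obj Y) (F.functor.obj Z)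
    have h2 := F.frobenius_left X Y Z
    simp only [Functor.comp_obj, comp_δ, comp_μ, comp_whiskerRight,
      MonoidalCategory.whiskerLeft_comp, Category.assoc, Functor.comp_map]
    rw [reassoc_of% h1, μ_natural_left_assoc, δ_natural_right]
    simp only [← Functor.map_comp_assoc, h2]
  frobenius_right X Y Z := by
    have h1 := G.frobenius_right (F.functor.obj X) (F.functor.obj Y) (F.functor.obj Z)
    have h2 := F.frobenius_right X Y Z
    simp only [Functor.comp_obj, comp_δ, comp_μ, comp_whiskerRight,
      MonoidalCategory.whiskerLeft_comp, Category.assoc, Functor.comp_map]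
    rw [reassoc_of% h1, μ_natural_right_assoc, δ_natural_left]
    simp only [← Functor.map_comp_assoc, h2]
  separable X Y := by
    have h1 := G.separable (F.functor.obj X) (F.functor.obj Y)
    have h2 := F.separable X Y
    simp only [Functor.comp_obj, comp_δ, comp_μ, Category.assoc]
    rw [reassoc_of% h1, ← Functor.map_comp, h2, CategoryTheory.Functor.map_id]

lemma id_comp (F : SFFunctor C D) : (id C).comp F = F := by
  refine ext_structure rfl ?_ ?_ ?_ ?_ <;> intros <;> simp

lemma comp_id (F : SFFunctor C D) : F.comp (id D) = F := by
  refine ext_structure rfl ?_ ?_ ?_ ?_ <;> intros <;> simp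

lemma comp_assoc {B : Type u} [Category.{v} B] [MonoidalCategory B] (F : SFFunctor B C)
    (G : SFFunctor C D) (H : SFFunctor D E) : (F.comp G).comp H = F.comp (G.comp H) := by
  refine ext_structure rfl ?_ ?_ ?_ ?_ <;> intros <;> simp

end SFFunctor

/-- A natural transformation is monoidal and comonoidal. -/
structure IsBimonoidal {C : Type u₁} [Category.{v₁} C] [MonoidalCategory C]
    {D : Type u₂} [Category.{v₂} D] [MonoidalCategory D] (F G : SFFunctor C D)
    (τ : F.functor ⟶ G.functor) : Prop where
  unit : ε F.functor ≫ τ.app (𝟙_ C) = ε G.functor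
  tensor (X Y : C) : μ F.functor X Y ≫ τ.app (X ⊗ Y) = (τ.app X ⊗ₘ τ.app Y) ≫ μ G.functor X Y
  counit : τ.app (𝟙_ C) ≫ η G.functor = η F.functor
  cotensor (X Y : C) : τ.app (X ⊗ Y) ≫ δ G.functor X Y = δ F.functor X Y ≫ (τ.app X ⊗ₘ τ.app Y)

namespace IsBimonoidal

variable {C : Type u₁} [Category.{v₁} C] [MonoidalCategory C]
  {D : Type u₂} [Category.{v₂} D] [MonoidalCategory D]
  {E : Type u₃} [Category.{v₃} E] [MonoidalCategory E]

lemma refl (F : SFFunctor C D) : IsBimonoidal F F (𝟙 F.functor) where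
  unit := by simp
  tensor X Y := by simp
  counit := by simp
  cotensor X Y := by simp

lemma trans {F G H : SFFunctor C D} {σ : F.functor ⟶ G.functor} {τ : G.functor ⟶ H.functor}
    (hσ : IsBimonoidal F G σ) (hτ : IsBimonoidal G H τ) : IsBimonoidal F H (σ ≫ τ) where
  unit := by rw [NatTrans.comp_app, reassoc_of% hσ.unit, hτ.unit]
  tensor X Y := by
    rw [NatTrans.comp_app, reassoc_of% hσ.tensor X Y, hτ.tensor, NatTrans.comp_app,
      NatTrans.comp_app, MonoidalCategory.tensorHom_comp_tensorHom_assoc]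
  counit := by rw [NatTrans.comp_app, Category.assoc, hτ.counit, hσ.counit]
  cotensor X Y := by
    rw [NatTrans.comp_app, Category.assoc, hτ.cotensor, reassoc_of% hσ.cotensor X Y,
      NatTrans.comp_app, NatTrans.comp_app, MonoidalCategory.tensorHom_comp_tensorHom]

lemma symm {F G : SFFunctor C D} {e : F.functor ≅ G.functor}
    (h : IsBimonoidal F G e.hom) : IsBimonoidal G F e.inv where
  unit := by rw [← h.unit]; simp
  tensor X Y := by
    rw [← cancel_mono (e.hom.app (X ⊗ Y))]
    simp [h.tensor]
  counit := by rw [← h.counit]; simp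
  cotensor X Y := by
    rw [← cancel_epi (e.hom.app (X ⊗ Y))]
    simp [reassoc_of% h.cotensor]

lemma whiskerLeft (F : SFFunctor C D) {G H : SFFunctor D E} {τ : G.functor ⟶ H.functor}
    (h : IsBimonoidal G H τ) :
    IsBimonoidal (F.comp G) (F.comp H) (Functor.whiskerLeft F.functor τ) where
  unit := by simp [← h.unit]
  tensor X Y := by simp [← reassoc_of% h.tensor]
  counit := by simp [← h.counit]
  cotensor X Y := by simp [← h.cotensor]

lemma whiskerRight {F G : SFFunctor C D} {τ : F.functor ⟶ G.functor}
    (h : IsBimonoidal F G τ) (H : SFFunctor D E) :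
    IsBimonoidal (F.comp H) (G.comp H) (Functor.whiskerRight τ H.functor) where
  unit := by simp [← h.unit]
  tensor X Y := by simp [← Functor.map_comp, h.tensor]
  counit := by simp [← h.counit]
  cotensor X Y := by
    have := congrArg H.functor.map (h.cotensor X Y)
    simp only [Functor.map_comp] at this
    simp [reassoc_of% this]

lemma associator {B : Type u} [Category.{v} B] [MonoidalCategory B] (F : SFFunctor B C)
    (G : SFFunctor C D) (H : SFFunctor D E) :
    IsBimonoidal ((F.comp G).comp H) (F.comp (G.comp H))
      (Functor.associator F.functor G.functor H.functor).hom :=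
  ⟨by simp, by simp, by simp, by simp⟩

lemma leftUnitor (F : SFFunctor C D) :
    IsBimonoidal ((SFFunctor.id C).comp F) F (Functor.leftUnitor F.functor).hom :=
  ⟨by simp, by simp, by simp, by simp⟩

lemma rightUnitor (F : SFFunctor C D) :
    IsBimonoidal (F.comp (SFFunctor.id D)) F (Functor.rightUnitor F.functor).hom :=
  ⟨by simp, by simp, by simp, by simp⟩

end IsBimonoidal

/-- Frobenius monoidal functors preserve duals. -/
abbrev SFFunctor.mapPairing {C : Type u₁} [Category.{v₁} C] [MonoidalCategory C]
    {D : Type u₂} [Category.{v₂} D] [MonoidalCategory D] (F : SFFunctor C D)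
    (X Y : C) [ExactPairing X Y] : ExactPairing (F.functor.obj X) (F.functor.obj Y) where
  coevaluation' := ε F.functor ≫ F.functor.map (η_ X Y) ≫ δ F.functor X Y
  evaluation' := μ F.functor Y X ≫ F.functor.map (ε_ X Y) ≫ η F.functor
  coevaluation_evaluation' := by
    have h := F.frobenius_right Y X Y
    have z := congrArg F.functor.map (ExactPairing.coevaluation_evaluation X Y)
    simp only [Functor.map_comp] at z
    simp only [MonoidalCategory.whiskerLeft_comp, comp_whiskerRight, Category.assoc]
    rw [reassoc_of% h, μ_natural_right_assoc, δ_natural_left_assoc, reassoc_of% z]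
    simp
  evaluation_coevaluation' := by
    have h := F.frobenius_left X Y X
    have z := congrArg F.functor.map (ExactPairing.evaluation_coevaluation X Y)
    simp only [Functor.map_comp] at z
    simp only [MonoidalCategory.whiskerLeft_comp, comp_whiskerRight, Category.assoc]
    rw [reassoc_of% h, μ_natural_left_assoc, δ_natural_right_assoc, reassoc_of% z]
    simp

/-- A braided monoidally complete category: it has all small limits, and tensoring with an
object on either side preserves them. -/
structure BMCat where
  carrier : Type u
  [category : Category.{v} carrier]
  [monoidal : MonoidalCategory carrier]
  [braided : BraidedCategory carrier]
  [complete : HasLimits carrier]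
  [tensorLeft_continuous (b : carrier) : PreservesLimits (tensorLeft b)]
  [tensorRight_continuous (b : carrier) : PreservesLimits (tensorRight b)]

namespace BMCat

instance : CoeSort BMCat.{v, u} (Type u) := ⟨carrier⟩

attribute [instance] category monoidal braided complete tensorLeft_continuous
  tensorRight_continuous

/-- A separable Frobenius monoidal functor that is braided as a monoidal functor and as a
comonoidal functor. -/
structure Hom (V W : BMCat.{v, u}) extends SFFunctor V W where
  braided_μ (X Y : V) : μ functor X Y ≫ functor.map (β_ X Y).hom =
    (β_ (functor.obj X) (functor.obj Y)).hom ≫ μ functor Y X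
  braided_δ (X Y : V) : functor.map (β_ X Y).hom ≫ δ functor Y X =
    δ functor X Y ≫ (β_ (functor.obj X) (functor.obj Y)).hom

/-- A monoidal and comonoidal natural transformation. -/
@[ext]
structure Hom₂ {V W : BMCat.{v, u}} (Φ Ψ : Hom V W) where
  nat : Φ.functor ⟶ Ψ.functor
  bimonoidal : IsBimonoidal Φ.toSFFunctor Ψ.toSFFunctor nat

/-- The identity 1-cell. -/
abbrev Hom.id (V : BMCat.{v, u}) : Hom V V where
  toSFFunctor := SFFunctor.id V
  braided_μ X Y := by simp
  braided_δ X Y := by simp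

/-- Composition of 1-cells. -/
abbrev Hom.comp {U V W : BMCat.{v, u}} (Φ : Hom U V) (Ψ : Hom V W) : Hom U W where
  toSFFunctor := Φ.toSFFunctor.comp Ψ.toSFFunctor
  braided_μ X Y := by
    have h := congrArg Ψ.functor.map (Φ.braided_μ X Y)
    simp only [Functor.map_comp] at h
    simp [h, reassoc_of% Ψ.braided_μ]
  braided_δ X Y := by
    have h := congrArg Ψ.functor.map (Φ.braided_δ X Y)
    simp only [Functor.map_comp] at h
    simp [reassoc_of% h, Ψ.braided_δ]

instance {V W : BMCat.{v, u}} : Category (Hom V W) where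
  Hom Φ Ψ := Hom₂ Φ Ψ
  id Φ := ⟨𝟙 Φ.functor, .refl _⟩
  comp σ τ := ⟨σ.nat ≫ τ.nat, σ.bimonoidal.trans τ.bimonoidal⟩
  id_comp _ := Hom₂.ext (Category.id_comp _)
  comp_id _ := Hom₂.ext (Category.comp_id _)
  assoc _ _ _ := Hom₂.ext (Category.assoc _ _ _)

instance : CategoryStruct BMCat.{v, u} where
  Hom := Hom
  id := Hom.id
  comp := Hom.comp

/-- An invertible 2-cell from an invertible natural transformation. -/
@[simps]
def isoMk {V W : BMCat.{v, u}} {Φ Ψ : Hom V W} (e : Φ.functor ≅ Ψ.functor)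
    (h : IsBimonoidal Φ.toSFFunctor Ψ.toSFFunctor e.hom) : Φ ≅ Ψ where
  hom := ⟨e.hom, h⟩
  inv := ⟨e.inv, h.symm⟩
  hom_inv_id := Hom₂.ext e.hom_inv_id
  inv_hom_id := Hom₂.ext e.inv_hom_id

/-- The 2-category of braided monoidally complete categories, braided separable Frobenius functors,
and monoidal and comonoidal natural transformations. -/
instance : Bicategory BMCat.{v, u} where
  homCategory V W := inferInstanceAs (Category (Hom V W))
  whiskerLeft Φ _ _ τ := ⟨Functor.whiskerLeft Φ.functor τ.nat, τ.bimonoidal.whiskerLeft _⟩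
  whiskerRight τ Ψ := ⟨Functor.whiskerRight τ.nat Ψ.functor, τ.bimonoidal.whiskerRight _⟩
  associator Φ Ψ Θ := isoMk (Functor.associator Φ.functor Ψ.functor Θ.functor)
    (IsBimonoidal.associator _ _ _)
  leftUnitor Φ := isoMk (Functor.leftUnitor Φ.functor) (IsBimonoidal.leftUnitor _)
  rightUnitor Φ := isoMk (Functor.rightUnitor Φ.functor) (IsBimonoidal.rightUnitor _)
  whiskerLeft_id _ _ := Hom₂.ext (by ext; rfl)
  whiskerLeft_comp _ _ _ _ _ _ := Hom₂.ext (by ext; rfl)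
  id_whiskerLeft τ := Hom₂.ext (by
    ext X; exact ((Category.id_comp _).trans (Category.comp_id (τ.nat.app X))).symm)
  comp_whiskerLeft Φ Ψ _ _ τ := Hom₂.ext (by
    ext X
    exact ((Category.id_comp _).trans (Category.comp_id
      (τ.nat.app (Ψ.functor.obj (Φ.functor.obj X))))).symm)
  id_whiskerRight Φ Ψ := Hom₂.ext (by ext X; exact Ψ.functor.map_id _)
  comp_whiskerRight σ τ Ψ := Hom₂.ext (by
    ext X; exact Ψ.functor.map_comp (σ.nat.app X) (τ.nat.app X))
  whiskerRight_id τ := Hom₂.ext (by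
    ext X; exact ((Category.id_comp _).trans (Category.comp_id (τ.nat.app X))).symm)
  whiskerRight_comp τ Φ Ψ := Hom₂.ext (by
    ext X
    exact ((Category.id_comp _).trans (Category.comp_id
      (Ψ.functor.map (Φ.functor.map (τ.nat.app X))))).symm)
  whisker_assoc Φ _ _ τ Ψ := Hom₂.ext (by
    ext X
    exact ((Category.id_comp _).trans (Category.comp_id
      (Ψ.functor.map (τ.nat.app (Φ.functor.obj X))))).symm)
  whisker_exchange σ τ := Hom₂.ext (by ext X; exact (τ.nat.naturality (σ.nat.app X)).symm)
  pentagon Φ Ψ Θ Ξ := Hom₂.ext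
    (Functor.pentagon Φ.functor Ψ.functor Θ.functor Ξ.functor)
  triangle Φ Ψ := Hom₂.ext (Functor.triangle Φ.functor Ψ.functor)

end BMCat

lemma isIso_of_pairings {D : Type u₂} [Category.{v₂} D] [MonoidalCategory D] {P P' Q Q' : D}
    [ExactPairing P P'] [ExactPairing Q Q'] (f : P ⟶ Q) (g : P' ⟶ Q')
    (h₁ : η_ P P' ≫ (f ⊗ₘ g) = η_ Q Q') (h₂ : (g ⊗ₘ f) ≫ ε_ Q Q' = ε_ P P') : IsIso f := by
  refine ⟨(λ_ Q).inv ≫ η_ P P' ▷ Q ≫ (P ◁ g) ▷ Q ≫ (α_ _ _ _).hom ≫ P ◁ ε_ Q Q' ≫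
    (ρ_ P).hom, ?_, ?_⟩
  · have z := ExactPairing.evaluation_coevaluation P P'
    rw [← h₂, MonoidalCategory.tensorHom_def] at z
    calc _ = (λ_ _).inv ≫ (η_ P P' ▷ P ≫ (α_ _ _ _).hom ≫
          P ◁ ((g ▷ P ≫ Q' ◁ f) ≫ ε_ Q Q')) ≫ (ρ_ _).hom := by
          simp only [Category.assoc]
          rw [leftUnitor_inv_naturality_assoc, whisker_exchange_assoc]
          simp [← whisker_exchange_assoc]
      _ = _ := by rw [z]; simp
  · have z := ExactPairing.evaluation_coevaluation Q Q'
    rw [← h₁, MonoidalCategory.tensorHom_def'] at z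
    calc _ = (λ_ _).inv ≫ ((η_ P P' ≫ P ◁ g ≫ f ▷ Q') ▷ Q ≫ (α_ _ _ _).hom ≫
          Q ◁ ε_ Q Q') ≫ (ρ_ _).hom := by
          simp only [Category.assoc]
          rw [← rightUnitor_naturality, whisker_exchange_assoc]
          simp
      _ = _ := by rw [z]; simp

/-- A monoidal and comonoidal transformation between Frobenius monoidal functors is invertible
at every dualizable object. -/
lemma IsBimonoidal.isIso_app {C : Type u₁} [Category.{v₁} C] [MonoidalCategory C]
    {D : Type u₂} [Category.{v₂} D] [MonoidalCategory D] {F G : SFFunctor C D}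
    {τ : F.functor ⟶ G.functor} (h : IsBimonoidal F G τ) (X Y : C) [ExactPairing X Y] :
    IsIso (τ.app X) := by
  let pF := F.mapPairing X Y
  let pG := G.mapPairing X Y
  have h₁ : η_ (F.functor.obj X) (F.functor.obj Y) ≫ (τ.app X ⊗ₘ τ.app Y) =
      η_ (G.functor.obj X) (G.functor.obj Y) := by
    change (ε F.functor ≫ F.functor.map (η_ X Y) ≫ δ F.functor X Y) ≫ (τ.app X ⊗ₘ τ.app Y) =
      ε G.functor ≫ G.functor.map (η_ X Y) ≫ δ G.functor X Y
    simp [← h.cotensor, ← h.unit]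
  have h₂ : (τ.app Y ⊗ₘ τ.app X) ≫ ε_ (G.functor.obj X) (G.functor.obj Y) =
      ε_ (F.functor.obj X) (F.functor.obj Y) := by
    change (τ.app Y ⊗ₘ τ.app X) ≫ μ G.functor Y X ≫ G.functor.map (ε_ X Y) ≫ η G.functor =
      μ F.functor Y X ≫ F.functor.map (ε_ X Y) ≫ η F.functor
    rw [← reassoc_of% h.tensor, ← h.counit, τ.naturality_assoc]
  exact isIso_of_pairings (τ.app X) (τ.app Y) h₁ h₂

/-- The objects of `sfmon ⫽ V`: separable Frobenius monoidal functors `F` of reconstruction type, from a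
small monoidal category `A` to `V`. Every `F a` has to have a dual with an evaluation
`(F a)ᘁ ⊗ F a ⟶ 𝟙_ V`, which Mathlib calls a *right* dual. -/
structure SFOver (V : BMCat.{v, u}) where
  A : Type v
  [category : SmallCategory A]
  [monoidal : MonoidalCategory A]
  F : SFFunctor A V
  dual (a : A) : Nonempty (HasRightDual (F.functor.obj a))

namespace SFOver

attribute [instance] category monoidal

noncomputable instance hasRightDual {V : BMCat.{v, u}} (F : SFOver V) (a : F.A) :
    HasRightDual (F.F.functor.obj a) := (F.dual a).some

variable {V : BMCat.{v, u}}

/-- The morphisms `F ⟶ G` of `sfmon ⫽ V`: separable Frobenius monoidal functors `H` with an invertible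
monoidal and comonoidal transformation from `H` followed by `G` to `F`. Strictly commuting triangles
are those for which this transformation is an identity. -/
structure Hom (F G : SFOver V) where
  H : SFFunctor F.A G.A
  iso : H.functor ⋙ G.F.functor ≅ F.F.functor
  bimonoidal : IsBimonoidal (H.comp G.F) F.F iso.hom

lemma Hom.ext' {F G : SFOver V} {H K : Hom F G} (h : H.H = K.H)
    (h' : ∀ a, HEq (H.iso.hom.app a) (K.iso.hom.app a)) : H = K := by
  obtain ⟨H, e, _⟩ := H
  obtain ⟨K, e', _⟩ := K
  dsimp only at h
  subst h
  have : e = e' := by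
    ext a
    exact eq_of_heq (h' a)
  subst this
  rfl

instance : Category (SFOver V) where
  Hom := Hom
  id F := ⟨SFFunctor.id F.A, Functor.leftUnitor _, IsBimonoidal.leftUnitor _⟩
  comp {F G E} H K := ⟨H.H.comp K.H, Functor.associator _ _ _ ≪≫
      Functor.isoWhiskerLeft H.H.functor K.iso ≪≫ H.iso,
    (IsBimonoidal.associator _ _ _).trans ((K.bimonoidal.whiskerLeft H.H).trans H.bimonoidal)⟩
  id_comp {F G} H := Hom.ext' (SFFunctor.id_comp _) fun a => heq_of_eq (by simp)
  comp_id {F G} H := Hom.ext' (SFFunctor.comp_id _) fun a => heq_of_eq (by simp)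
  assoc H K L := Hom.ext' (SFFunctor.comp_assoc _ _ _) fun a => heq_of_eq (by simp)

lemma id_H (F : SFOver V) : Hom.H (𝟙 F) = SFFunctor.id F.A := rfl

lemma comp_H {F G E : SFOver V} (f : F ⟶ G) (g : G ⟶ E) :
    Hom.H (f ≫ g) = (Hom.H f).comp (Hom.H g) := rfl

lemma id_iso_app (F : SFOver V) (a : F.A) :
    (Hom.iso (𝟙 F)).hom.app a = 𝟙 (F.F.functor.obj a) := rfl

lemma comp_iso_app {F G E : SFOver V} (f : F ⟶ G) (g : G ⟶ E) (a : F.A) :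
    (Hom.iso (f ≫ g)).hom.app a =
      (Hom.iso g).hom.app ((Hom.H f).functor.obj a) ≫ (Hom.iso f).hom.app a :=
  Category.id_comp _

end SFOver

namespace SFOver

open Bicategory

section

variable {V : BMCat.{v, u}} {A : Type v} [SmallCategory A] [MonoidalCategory A]

/-- An invertible monoidal and comonoidal transformation `e : F ≅ G` of functors with the same
domain, as a morphism from `G` to `F`. -/
abbrev homOfIso {F G : SFFunctor A V} (hF : ∀ a, Nonempty (HasRightDual (F.functor.obj a)))
    (hG : ∀ a, Nonempty (HasRightDual (G.functor.obj a))) (e : F.functor ≅ G.functor)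
    (he : IsBimonoidal F G e.hom) : SFOver.mk A G hG ⟶ SFOver.mk A F hF where
  H := SFFunctor.id A
  iso := Functor.leftUnitor _ ≪≫ e
  bimonoidal := (IsBimonoidal.leftUnitor _).trans he

/-- Invertible transformations give isomorphisms. -/
@[simps]
def isoOfIso {F G : SFFunctor A V} (hF : ∀ a, Nonempty (HasRightDual (F.functor.obj a)))
    (hG : ∀ a, Nonempty (HasRightDual (G.functor.obj a))) (e : F.functor ≅ G.functor)
    (he : IsBimonoidal F G e.hom) : SFOver.mk A G hG ≅ SFOver.mk A F hF where
  hom := homOfIso hF hG e he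
  inv := homOfIso hG hF e.symm he.symm
  hom_inv_id := Hom.ext' (SFFunctor.id_comp _) fun a => heq_of_eq (by
    rw [comp_iso_app, id_iso_app]; simp)
  inv_hom_id := Hom.ext' (SFFunctor.id_comp _) fun a => heq_of_eq (by
    rw [comp_iso_app, id_iso_app]; simp)

end

/-- Composition with a 1-cell `Φ`, on objects. -/
abbrev mapObj {V W : BMCat.{v, u}} (Φ : V ⟶ W) (F : SFOver V) : SFOver W where
  A := F.A
  F := F.F.comp Φ.toSFFunctor
  dual a := ⟨@HasRightDual.mk _ _ _ (Φ.functor.obj (F.F.functor.obj a)) _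
    (Φ.toSFFunctor.mapPairing (F.F.functor.obj a) (F.F.functor.obj a)ᘁ)⟩

/-- Composition with a 1-cell `Φ`, as a functor `sfmon ⫽ V ⥤ sfmon ⫽ W`. -/
def map {V W : BMCat.{v, u}} (Φ : V ⟶ W) : SFOver V ⥤ SFOver W where
  obj F := mapObj Φ F
  map {F G} H := ⟨H.H, (Functor.associator _ _ _).symm ≪≫ Functor.isoWhiskerRight H.iso Φ.functor,
    (IsBimonoidal.associator _ _ _).symm.trans (H.bimonoidal.whiskerRight Φ.toSFFunctor)⟩
  map_id F := Hom.ext' rfl fun a => heq_of_eq (by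
    simp only [Iso.trans_hom, NatTrans.comp_app, Iso.symm_hom, Functor.associator_inv_app,
      Functor.isoWhiskerRight_hom, Functor.whiskerRight_app, id_iso_app]
    exact (Category.id_comp _).trans (Φ.functor.map_id _))
  map_comp H K := Hom.ext' rfl fun a => heq_of_eq (by
    simp [comp_iso_app, comp_H])

/-- A 2-cell `τ : Φ ⟶ Ψ`, whiskered by `F`. Its components are invertible because the values of
`F` have duals, and it is a morphism from `Ψ F` to `Φ F`. -/
noncomputable abbrev whisker {V W : BMCat.{v, u}} {Φ Ψ : V ⟶ W} (τ : Φ ⟶ Ψ) (F : SFOver V) :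
    mapObj Ψ F ⟶ mapObj Φ F :=
  haveI (a : F.A) : IsIso ((Functor.whiskerLeft F.F.functor τ.nat).app a) :=
    τ.bimonoidal.isIso_app (F.F.functor.obj a) (F.F.functor.obj a)ᘁ
  haveI : IsIso (Functor.whiskerLeft F.F.functor τ.nat) := NatIso.isIso_of_isIso_app _
  homOfIso (mapObj Φ F).dual (mapObj Ψ F).dual (asIso (Functor.whiskerLeft F.F.functor τ.nat))
    (τ.bimonoidal.whiskerLeft F.F)

lemma whisker_iso_app {V W : BMCat.{v, u}} {Φ Ψ : V ⟶ W} (τ : Φ ⟶ Ψ) (F : SFOver V) (a : F.A) :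
    (Hom.iso (whisker τ F)).hom.app a = τ.nat.app (F.F.functor.obj a) :=
  Category.id_comp _

lemma map_iso_app {V W : BMCat.{v, u}} (Φ : V ⟶ W) {F G : SFOver V} (f : F ⟶ G) (a : F.A) :
    (Hom.iso ((map Φ).map f)).hom.app a = Φ.functor.map ((Hom.iso f).hom.app a) :=
  Category.id_comp _

lemma whisker_naturality {V W : BMCat.{v, u}} {Φ Ψ : V ⟶ W} (τ : Φ ⟶ Ψ) {F G : SFOver V}
    (f : F ⟶ G) : (map Ψ).map f ≫ whisker τ G = whisker τ F ≫ (map Φ).map f := by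
  refine Hom.ext' ((SFFunctor.comp_id _).trans (SFFunctor.id_comp _).symm)
    fun a => heq_of_eq ?_
  refine (comp_iso_app ((map Ψ).map f) (whisker τ G) a).trans
    (Eq.trans ?_ (comp_iso_app (whisker τ F) ((map Φ).map f) a).symm)
  refine (congrArg₂ (· ≫ ·) (whisker_iso_app τ G _) (map_iso_app Ψ f a)).trans
    (Eq.trans ?_ (congrArg₂ (· ≫ ·) (map_iso_app Φ f _) (whisker_iso_app τ F a)).symm)
  exact (τ.nat.naturality ((Hom.iso f).hom.app a)).symm

lemma whisker_id {V W : BMCat.{v, u}} (Φ : V ⟶ W) (F : SFOver V) :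
    whisker (𝟙 Φ) F = 𝟙 (mapObj Φ F) :=
  Hom.ext' rfl fun a => heq_of_eq (whisker_iso_app (𝟙 Φ) F a)

lemma whisker_comp {V W : BMCat.{v, u}} {Φ Ψ Θ : V ⟶ W} (σ : Φ ⟶ Ψ) (τ : Ψ ⟶ Θ)
    (F : SFOver V) : whisker (σ ≫ τ) F = whisker τ F ≫ whisker σ F := by
  refine Hom.ext' (SFFunctor.id_comp _).symm fun a => heq_of_eq ?_
  refine (whisker_iso_app (σ ≫ τ) F a).trans
    (Eq.trans ?_ (comp_iso_app (whisker τ F) (whisker σ F) a).symm)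
  exact (congrArg₂ (· ≫ ·) (whisker_iso_app σ F a) (whisker_iso_app τ F a)).symm

/-- The canonical isomorphism `𝟙 F ≅ F` in `sfmon ⫽ V`. -/
def mapIdIso (V : BMCat.{v, u}) (F : SFOver V) : mapObj (𝟙 V) F ≅ F :=
  isoOfIso F.dual (mapObj (𝟙 V) F).dual (Functor.rightUnitor F.F.functor).symm
    (IsBimonoidal.rightUnitor _).symm

/-- The canonical isomorphism `(Φ ≫ Ψ) F ≅ Ψ (Φ F)` in `sfmon ⫽ W`. -/
def mapCompIso {U V W : BMCat.{v, u}} (Φ : U ⟶ V) (Ψ : V ⟶ W) (F : SFOver U) :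
    mapObj (Φ ≫ Ψ) F ≅ mapObj Ψ (mapObj Φ F) :=
  isoOfIso (mapObj Ψ (mapObj Φ F)).dual (mapObj (Φ ≫ Ψ) F).dual
    (Functor.associator F.F.functor Φ.functor Ψ.functor) (IsBimonoidal.associator _ _ _)

lemma mapIdIso_hom_iso_app (V : BMCat.{v, u}) (F : SFOver V) (a : F.A) :
    (Hom.iso (mapIdIso V F).hom).hom.app a = 𝟙 (F.F.functor.obj a) :=
  Category.id_comp _

lemma mapIdIso_inv_iso_app (V : BMCat.{v, u}) (F : SFOver V) (a : F.A) :
    (Hom.iso (mapIdIso V F).inv).hom.app a = 𝟙 (F.F.functor.obj a) :=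
  Category.id_comp _

lemma mapCompIso_hom_iso_app {U V W : BMCat.{v, u}} (Φ : U ⟶ V) (Ψ : V ⟶ W) (F : SFOver U)
    (a : F.A) : (Hom.iso (mapCompIso Φ Ψ F).hom).hom.app a =
      𝟙 (Ψ.functor.obj (Φ.functor.obj (F.F.functor.obj a))) :=
  Category.id_comp _

lemma mapCompIso_inv_iso_app {U V W : BMCat.{v, u}} (Φ : U ⟶ V) (Ψ : V ⟶ W) (F : SFOver U)
    (a : F.A) : (Hom.iso (mapCompIso Φ Ψ F).inv).hom.app a =
      𝟙 (Ψ.functor.obj (Φ.functor.obj (F.F.functor.obj a))) :=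
  Category.id_comp _

lemma mapIdIso_naturality (V : BMCat.{v, u}) {F G : SFOver V} (f : F ⟶ G) :
    (mapIdIso V F).inv ≫ (map (𝟙 V)).map f = f ≫ (mapIdIso V G).inv := by
  refine Hom.ext' ((SFFunctor.id_comp _).trans (SFFunctor.comp_id _).symm)
    fun a => heq_of_eq ?_
  refine (comp_iso_app (mapIdIso V F).inv ((map (𝟙 V)).map f) a).trans
    (Eq.trans ?_ (comp_iso_app f (mapIdIso V G).inv a).symm)
  refine (congrArg₂ (· ≫ ·) (map_iso_app (𝟙 V) f a) (mapIdIso_inv_iso_app V F a)).trans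
    (Eq.trans ?_ (congrArg₂ (· ≫ ·) (mapIdIso_inv_iso_app V G _) rfl).symm)
  exact (Category.comp_id _).trans (Category.id_comp _).symm

lemma mapCompIso_naturality {U V W : BMCat.{v, u}} (Φ : U ⟶ V) (Ψ : V ⟶ W) {F G : SFOver U}
    (f : F ⟶ G) : (mapCompIso Φ Ψ F).inv ≫ (map (Φ ≫ Ψ)).map f =
      (map Ψ).map ((map Φ).map f) ≫ (mapCompIso Φ Ψ G).inv := by
  refine Hom.ext' ((SFFunctor.id_comp _).trans (SFFunctor.comp_id _).symm)
    fun a => heq_of_eq ?_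
  refine (comp_iso_app (mapCompIso Φ Ψ F).inv ((map (Φ ≫ Ψ)).map f) a).trans
    (Eq.trans ?_ (comp_iso_app ((map Ψ).map ((map Φ).map f)) (mapCompIso Φ Ψ G).inv a).symm)
  refine (congrArg₂ (· ≫ ·) (map_iso_app (Φ ≫ Ψ) f a)
    (mapCompIso_inv_iso_app Φ Ψ F a)).trans (Eq.trans ?_
    (congrArg₂ (· ≫ ·) (mapCompIso_inv_iso_app Φ Ψ G _) (map_iso_app Ψ ((map Φ).map f) a)).symm)
  refine (Category.comp_id _).trans (Eq.trans ?_ (Category.id_comp _).symm)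
  exact congrArg Ψ.functor.map (map_iso_app Φ f a).symm

lemma comp₃_iso_app {V : BMCat.{v, u}} {F G E L : SFOver V} (f : F ⟶ G) (g : G ⟶ E) (h : E ⟶ L) (a : F.A) :
    (Hom.iso (f ≫ g ≫ h)).hom.app a =
      ((Hom.iso h).hom.app ((Hom.H g).functor.obj ((Hom.H f).functor.obj a)) ≫
        (Hom.iso g).hom.app ((Hom.H f).functor.obj a)) ≫ (Hom.iso f).hom.app a :=
  (comp_iso_app f (g ≫ h) a).trans (congrArg₂ (· ≫ ·) (comp_iso_app g h _) rfl)

lemma whisker_whiskerLeft {U V W : BMCat.{v, u}} (Φ : U ⟶ V) {Ψ Θ : V ⟶ W} (τ : Ψ ⟶ Θ)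
    (F : SFOver U) : whisker (Φ ◁ τ) F =
      (mapCompIso Φ Θ F).hom ≫ whisker τ (mapObj Φ F) ≫ (mapCompIso Φ Ψ F).inv := by
  refine Hom.ext' (((SFFunctor.id_comp _).trans (SFFunctor.id_comp _)).symm)
    fun a => heq_of_eq ?_
  refine (whisker_iso_app (Φ ◁ τ) F a).trans (Eq.trans ?_
    (comp₃_iso_app (mapCompIso Φ Θ F).hom (whisker τ (mapObj Φ F)) (mapCompIso Φ Ψ F).inv a).symm)
  refine Eq.trans ?_ (congrArg₂ (· ≫ ·) (congrArg₂ (· ≫ ·) (mapCompIso_inv_iso_app Φ Ψ F a)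
    (whisker_iso_app τ (mapObj Φ F) a)) (mapCompIso_hom_iso_app Φ Θ F a)).symm
  exact ((Category.comp_id _).trans (Category.id_comp _)).symm

lemma whisker_whiskerRight {U V W : BMCat.{v, u}} {Φ Ψ : U ⟶ V} (τ : Φ ⟶ Ψ) (Θ : V ⟶ W)
    (F : SFOver U) : whisker (τ ▷ Θ) F =
      (mapCompIso Ψ Θ F).hom ≫ (map Θ).map (whisker τ F) ≫ (mapCompIso Φ Θ F).inv := by
  refine Hom.ext' (((SFFunctor.id_comp _).trans (SFFunctor.id_comp _)).symm)
    fun a => heq_of_eq ?_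
  refine (whisker_iso_app (τ ▷ Θ) F a).trans (Eq.trans ?_ (comp₃_iso_app
    (mapCompIso Ψ Θ F).hom ((map Θ).map (whisker τ F)) (mapCompIso Φ Θ F).inv a).symm)
  refine Eq.trans ?_ (congrArg₂ (· ≫ ·) (congrArg₂ (· ≫ ·) (mapCompIso_inv_iso_app Φ Θ F a)
    ((map_iso_app Θ (whisker τ F) a).trans (congrArg Θ.functor.map (whisker_iso_app τ F a))))
    (mapCompIso_hom_iso_app Ψ Θ F a)).symm
  exact ((Category.comp_id _).trans (Category.id_comp _)).symm

lemma whisker_associator {U V W X : BMCat.{v, u}} (Φ : U ⟶ V) (Ψ : V ⟶ W) (Θ : W ⟶ X)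
    (F : SFOver U) : whisker (α_ Φ Ψ Θ).hom F =
      ((mapCompIso Φ (Ψ ≫ Θ) F).hom ≫ (mapCompIso Ψ Θ (mapObj Φ F)).hom) ≫
        (map Θ).map (mapCompIso Φ Ψ F).inv ≫ (mapCompIso (Φ ≫ Ψ) Θ F).inv := by
  refine Hom.ext' ((((SFFunctor.comp_assoc _ _ _).trans (SFFunctor.id_comp _)).trans (SFFunctor.id_comp _)).trans
    (SFFunctor.id_comp _)).symm fun a => heq_of_eq ?_
  refine (whisker_iso_app (α_ Φ Ψ Θ).hom F a).trans (Eq.trans ?_ (comp₃_iso_app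
    ((mapCompIso Φ (Ψ ≫ Θ) F).hom ≫ (mapCompIso Ψ Θ (mapObj Φ F)).hom)
    ((map Θ).map (mapCompIso Φ Ψ F).inv) (mapCompIso (Φ ≫ Ψ) Θ F).inv a).symm)
  refine Eq.trans ?_ (congrArg₂ (· ≫ ·) (congrArg₂ (· ≫ ·) (mapCompIso_inv_iso_app (Φ ≫ Ψ) Θ F a)
    ((map_iso_app Θ (mapCompIso Φ Ψ F).inv a).trans ((congrArg Θ.functor.map
      (mapCompIso_inv_iso_app Φ Ψ F a)).trans (CategoryTheory.Functor.map_id _ _))))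
    ((comp_iso_app (mapCompIso Φ (Ψ ≫ Θ) F).hom (mapCompIso Ψ Θ (mapObj Φ F)).hom a).trans
      (congrArg₂ (· ≫ ·) (mapCompIso_hom_iso_app Ψ Θ (mapObj Φ F) a)
        (mapCompIso_hom_iso_app Φ (Ψ ≫ Θ) F a)))).symm
  exact ((congrArg₂ (· ≫ ·) (Category.comp_id _) (Category.comp_id _)).trans
    (Category.comp_id _)).symm

lemma whisker_leftUnitor {V W : BMCat.{v, u}} (Φ : V ⟶ W) (F : SFOver V) :
    whisker (Bicategory.leftUnitor Φ).hom F = (map Φ).map (mapIdIso V F).inv ≫ (mapCompIso (𝟙 V) Φ F).inv := by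
  refine Hom.ext' (SFFunctor.id_comp _).symm fun a => heq_of_eq ?_
  refine (whisker_iso_app (Bicategory.leftUnitor Φ).hom F a).trans (Eq.trans ?_ (comp_iso_app
    ((map Φ).map (mapIdIso V F).inv) (mapCompIso (𝟙 V) Φ F).inv a).symm)
  refine Eq.trans ?_ (congrArg₂ (· ≫ ·) (mapCompIso_inv_iso_app (𝟙 V) Φ F a)
    ((map_iso_app Φ (mapIdIso V F).inv a).trans ((congrArg Φ.functor.map
      (mapIdIso_inv_iso_app V F a)).trans (CategoryTheory.Functor.map_id _ _)))).symm
  exact (Category.comp_id _).symm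

lemma whisker_rightUnitor {V W : BMCat.{v, u}} (Φ : V ⟶ W) (F : SFOver V) :
    whisker (Bicategory.rightUnitor Φ).hom F = (mapIdIso W (mapObj Φ F)).inv ≫ (mapCompIso Φ (𝟙 W) F).inv := by
  refine Hom.ext' (SFFunctor.id_comp _).symm fun a => heq_of_eq ?_
  refine (whisker_iso_app (Bicategory.rightUnitor Φ).hom F a).trans (Eq.trans ?_ (comp_iso_app
    (mapIdIso W (mapObj Φ F)).inv (mapCompIso Φ (𝟙 W) F).inv a).symm)
  refine Eq.trans ?_ (congrArg₂ (· ≫ ·) (mapCompIso_inv_iso_app Φ (𝟙 W) F a)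
    (mapIdIso_inv_iso_app W (mapObj Φ F) a)).symm
  exact (Category.comp_id _).symm

/-- The 2-functor `V ↦ (sfmon ⫽ V)ᵒᵖ`. A 1-cell `Φ` acts by composition with `Φ`. A 2-cell
`τ : Φ ⟶ Ψ` acts by whiskering, which gives morphisms `Ψ F ⟶ Φ F` of `sfmon ⫽ W`, that is,
morphisms `Φ F ⟶ Ψ F` of the opposite category. -/
noncomputable def sfmonOp : BMCat.{v, u} ⥤ᵖ Cat.{v, max u (v + 1)} where
  obj V := Cat.of (SFOver V)ᵒᵖ
  map Φ := (map Φ).op.toCatHom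
  map₂ {V W Φ Ψ} τ := NatTrans.toCatHom₂
    { app := fun F => (whisker τ F.unop).op
      naturality := fun F G f => congrArg Quiver.Hom.op (whisker_naturality τ f.unop).symm }
  map₂_id {V W} Φ := by
    ext F
    exact congrArg Quiver.Hom.op (whisker_id Φ F.unop)
  map₂_comp {V W Φ Ψ Θ} σ τ := by
    ext F
    exact congrArg Quiver.Hom.op (whisker_comp σ τ F.unop)
  mapId V := Cat.Hom.isoMk (NatIso.ofComponents (fun F => (mapIdIso V F.unop).op.symm)
    (fun {F G} f => congrArg Quiver.Hom.op (mapIdIso_naturality V f.unop)))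
  mapComp Φ Ψ := Cat.Hom.isoMk (NatIso.ofComponents
    (fun F => (mapCompIso Φ Ψ F.unop).op.symm)
    (fun {F G} f => congrArg Quiver.Hom.op (mapCompIso_naturality Φ Ψ f.unop)))
  map₂_whisker_left Φ _ _ τ := by
    ext F
    refine (congrArg Quiver.Hom.op (whisker_whiskerLeft Φ τ F.unop)).trans ?_
    exact (Category.assoc (obj := (SFOver _)ᵒᵖ) _ _ _)
  map₂_whisker_right τ Θ := by
    ext F
    refine (congrArg Quiver.Hom.op (whisker_whiskerRight τ Θ F.unop)).trans ?_
    exact (Category.assoc (obj := (SFOver _)ᵒᵖ) _ _ _)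
  map₂_associator Φ Ψ Θ := by
    ext F
    refine (congrArg Quiver.Hom.op (whisker_associator Φ Ψ Θ F.unop)).trans ?_
    refine (Category.assoc (obj := (SFOver _)ᵒᵖ) _ _ _).trans ?_
    refine congrArg₂ (· ≫ ·) rfl (congrArg₂ (· ≫ ·) rfl ?_)
    exact (Category.id_comp (obj := (SFOver _)ᵒᵖ) _).symm
  map₂_left_unitor Φ := by
    ext F
    refine (congrArg Quiver.Hom.op (whisker_leftUnitor Φ F.unop)).trans ?_
    exact congrArg (fun k => (mapCompIso (𝟙 _) Φ F.unop).inv.op ≫ k)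
      (Category.comp_id (obj := (SFOver _)ᵒᵖ) _).symm
  map₂_right_unitor Φ := by
    ext F
    refine (congrArg Quiver.Hom.op (whisker_rightUnitor Φ F.unop)).trans ?_
    exact congrArg (fun k => (mapCompIso Φ (𝟙 _) F.unop).inv.op ≫ k)
      (Category.comp_id (obj := (SFOver _)ᵒᵖ) _).symm

end SFOver

/-- The data (without the axioms) of an algebra and coalgebra structure on an object. -/
structure PreBialgebra (C : Type u₁) [Category.{v₁} C] [MonoidalCategory C] where
  X : C
  mul : X ⊗ X ⟶ X
  one : 𝟙_ C ⟶ X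
  comul : X ⟶ X ⊗ X
  counit : X ⟶ 𝟙_ C

namespace PreBialgebra

variable {C : Type u₁} [Category.{v₁} C] [MonoidalCategory C] [BraidedCategory C]

/-- The comultiplication of the unit. -/
def comulOne (B : PreBialgebra C) : 𝟙_ C ⟶ B.X ⊗ B.X := B.one ≫ B.comul

lemma comulOne_def {C : Type u₁} [Category.{v₁} C] [MonoidalCategory C]
    (B : PreBialgebra C) : B.comulOne = B.one ≫ B.comul := rfl

/-- The counit of a product. -/
def counitMul (B : PreBialgebra C) : B.X ⊗ B.X ⟶ 𝟙_ C := B.mul ≫ B.counit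

/-- The multiplication of the algebra `B ⊗ B`: in Sweedler notation
`(a ⊗ b) (c ⊗ d) = a c ⊗ b d`, where `b` is moved past `c` by the braiding `β_ B B`. -/
def mul₂ (B : PreBialgebra C) : (B.X ⊗ B.X) ⊗ (B.X ⊗ B.X) ⟶ B.X ⊗ B.X :=
  tensorμ B.X B.X B.X B.X ≫ (B.mul ⊗ₘ B.mul)

/-- The axioms of a weak bialgebra. The braiding in the weak unit axiom and in the weak counit axiom
is the inverse of the one in the bialgebra axiom `mul_comul`. -/
structure IsWeakBialgebra (B : PreBialgebra C) : Prop where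
  mul_assoc : B.mul ▷ B.X ≫ B.mul = (α_ B.X B.X B.X).hom ≫ B.X ◁ B.mul ≫ B.mul
  one_mul : B.one ▷ B.X ≫ B.mul = (λ_ B.X).hom
  mul_one : B.X ◁ B.one ≫ B.mul = (ρ_ B.X).hom
  comul_assoc : B.comul ≫ B.comul ▷ B.X ≫ (α_ B.X B.X B.X).hom = B.comul ≫ B.X ◁ B.comul
  counit_comul : B.comul ≫ B.counit ▷ B.X = (λ_ B.X).inv
  comul_counit : B.comul ≫ B.X ◁ B.counit = (ρ_ B.X).inv
  mul_comul : B.mul ≫ B.comul = (B.comul ⊗ₘ B.comul) ≫ B.mul₂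
  -- `1₁ ⊗ 1₂ ⊗ 1₃ = 1₁ ⊗ 1₂ e₁ ⊗ e₂`, where `e₁ ⊗ e₂` is another copy of `1₁ ⊗ 1₂`
  weak_unit : B.comulOne ≫ B.comul ▷ B.X =
    (λ_ (𝟙_ C)).inv ≫ (B.comulOne ⊗ₘ B.comulOne) ≫ (α_ B.X B.X (B.X ⊗ B.X)).hom ≫
      B.X ◁ ((α_ B.X B.X B.X).inv ≫ B.mul ▷ B.X) ≫ (α_ B.X B.X B.X).inv
  -- `1₁ ⊗ 1₂ ⊗ 1₃ = 1₁ ⊗ e₁ 1₂ ⊗ e₂`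
  weak_unit_braided : B.comulOne ≫ B.comul ▷ B.X =
    (λ_ (𝟙_ C)).inv ≫ (B.comulOne ⊗ₘ B.comulOne) ≫ (α_ B.X B.X (B.X ⊗ B.X)).hom ≫
      B.X ◁ ((α_ B.X B.X B.X).inv ≫ ((β_ B.X B.X).inv ≫ B.mul) ▷ B.X) ≫ (α_ B.X B.X B.X).inv
  -- `ε(a b c) = ε(a b₁) ε(b₂ c)`
  weak_counit : B.mul ▷ B.X ≫ B.counitMul =
    ((B.X ◁ B.comul) ≫ (α_ B.X B.X B.X).inv) ▷ B.X ≫ (α_ (B.X ⊗ B.X) B.X B.X).hom ≫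
      (B.counitMul ⊗ₘ B.counitMul) ≫ (λ_ (𝟙_ C)).hom
  -- `ε(a b c) = ε(a b₂) ε(b₁ c)`
  weak_counit_braided : B.mul ▷ B.X ≫ B.counitMul =
    ((B.X ◁ (B.comul ≫ (β_ B.X B.X).inv)) ≫ (α_ B.X B.X B.X).inv) ▷ B.X ≫
      (α_ (B.X ⊗ B.X) B.X B.X).hom ≫ (B.counitMul ⊗ₘ B.counitMul) ≫ (λ_ (𝟙_ C)).hom

/-- The canonical idempotent `h ↦ 1₁ ε(1₂ h)`. -/
def idemS (B : PreBialgebra C) : B.X ⟶ B.X :=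
  (λ_ B.X).inv ≫ B.comulOne ▷ B.X ≫ (α_ B.X B.X B.X).hom ≫ B.X ◁ B.counitMul ≫ (ρ_ B.X).hom

/-- The canonical idempotent `h ↦ ε(h 1₁) 1₂`. -/
def idemZ (B : PreBialgebra C) : B.X ⟶ B.X :=
  (ρ_ B.X).inv ≫ B.X ◁ B.comulOne ≫ (α_ B.X B.X B.X).inv ≫ B.counitMul ▷ B.X ≫ (λ_ B.X).hom

/-- The canonical idempotent `h ↦ ε(1₁ h) 1₂`. -/
def idemT (B : PreBialgebra C) : B.X ⟶ B.X :=
  (λ_ B.X).inv ≫ B.comulOne ▷ B.X ≫ (α_ B.X B.X B.X).hom ≫ B.X ◁ (β_ B.X B.X).hom ≫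
    (α_ B.X B.X B.X).inv ≫ B.counitMul ▷ B.X ≫ (λ_ B.X).hom

/-- The canonical idempotent `h ↦ 1₁ ε(h 1₂)`. -/
def idemR (B : PreBialgebra C) : B.X ⟶ B.X :=
  (ρ_ B.X).inv ≫ B.X ◁ B.comulOne ≫ (α_ B.X B.X B.X).inv ≫ (β_ B.X B.X).hom ▷ B.X ≫
    (α_ B.X B.X B.X).hom ≫ B.X ◁ B.counitMul ≫ (ρ_ B.X).hom

/-- Weak morphisms of weak bialgebras. -/
structure IsWeakMorphism (H J : PreBialgebra C) (f : H.X ⟶ J.X) : Prop where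
  idemS : H.idemS ≫ f = f ≫ J.idemS
  idemZ : H.idemZ ≫ f = f ≫ J.idemZ
  idemT : H.idemT ≫ f = f ≫ J.idemT
  idemR : H.idemR ≫ f = f ≫ J.idemR
  map_mul : H.mul ≫ f = (f ⊗ₘ f) ≫ J.mul
  map_one : H.one ≫ f = J.one
  -- `Δ (f h) = Δ 1 · (f ⊗ f) (Δ h)`
  comul_left : f ≫ J.comul =
    (λ_ H.X).inv ≫ (J.comulOne ⊗ₘ (H.comul ≫ (f ⊗ₘ f))) ≫ J.mul₂
  -- `Δ (f h) = (f ⊗ f) (Δ h) · Δ 1`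
  comul_right : f ≫ J.comul =
    (ρ_ H.X).inv ≫ ((H.comul ≫ (f ⊗ₘ f)) ⊗ₘ J.comulOne) ≫ J.mul₂

/-- Strong morphisms of weak bialgebras. -/
structure IsStrongMorphism (H J : PreBialgebra C) (f : H.X ⟶ J.X) : Prop where
  map_mul : H.mul ≫ f = (f ⊗ₘ f) ≫ J.mul
  map_one : H.one ≫ f = J.one
  map_comul : f ≫ J.comul = H.comul ≫ (f ⊗ₘ f)
  map_counit : f ≫ J.counit = H.counit

section

variable {C : Type u₁} [Category.{v₁} C] [MonoidalCategory C]

lemma mul_assoc_aux_left {T X : C} {m : T ⊗ T ⟶ T}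
    (hm : m ▷ T ≫ m = (α_ T T T).hom ≫ T ◁ m ≫ m) (a b : 𝟙_ C ⟶ T) (c : X ⟶ T) :
    (λ_ X).inv ≫ (a ⊗ₘ ((λ_ X).inv ≫ (b ⊗ₘ c) ≫ m)) ≫ m =
      (λ_ X).inv ≫ (((λ_ (𝟙_ C)).inv ≫ (a ⊗ₘ b) ≫ m) ⊗ₘ c) ≫ m := by
  have h₁ : (((λ_ (𝟙_ C)).inv ≫ (a ⊗ₘ b) ≫ m) ⊗ₘ c) =
      (λ_ (𝟙_ C)).inv ▷ X ≫ ((a ⊗ₘ b) ⊗ₘ c) ≫ m ▷ T := by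
    simp only [← tensorHom_id, tensorHom_comp_tensorHom, Category.comp_id, Category.id_comp]
  have h₂ : (a ⊗ₘ ((λ_ X).inv ≫ (b ⊗ₘ c) ≫ m)) =
      (𝟙_ C) ◁ (λ_ X).inv ≫ (a ⊗ₘ (b ⊗ₘ c)) ≫ T ◁ m := by
    simp only [← id_tensorHom, tensorHom_comp_tensorHom, Category.comp_id, Category.id_comp]
  rw [h₁, h₂]
  simp only [Category.assoc]
  rw [hm, associator_naturality_assoc]
  simp

lemma mul_assoc_aux_right {T X : C} {m : T ⊗ T ⟶ T}
    (hm : m ▷ T ≫ m = (α_ T T T).hom ≫ T ◁ m ≫ m) (a b : 𝟙_ C ⟶ T) (c : X ⟶ T) :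
    (ρ_ X).inv ≫ (((ρ_ X).inv ≫ (c ⊗ₘ a) ≫ m) ⊗ₘ b) ≫ m =
      (ρ_ X).inv ≫ (c ⊗ₘ ((ρ_ (𝟙_ C)).inv ≫ (a ⊗ₘ b) ≫ m)) ≫ m := by
  have h₁ : (((ρ_ X).inv ≫ (c ⊗ₘ a) ≫ m) ⊗ₘ b) =
      (ρ_ X).inv ▷ (𝟙_ C) ≫ ((c ⊗ₘ a) ⊗ₘ b) ≫ m ▷ T := by
    simp only [← tensorHom_id, tensorHom_comp_tensorHom, Category.comp_id, Category.id_comp]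
  have h₂ : (c ⊗ₘ ((ρ_ (𝟙_ C)).inv ≫ (a ⊗ₘ b) ≫ m)) =
      X ◁ (ρ_ (𝟙_ C)).inv ≫ (c ⊗ₘ (a ⊗ₘ b)) ≫ T ◁ m := by
    simp only [← id_tensorHom, tensorHom_comp_tensorHom, Category.comp_id, Category.id_comp]
  rw [h₁, h₂]
  simp only [Category.assoc]
  rw [hm, associator_naturality_assoc]
  simp

end

lemma map_mul₂ {H J : PreBialgebra C} {f : H.X ⟶ J.X} (h : H.mul ≫ f = (f ⊗ₘ f) ≫ J.mul) :
    H.mul₂ ≫ (f ⊗ₘ f) = ((f ⊗ₘ f) ⊗ₘ (f ⊗ₘ f)) ≫ J.mul₂ := by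
  simp only [mul₂, Category.assoc, tensorHom_comp_tensorHom, h, tensorμ_natural_assoc]

lemma IsWeakBialgebra.mul₂_assoc {B : PreBialgebra C} (hB : B.IsWeakBialgebra) :
    B.mul₂ ▷ (B.X ⊗ B.X) ≫ B.mul₂ = (α_ _ _ _).hom ≫ (B.X ⊗ B.X) ◁ B.mul₂ ≫ B.mul₂ := by
  let _ : MonObj B.X := ⟨B.one, B.mul, hB.one_mul, hB.mul_one, hB.mul_assoc⟩
  exact MonObj.Mon_tensor_mul_assoc B.X B.X

lemma IsWeakBialgebra.comulOne_mul₂ {B : PreBialgebra C} (hB : B.IsWeakBialgebra) :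
    (λ_ B.X).inv ≫ (B.comulOne ⊗ₘ B.comul) ≫ B.mul₂ = B.comul := by
  rw [comulOne, ← MonoidalCategory.whiskerRight_comp_tensorHom_assoc, ← hB.mul_comul,
    reassoc_of% hB.one_mul, Iso.inv_hom_id_assoc]

lemma IsWeakBialgebra.mul₂_comulOne {B : PreBialgebra C} (hB : B.IsWeakBialgebra) :
    (ρ_ B.X).inv ≫ (B.comul ⊗ₘ B.comulOne) ≫ B.mul₂ = B.comul := by
  rw [comulOne, ← MonoidalCategory.whiskerLeft_comp_tensorHom_assoc, ← hB.mul_comul,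
    reassoc_of% hB.mul_one, Iso.inv_hom_id_assoc]

lemma IsStrongMorphism.isWeakMorphism {H J : PreBialgebra C} {f : H.X ⟶ J.X}
    (hH : H.IsWeakBialgebra) (h : IsStrongMorphism H J f) : IsWeakMorphism H J f := by
  have h₁ : J.comulOne = H.comulOne ≫ (f ⊗ₘ f) := by
    rw [comulOne, comulOne, Category.assoc, ← h.map_comul, reassoc_of% h.map_one]
  have h₂ : (f ⊗ₘ f) ≫ J.counitMul = H.counitMul := by
    rw [counitMul, counitMul, ← reassoc_of% h.map_mul, h.map_counit]
  have l₁ : f ≫ (λ_ J.X).inv ≫ J.comulOne ▷ J.X =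
      (λ_ H.X).inv ≫ H.comulOne ▷ H.X ≫ ((f ⊗ₘ f) ⊗ₘ f) := by
    rw [h₁, leftUnitor_inv_naturality_assoc, whisker_exchange, MonoidalCategory.comp_whiskerRight,
      Category.assoc, MonoidalCategory.tensorHom_def (f ⊗ₘ f) f]
  have r₁ : f ≫ (ρ_ J.X).inv ≫ J.X ◁ J.comulOne =
      (ρ_ H.X).inv ≫ H.X ◁ H.comulOne ≫ (f ⊗ₘ (f ⊗ₘ f)) := by
    rw [h₁, rightUnitor_inv_naturality_assoc, ← whisker_exchange,
      MonoidalCategory.whiskerLeft_comp, Category.assoc,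
      MonoidalCategory.tensorHom_def' f (f ⊗ₘ f)]
  have r₂ : (f ⊗ₘ (f ⊗ₘ f)) ≫ J.X ◁ J.counitMul ≫ (ρ_ J.X).hom =
      H.X ◁ H.counitMul ≫ (ρ_ H.X).hom ≫ f := by
    rw [← h₂, ← rightUnitor_naturality, MonoidalCategory.tensorHom_def' f (f ⊗ₘ f),
      MonoidalCategory.whiskerLeft_comp]
    simp only [Category.assoc]
    rw [← whisker_exchange_assoc]
  have l₂ : ((f ⊗ₘ f) ⊗ₘ f) ≫ J.counitMul ▷ J.X ≫ (λ_ J.X).hom =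
      H.counitMul ▷ H.X ≫ (λ_ H.X).hom ≫ f := by
    rw [← h₂, ← leftUnitor_naturality, MonoidalCategory.tensorHom_def (f ⊗ₘ f) f,
      MonoidalCategory.comp_whiskerRight]
    simp only [Category.assoc]
    rw [whisker_exchange_assoc]
  have a := MonoidalCategory.associator_naturality f f f
  have a' := MonoidalCategory.associator_inv_naturality f f f
  have b : (f ⊗ₘ (f ⊗ₘ f)) ≫ J.X ◁ (β_ J.X J.X).hom = H.X ◁ (β_ H.X H.X).hom ≫
      (f ⊗ₘ (f ⊗ₘ f)) := by
    rw [MonoidalCategory.tensorHom_comp_whiskerLeft, MonoidalCategory.whiskerLeft_comp_tensorHom,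
      BraidedCategory.braiding_naturality]
  have b' : ((f ⊗ₘ f) ⊗ₘ f) ≫ (β_ J.X J.X).hom ▷ J.X = (β_ H.X H.X).hom ▷ H.X ≫
      ((f ⊗ₘ f) ⊗ₘ f) := by
    rw [MonoidalCategory.tensorHom_comp_whiskerRight,
      MonoidalCategory.whiskerRight_comp_tensorHom, BraidedCategory.braiding_naturality]
  refine ⟨?_, ?_, ?_, ?_, h.map_mul, h.map_one, ?_, ?_⟩
  · simp only [idemS, Category.assoc]
    rw [reassoc_of% l₁, reassoc_of% a, r₂]
  · simp only [idemZ, Category.assoc]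
    rw [reassoc_of% r₁, reassoc_of% a', l₂]
  · simp only [idemT, Category.assoc]
    rw [reassoc_of% l₁, reassoc_of% a, reassoc_of% b, reassoc_of% a', l₂]
  · simp only [idemR, Category.assoc]
    rw [reassoc_of% r₁, reassoc_of% a', reassoc_of% b', reassoc_of% a, r₂]
  · rw [h₁, ← MonoidalCategory.tensorHom_comp_tensorHom_assoc, ← map_mul₂ h.map_mul,
      reassoc_of% hH.comulOne_mul₂, h.map_comul]
  · rw [h₁, ← MonoidalCategory.tensorHom_comp_tensorHom_assoc, ← map_mul₂ h.map_mul,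
      reassoc_of% hH.mul₂_comulOne, h.map_comul]

lemma IsStrongMorphism.id {C : Type u₁} [Category.{v₁} C] [MonoidalCategory C]
    (B : PreBialgebra C) : IsStrongMorphism B B (𝟙 B.X) :=
  ⟨by simp, by simp, by simp, by simp⟩

lemma IsWeakMorphism.comp {H J K : PreBialgebra C} {f : H.X ⟶ J.X} {g : J.X ⟶ K.X}
    (hK : K.IsWeakBialgebra) (hf : IsWeakMorphism H J f) (hg : IsWeakMorphism J K g) :
    IsWeakMorphism H K (f ≫ g) where
  idemS := by rw [reassoc_of% hf.idemS, hg.idemS, Category.assoc]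
  idemZ := by rw [reassoc_of% hf.idemZ, hg.idemZ, Category.assoc]
  idemT := by rw [reassoc_of% hf.idemT, hg.idemT, Category.assoc]
  idemR := by rw [reassoc_of% hf.idemR, hg.idemR, Category.assoc]
  map_mul := by
    rw [reassoc_of% hf.map_mul, hg.map_mul, MonoidalCategory.tensorHom_comp_tensorHom_assoc]
  map_one := by rw [reassoc_of% hf.map_one, hg.map_one]
  comul_left := by
    have h₁ : (λ_ (𝟙_ C)).inv ≫ (K.comulOne ⊗ₘ (J.comulOne ≫ (g ⊗ₘ g))) ≫ K.mul₂ = K.comulOne := by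
      have := J.one ≫= hg.comul_left
      rw [reassoc_of% hg.map_one, leftUnitor_inv_naturality_assoc,
        MonoidalCategory.whiskerLeft_comp_tensorHom_assoc] at this
      rw [J.comulOne_def, Category.assoc, ← this, K.comulOne_def]
    have h₂ : f ≫ J.comul ≫ (g ⊗ₘ g) = (λ_ H.X).inv ≫
        ((J.comulOne ≫ (g ⊗ₘ g)) ⊗ₘ (H.comul ≫ ((f ≫ g) ⊗ₘ (f ≫ g)))) ≫ K.mul₂ := by
      rw [reassoc_of% hf.comul_left, map_mul₂ hg.map_mul,
        MonoidalCategory.tensorHom_comp_tensorHom_assoc, Category.assoc,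
        MonoidalCategory.tensorHom_comp_tensorHom]
    rw [Category.assoc, hg.comul_left, leftUnitor_inv_naturality_assoc,
      MonoidalCategory.whiskerLeft_comp_tensorHom_assoc, h₂]
    conv_rhs => rw [← h₁]
    exact mul_assoc_aux_left hK.mul₂_assoc _ _ _
  comul_right := by
    have h₁ : (ρ_ (𝟙_ C)).inv ≫ ((J.comulOne ≫ (g ⊗ₘ g)) ⊗ₘ K.comulOne) ≫ K.mul₂ = K.comulOne := by
      have := J.one ≫= hg.comul_right
      rw [reassoc_of% hg.map_one, rightUnitor_inv_naturality_assoc,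
        MonoidalCategory.whiskerRight_comp_tensorHom_assoc] at this
      rw [J.comulOne_def, Category.assoc, ← this, K.comulOne_def]
    have h₂ : f ≫ J.comul ≫ (g ⊗ₘ g) = (ρ_ H.X).inv ≫
        ((H.comul ≫ ((f ≫ g) ⊗ₘ (f ≫ g))) ⊗ₘ (J.comulOne ≫ (g ⊗ₘ g))) ≫ K.mul₂ := by
      rw [reassoc_of% hf.comul_right, map_mul₂ hg.map_mul,
        MonoidalCategory.tensorHom_comp_tensorHom_assoc, Category.assoc,
        MonoidalCategory.tensorHom_comp_tensorHom]
    rw [Category.assoc, hg.comul_right, rightUnitor_inv_naturality_assoc,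
      MonoidalCategory.whiskerRight_comp_tensorHom_assoc, h₂]
    conv_rhs => rw [← h₁]
    exact mul_assoc_aux_right hK.mul₂_assoc _ _ _

end PreBialgebra

/-- The image of an algebra and coalgebra under a monoidal and comonoidal functor. -/
abbrev SFFunctor.mapPre {C : Type u₁} [Category.{v₁} C] [MonoidalCategory C]
    {D : Type u₂} [Category.{v₂} D] [MonoidalCategory D] (Φ : SFFunctor C D)
    (B : PreBialgebra C) : PreBialgebra D where
  X := Φ.functor.obj B.X
  mul := μ Φ.functor B.X B.X ≫ Φ.functor.map B.mul
  one := ε Φ.functor ≫ Φ.functor.map B.one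
  comul := Φ.functor.map B.comul ≫ δ Φ.functor B.X B.X
  counit := Φ.functor.map B.counit ≫ η Φ.functor

/-- The objects of `wba V`: the weak bialgebras in `V`. -/
structure WBA (V : BMCat.{v, u}) : Type (max u (v + 1)) where
  toPre : PreBialgebra V
  isWeakBialgebra : toPre.IsWeakBialgebra

namespace WBA

open PreBialgebra

/-- The morphisms of `wba V`: the weak morphisms of weak bialgebras. -/
@[ext]
structure Hom {V : BMCat.{v, u}} (H J : WBA V) where
  hom : H.toPre.X ⟶ J.toPre.X
  isWeakMorphism : IsWeakMorphism H.toPre J.toPre hom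

instance (V : BMCat.{v, u}) : Category (WBA V) where
  Hom := Hom
  id H := ⟨𝟙 H.toPre.X, (IsStrongMorphism.id _).isWeakMorphism H.isWeakBialgebra⟩
  comp {_ _ K} f g := ⟨f.hom ≫ g.hom, f.isWeakMorphism.comp K.isWeakBialgebra g.isWeakMorphism⟩
  id_comp _ := Hom.ext (Category.id_comp _)
  comp_id _ := Hom.ext (Category.comp_id _)
  assoc _ _ _ := Hom.ext (Category.assoc _ _ _)

/-- Braided separable Frobenius functors preserve weak bialgebras and weak morphisms. -/
structure Preserved : Prop where
  obj {V W : BMCat.{v, u}} (Φ : V ⟶ W) (B : WBA V) :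
    (Φ.toSFFunctor.mapPre B.toPre).IsWeakBialgebra
  map {V W : BMCat.{v, u}} (Φ : V ⟶ W) {H J : WBA V} (f : H ⟶ J) :
    IsWeakMorphism (Φ.toSFFunctor.mapPre H.toPre) (Φ.toSFFunctor.mapPre J.toPre)
      (Φ.functor.map f.hom)

lemma isStrongMorphism_app {V W : BMCat.{v, u}} {Φ Ψ : V ⟶ W} (τ : Φ ⟶ Ψ) (B : PreBialgebra V) :
    IsStrongMorphism (Φ.toSFFunctor.mapPre B) (Ψ.toSFFunctor.mapPre B) (τ.nat.app B.X) where
  map_mul := by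
    rw [Category.assoc, τ.nat.naturality, reassoc_of% τ.bimonoidal.tensor]
  map_one := by
    rw [Category.assoc, τ.nat.naturality, reassoc_of% τ.bimonoidal.unit]
  map_comul := by
    rw [Category.assoc, ← τ.bimonoidal.cotensor, τ.nat.naturality_assoc]
  map_counit := by
    rw [← τ.nat.naturality_assoc, τ.bimonoidal.counit]

/-- Strong isomorphisms are isomorphisms in `wba V`. -/
def isoMk {V : BMCat.{v, u}} {H J : WBA V} (e : H.toPre.X ≅ J.toPre.X)
    (h : IsStrongMorphism H.toPre J.toPre e.hom) (h' : IsStrongMorphism J.toPre H.toPre e.inv) :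
    H ≅ J where
  hom := ⟨e.hom, h.isWeakMorphism H.isWeakBialgebra⟩
  inv := ⟨e.inv, h'.isWeakMorphism J.isWeakBialgebra⟩
  hom_inv_id := Hom.ext e.hom_inv_id
  inv_hom_id := Hom.ext e.inv_hom_id

/-- The action of a 1-cell on weak bialgebras. -/
def mapObj (h : Preserved.{v, u}) {V W : BMCat.{v, u}} (Φ : V ⟶ W) (B : WBA V) : WBA W :=
  ⟨Φ.toSFFunctor.mapPre B.toPre, h.obj Φ B⟩

/-- The functor `wba V ⥤ wba W` induced by a 1-cell. -/
def map (h : Preserved.{v, u}) {V W : BMCat.{v, u}} (Φ : V ⟶ W) : WBA V ⥤ WBA W where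
  obj B := mapObj h Φ B
  map f := ⟨Φ.functor.map f.hom, h.map Φ f⟩
  map_id _ := Hom.ext (Φ.functor.map_id _)
  map_comp f g := Hom.ext (Φ.functor.map_comp f.hom g.hom)

/-- The natural transformation induced by a 2-cell. -/
def map₂ (h : Preserved.{v, u}) {V W : BMCat.{v, u}} {Φ Ψ : V ⟶ W} (τ : Φ ⟶ Ψ) :
    map h Φ ⟶ map h Ψ where
  app B := ⟨τ.nat.app B.toPre.X, (isStrongMorphism_app τ B.toPre).isWeakMorphism (h.obj Φ B)⟩
  naturality _ _ f := Hom.ext (τ.nat.naturality f.hom)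

lemma isStrongMorphism_mapId {V : BMCat.{v, u}} (B : PreBialgebra V) :
    IsStrongMorphism ((SFFunctor.id V).mapPre B) B (𝟙 B.X) :=
  ⟨by simp, by simp, by simp, by simp⟩

lemma isStrongMorphism_mapId_inv {V : BMCat.{v, u}} (B : PreBialgebra V) :
    IsStrongMorphism B ((SFFunctor.id V).mapPre B) (𝟙 B.X) :=
  ⟨by simp, by simp, by simp, by simp⟩

lemma isStrongMorphism_mapComp {U V W : BMCat.{v, u}} (Φ : SFFunctor U V) (Ψ : SFFunctor V W)
    (B : PreBialgebra U) : IsStrongMorphism ((Φ.comp Ψ).mapPre B) (Ψ.mapPre (Φ.mapPre B))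
      (𝟙 (Ψ.functor.obj (Φ.functor.obj B.X))) :=
  ⟨by simp, by simp, by simp, by simp⟩

lemma isStrongMorphism_mapComp_inv {U V W : BMCat.{v, u}} (Φ : SFFunctor U V)
    (Ψ : SFFunctor V W) (B : PreBialgebra U) :
    IsStrongMorphism (Ψ.mapPre (Φ.mapPre B)) ((Φ.comp Ψ).mapPre B)
      (𝟙 (Ψ.functor.obj (Φ.functor.obj B.X))) :=
  ⟨by simp, by simp, by simp, by simp⟩

/-- The 2-functor `wba`. A 2-cell `τ` acts by its components `τ.app B`. -/
def wba (h : Preserved.{v, u}) : Pseudofunctor BMCat.{v, u} Cat.{v, max u (v + 1)} where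
  obj V := Cat.of (WBA V)
  map Φ := (map h Φ).toCatHom
  map₂ τ := (map₂ h τ).toCatHom₂
  map₂_id Φ := by
    ext B
    exact Hom.ext rfl
  map₂_comp σ τ := by
    ext B
    exact Hom.ext rfl
  mapId V := Cat.Hom.isoMk (NatIso.ofComponents
    (fun B => isoMk (Iso.refl B.toPre.X) (isStrongMorphism_mapId B.toPre)
      (isStrongMorphism_mapId_inv B.toPre))
    (fun f => Hom.ext ((Category.comp_id _).trans (Category.id_comp _).symm)))
  mapComp Φ Ψ := Cat.Hom.isoMk (NatIso.ofComponents
    (fun B => isoMk (Iso.refl (Ψ.functor.obj (Φ.functor.obj B.toPre.X)))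
      (isStrongMorphism_mapComp Φ.toSFFunctor Ψ.toSFFunctor B.toPre)
      (isStrongMorphism_mapComp_inv Φ.toSFFunctor Ψ.toSFFunctor B.toPre))
    (fun f => Hom.ext ((Category.comp_id _).trans (Category.id_comp _).symm)))
  map₂_whisker_left Φ _ _ τ := by
    ext B
    exact Hom.ext ((Category.id_comp _).trans (Category.comp_id _)).symm
  map₂_whisker_right τ Θ := by
    ext B
    exact Hom.ext ((Category.id_comp _).trans (Category.comp_id _)).symm
  map₂_associator Φ Ψ Θ := by
    ext B
    refine Hom.ext (((Category.id_comp _).trans (congrArg₂ (· ≫ ·) (Θ.functor.map_id _)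
      ((Category.id_comp _).trans (Category.id_comp _)))).trans (Category.id_comp _)).symm
  map₂_left_unitor Φ := by
    ext B
    exact Hom.ext ((Category.id_comp _).trans ((Category.comp_id _).trans
      (Φ.functor.map_id _))).symm
  map₂_right_unitor Φ := by
    ext B
    exact Hom.ext ((Category.id_comp _).trans (Category.id_comp _)).symm

end WBA

namespace SFOver

section Tan

lemma tensorRightHomEquiv_symm_comp_mate {D : Type u₂} [Category.{v₂} D] [MonoidalCategory D]
    {X P Q Z : D} [HasRightDual P] [HasRightDual Q] (f : P ⟶ Q) (g : X ⟶ Z ⊗ Qᘁ) :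
    (tensorRightHomEquiv X P Pᘁ Z).symm (g ≫ Z ◁ fᘁ) =
      X ◁ f ≫ (tensorRightHomEquiv X Q Qᘁ Z).symm g := by
  change (g ≫ Z ◁ fᘁ) ▷ P ≫ (α_ _ _ _).hom ≫ Z ◁ ε_ P Pᘁ ≫ (ρ_ _).hom =
    X ◁ f ≫ g ▷ Q ≫ (α_ _ _ _).hom ≫ Z ◁ ε_ Q Qᘁ ≫ (ρ_ _).hom
  rw [whisker_exchange_assoc]
  simp only [comp_whiskerRight, whisker_assoc, Category.assoc, Iso.inv_hom_id_assoc,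
    tensor_whiskerLeft]
  rw [← MonoidalCategory.whiskerLeft_comp_assoc, ← MonoidalCategory.whiskerLeft_comp_assoc,
    rightAdjointMate_comp_evaluation]

variable {V : BMCat.{v, u}} (F : SFOver V)

/-- The functor `(a, b) ↦ F b ⊗ (F a)ᘁ`. -/
noncomputable abbrev endFunctor : F.Aᵒᵖ ⥤ F.A ⥤ V where
  obj a :=
    { obj := fun b => F.F.functor.obj b ⊗ (F.F.functor.obj a.unop)ᘁ
      map := fun g => F.F.functor.map g ▷ (F.F.functor.obj a.unop)ᘁ }
  map {a a'} f :=
    { app := fun b => F.F.functor.obj b ◁ (F.F.functor.map f.unop)ᘁ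
      naturality := fun b b' g => (whisker_exchange _ _).symm }
  map_id a := by
    ext b
    simp
  map_comp f g := by
    ext b
    simp [comp_rightAdjointMate]

/-- The object `tan F`, the end of `F a ⊗ (F a)ᘁ`. -/
noncomputable def tanX : V := end_ F.endFunctor

/-- The projections of the end. -/
noncomputable def tanπ (x : F.A) : F.tanX ⟶ F.F.functor.obj x ⊗ (F.F.functor.obj x)ᘁ :=
  end_.π F.endFunctor x

lemma tanπ_condition {x y : F.A} (f : x ⟶ y) :
    F.tanπ x ≫ F.F.functor.map f ▷ (F.F.functor.obj x)ᘁ =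
      F.tanπ y ≫ F.F.functor.obj y ◁ (F.F.functor.map f)ᘁ :=
  end_.condition F.endFunctor f

/-- The canonical action of `tan F` on `F`. -/
noncomputable def act (x : F.A) : F.tanX ⊗ F.F.functor.obj x ⟶ F.F.functor.obj x :=
  (tensorRightHomEquiv _ _ (F.F.functor.obj x)ᘁ _).symm (F.tanπ x)

lemma act_naturality {x y : F.A} (f : x ⟶ y) :
    F.tanX ◁ F.F.functor.map f ≫ F.act y = F.act x ≫ F.F.functor.map f := by
  rw [act, ← tensorRightHomEquiv_symm_comp_mate, ← tanπ_condition, Equiv.symm_apply_eq,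
    tensorRightHomEquiv_naturality, act, Equiv.apply_symm_apply]

/-- The morphism `X ⟶ tan F` corresponding to a natural family of morphisms `X ⊗ F x ⟶ F x`. The
family is called the discharged form of the morphism. -/
noncomputable def lift {X : V} (a : ∀ x, X ⊗ F.F.functor.obj x ⟶ F.F.functor.obj x)
    (ha : ∀ ⦃x y : F.A⦄ (f : x ⟶ y), X ◁ F.F.functor.map f ≫ a y = a x ≫ F.F.functor.map f) :
    X ⟶ F.tanX :=
  end_.lift (F := F.endFunctor)
    (fun x => tensorRightHomEquiv _ _ (F.F.functor.obj x)ᘁ _ (a x)) (fun x y f => by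
      refine (tensorRightHomEquiv_naturality (a x) (F.F.functor.map f)).symm.trans ?_
      rw [← Equiv.eq_symm_apply]
      refine Eq.trans ?_ (tensorRightHomEquiv_symm_comp_mate (F.F.functor.map f)
        (tensorRightHomEquiv _ _ (F.F.functor.obj y)ᘁ _ (a y))).symm
      rw [Equiv.symm_apply_apply]
      exact (ha f).symm)

lemma lift_act {X : V} (a : ∀ x, X ⊗ F.F.functor.obj x ⟶ F.F.functor.obj x)
    (ha : ∀ ⦃x y : F.A⦄ (f : x ⟶ y), X ◁ F.F.functor.map f ≫ a y = a x ≫ F.F.functor.map f)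
    (x : F.A) : F.lift a ha ▷ F.F.functor.obj x ≫ F.act x = a x := by
  refine (tensorRightHomEquiv_symm_naturality _ (F.tanπ x)).symm.trans ?_
  rw [Equiv.symm_apply_eq]
  exact end_.lift_π _ _ x

lemma tan_hom_ext {X : V} {f g : X ⟶ F.tanX} (h : ∀ x, f ▷ F.F.functor.obj x ≫ F.act x =
    g ▷ F.F.functor.obj x ≫ F.act x) : f = g := by
  refine end_.hom_ext fun x => ?_
  refine (tensorRightHomEquiv _ (F.F.functor.obj x) (F.F.functor.obj x)ᘁ _).symm.injective ?_
  refine (tensorRightHomEquiv_symm_naturality f (F.tanπ x)).trans ?_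
  exact (h x).trans (tensorRightHomEquiv_symm_naturality g (F.tanπ x)).symm

/-- The multiplication of `tan F`. -/
noncomputable def tanMul : F.tanX ⊗ F.tanX ⟶ F.tanX :=
  F.lift (fun x => (α_ _ _ _).hom ≫ F.tanX ◁ F.act x ≫ F.act x) (fun x y f => by
    simp only [Category.assoc, tensor_whiskerLeft, Iso.inv_hom_id_assoc]
    rw [← MonoidalCategory.whiskerLeft_comp_assoc, act_naturality,
      MonoidalCategory.whiskerLeft_comp_assoc, act_naturality])

/-- The unit of `tan F`. -/
noncomputable def tanOne : 𝟙_ V ⟶ F.tanX :=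
  F.lift (fun _ => (λ_ _).hom) (fun _ _ _ => leftUnitor_naturality _)

/-- The counit of `tan F`. -/
noncomputable def tanCounit : F.tanX ⟶ 𝟙_ V :=
  (ρ_ _).inv ≫ F.tanX ◁ ε F.F.functor ≫ F.act (𝟙_ F.A) ≫ η F.F.functor

/-- The comultiplication of `tan F`, characterised by its discharged form. -/
def IsComul (Δ : F.tanX ⟶ F.tanX ⊗ F.tanX) : Prop :=
  ∀ x y : F.A, Δ ▷ (F.F.functor.obj x ⊗ F.F.functor.obj y) ≫
      tensorμ F.tanX F.tanX (F.F.functor.obj x) (F.F.functor.obj y) ≫ (F.act x ⊗ₘ F.act y) =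
    F.tanX ◁ μ F.F.functor x y ≫ F.act (x ⊗ y) ≫ δ F.F.functor x y

/-- The structure morphisms of `tan F`, with comultiplication `Δ`. -/
noncomputable def tanPre (Δ : F.tanX ⟶ F.tanX ⊗ F.tanX) : PreBialgebra V where
  X := F.tanX
  mul := F.tanMul
  one := F.tanOne
  comul := Δ
  counit := F.tanCounit

variable {F} in
/-- The morphism `tan G ⟶ tan F` induced by a morphism `f : F ⟶ G`: its discharged form is the
canonical action of `tan G` on `H ⋙ G ≅ F`. -/
noncomputable def tanHom {G : SFOver V} (f : F ⟶ G) : G.tanX ⟶ F.tanX :=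
  F.lift (fun x => G.tanX ◁ (Hom.iso f).inv.app x ≫ G.act ((Hom.H f).functor.obj x) ≫
    (Hom.iso f).hom.app x) (fun x y g => by
      rw [← MonoidalCategory.whiskerLeft_comp_assoc, (Hom.iso f).inv.naturality,
        MonoidalCategory.whiskerLeft_comp_assoc, Category.assoc, Category.assoc,
        ← (Hom.iso f).hom.naturality]
      exact congrArg (G.tanX ◁ (Hom.iso f).inv.app x ≫ ·)
        ((reassoc_of% G.act_naturality ((Hom.H f).functor.map g)) _))

end Tan

end SFOver

namespace SFOver

open PreBialgebra

/-- The construction `tan` is well defined: the comultiplication of `tan F` exists and is unique,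
`tan F` is a weak bialgebra, and morphisms `F ⟶ G` induce weak morphisms `tan G ⟶ tan F`. -/
structure TanWellDefined : Prop where
  comul {V : BMCat.{v, u}} (F : SFOver V) : ∃! Δ, F.IsComul Δ
  weakBialgebra {V : BMCat.{v, u}} (F : SFOver V) (Δ : F.tanX ⟶ F.tanX ⊗ F.tanX)
    (hΔ : F.IsComul Δ) : (F.tanPre Δ).IsWeakBialgebra
  weakMorphism {V : BMCat.{v, u}} {F G : SFOver V} (f : F ⟶ G) (Δ : F.tanX ⟶ F.tanX ⊗ F.tanX)
    (hΔ : F.IsComul Δ) (Δ' : G.tanX ⟶ G.tanX ⊗ G.tanX) (hΔ' : G.IsComul Δ') :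
    IsWeakMorphism (G.tanPre Δ') (F.tanPre Δ) (tanHom f)

variable (h : TanWellDefined.{v, u})

/-- The weak bialgebra `tan F`. -/
noncomputable def tanObj {V : BMCat.{v, u}} (F : SFOver V) : WBA V where
  toPre := F.tanPre (h.comul F).choose
  isWeakBialgebra := h.weakBialgebra F _ (h.comul F).choose_spec.1

lemma tanHom_act {V : BMCat.{v, u}} {F G : SFOver V} (f : F ⟶ G) (x : F.A) :
    tanHom f ▷ F.F.functor.obj x ≫ F.act x = G.tanX ◁ (Hom.iso f).inv.app x ≫
      G.act ((Hom.H f).functor.obj x) ≫ (Hom.iso f).hom.app x :=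
  F.lift_act _ _ x

lemma whiskerLeft_iso_tanHom_act {V : BMCat.{v, u}} {F G : SFOver V} (f : F ⟶ G) (x : F.A) :
    G.tanX ◁ (Hom.iso f).hom.app x ≫ tanHom f ▷ F.F.functor.obj x ≫ F.act x =
      G.act ((Hom.H f).functor.obj x) ≫ (Hom.iso f).hom.app x := by
  rw [tanHom_act, ← MonoidalCategory.whiskerLeft_comp_assoc, Iso.hom_inv_id_app,
    MonoidalCategory.whiskerLeft_id]
  exact Category.id_comp _

lemma ext_of_iso {V : BMCat.{v, u}} {F G : SFOver V} (f : F ⟶ G) {X : V} {l l' : X ⟶ F.tanX}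
    (h : ∀ x, X ◁ (Hom.iso f).hom.app x ≫ l ▷ F.F.functor.obj x ≫ F.act x =
      X ◁ (Hom.iso f).hom.app x ≫ l' ▷ F.F.functor.obj x ≫ F.act x) : l = l' :=
  F.tan_hom_ext fun x => (cancel_epi (X ◁ (Hom.iso f).hom.app x)).1 (h x)

lemma tanHom_id {V : BMCat.{v, u}} (F : SFOver V) : tanHom (𝟙 F) = 𝟙 F.tanX := by
  refine ext_of_iso (𝟙 F) fun x => (whiskerLeft_iso_tanHom_act (𝟙 F) x).trans ?_
  change F.act x ≫ 𝟙 (F.F.functor.obj x) =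
    F.tanX ◁ 𝟙 (F.F.functor.obj x) ≫ 𝟙 F.tanX ▷ F.F.functor.obj x ≫ F.act x
  rw [Category.comp_id, MonoidalCategory.whiskerLeft_id, MonoidalCategory.id_whiskerRight,
    Category.id_comp, Category.id_comp]

section Aux

variable {D : Type u₂} [Category.{v₂} D] [MonoidalCategory D]

lemma aux_comp {T T' T'' P Q R : D} (g : T'' ⟶ T') (f : T' ⟶ T) (i : P ⟶ Q) (j : Q ⟶ R)
    (p : T'' ⊗ P ⟶ P) (q : T' ⊗ Q ⟶ Q) (r : T ⊗ R ⟶ R) (h₁ : T'' ◁ i ≫ g ▷ Q ≫ q = p ≫ i)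
    (h₂ : T' ◁ j ≫ f ▷ R ≫ r = q ≫ j) : T'' ◁ (i ≫ j) ≫ (g ≫ f) ▷ R ≫ r = p ≫ i ≫ j := by
  rw [MonoidalCategory.whiskerLeft_comp_assoc, MonoidalCategory.comp_whiskerRight_assoc,
    whisker_exchange_assoc, h₂, reassoc_of% h₁]

lemma aux_exchange {T T' T'' P Q : D} (g : T'' ⟶ T') (f : T' ⟶ T) (i : P ⟶ Q)
    (p : T'' ⊗ P ⟶ P) (p' : T' ⊗ P ⟶ P) (q : T ⊗ Q ⟶ Q) (h₁ : g ▷ P ≫ p' = p)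
    (h₂ : T' ◁ i ≫ f ▷ Q ≫ q = p' ≫ i) : T'' ◁ i ≫ (g ≫ f) ▷ Q ≫ q = p ≫ i := by
  rw [MonoidalCategory.comp_whiskerRight_assoc, whisker_exchange_assoc, h₂, reassoc_of% h₁]

variable {C : Type u₁} [Category.{v₁} C] [MonoidalCategory C] (Φ : SFFunctor C D)

lemma aux_map {T P Q : C} (i : P ⟶ Q) (p : T ⊗ P ⟶ P) (q : T ⊗ Q ⟶ Q) (h : T ◁ i ≫ q = p ≫ i) :
    Φ.functor.obj T ◁ Φ.functor.map i ≫ μ Φ.functor T Q ≫ Φ.functor.map q =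
      (μ Φ.functor T P ≫ Φ.functor.map p) ≫ Φ.functor.map i := by
  rw [μ_natural_right_assoc, Category.assoc, ← Functor.map_comp, ← Functor.map_comp, h]

lemma aux_map_comp {T T' P Q : C} {S : D} (f : T' ⟶ T) (g : Φ.functor.obj T ⟶ S) (i : P ⟶ Q)
    (p : T' ⊗ P ⟶ P) (q : T ⊗ Q ⟶ Q) (h : T' ◁ i ≫ f ▷ Q ≫ q = p ≫ i)
    (r : S ⊗ Φ.functor.obj Q ⟶ Φ.functor.obj Q)
    (hr : g ▷ Φ.functor.obj Q ≫ r = μ Φ.functor T Q ≫ Φ.functor.map q) :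
    Φ.functor.obj T' ◁ Φ.functor.map i ≫ (Φ.functor.map f ≫ g) ▷ Φ.functor.obj Q ≫ r =
      (μ Φ.functor T' P ≫ Φ.functor.map p) ≫ Φ.functor.map i := by
  rw [MonoidalCategory.comp_whiskerRight_assoc, hr, μ_natural_left_assoc, μ_natural_right_assoc,
    Category.assoc, ← Functor.map_comp, ← Functor.map_comp, ← Functor.map_comp, h]

end Aux

lemma tanHom_comp {V : BMCat.{v, u}} {F G E : SFOver V} (f : F ⟶ G) (g : G ⟶ E) :
    tanHom (f ≫ g) = tanHom g ≫ tanHom f := by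
  refine ext_of_iso (f ≫ g) fun x => (whiskerLeft_iso_tanHom_act (f ≫ g) x).trans ?_
  rw [comp_iso_app]
  exact (aux_comp (tanHom g) (tanHom f) ((Hom.iso g).hom.app ((Hom.H f).functor.obj x))
    ((Hom.iso f).hom.app x) (E.act ((Hom.H g).functor.obj ((Hom.H f).functor.obj x)))
    (G.act ((Hom.H f).functor.obj x)) (F.act x)
    (whiskerLeft_iso_tanHom_act g ((Hom.H f).functor.obj x)) (whiskerLeft_iso_tanHom_act f x)).symm

/-- The functor `tan` from `sfmon ⫽ V` to `(wba V)ᵒᵖ`, written as a functor from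
`(sfmon ⫽ V)ᵒᵖ` to `wba V`. -/
noncomputable def tan (V : BMCat.{v, u}) : (SFOver V)ᵒᵖ ⥤ WBA V where
  obj F := tanObj h F.unop
  map f := ⟨tanHom f.unop, h.weakMorphism f.unop _ (h.comul _).choose_spec.1 _
    (h.comul _).choose_spec.1⟩
  map_id F := WBA.Hom.ext (tanHom_id F.unop)
  map_comp f g := WBA.Hom.ext (tanHom_comp g.unop f.unop)

/-- The canonical morphism `Φ (tan F) ⟶ tan (Φ F)`: its discharged form is the image under `Φ` of
the canonical action of `tan F` on `F`. -/
noncomputable def rhoHom {V W : BMCat.{v, u}} (Φ : V ⟶ W) (F : SFOver V) :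
    Φ.functor.obj F.tanX ⟶ (mapObj Φ F).tanX :=
  (mapObj Φ F).lift (fun x => μ Φ.functor F.tanX (F.F.functor.obj x) ≫ Φ.functor.map (F.act x))
    (fun x y f => aux_map Φ.toSFFunctor (F.F.functor.map f) (F.act x) (F.act y)
      (F.act_naturality f))

lemma rhoHom_act {V W : BMCat.{v, u}} (Φ : V ⟶ W) (F : SFOver V) (x : F.A) :
    rhoHom Φ F ▷ Φ.functor.obj (F.F.functor.obj x) ≫ (mapObj Φ F).act x =
      μ Φ.functor F.tanX (F.F.functor.obj x) ≫ Φ.functor.map (F.act x) :=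
  (mapObj Φ F).lift_act _ _ x

lemma whiskerLeft_map_tanHom_act {V W : BMCat.{v, u}} (Φ : V ⟶ W) {F G : SFOver V} (f : F ⟶ G)
    (x : F.A) : (mapObj Φ G).tanX ◁ Φ.functor.map ((Hom.iso f).hom.app x) ≫
      tanHom ((SFOver.map Φ).map f) ▷ Φ.functor.obj (F.F.functor.obj x) ≫ (mapObj Φ F).act x =
    (mapObj Φ G).act ((Hom.H f).functor.obj x) ≫ Φ.functor.map ((Hom.iso f).hom.app x) := by
  rw [← map_iso_app]
  exact whiskerLeft_iso_tanHom_act (F := mapObj Φ F) (G := mapObj Φ G) ((SFOver.map Φ).map f) x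

lemma rhoHom_naturality {V W : BMCat.{v, u}} (Φ : V ⟶ W) {F G : SFOver V} (f : F ⟶ G) :
    Φ.functor.map (tanHom f) ≫ rhoHom Φ F = rhoHom Φ G ≫ tanHom ((SFOver.map Φ).map f) := by
  refine (mapObj Φ F).tan_hom_ext fun x => (cancel_epi (Φ.functor.obj G.tanX ◁
    Φ.functor.map ((Hom.iso f).hom.app x))).1 ?_
  exact (aux_map_comp Φ.toSFFunctor (tanHom f) (rhoHom Φ F) ((Hom.iso f).hom.app x)
    (G.act ((Hom.H f).functor.obj x)) (F.act x) (whiskerLeft_iso_tanHom_act f x)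
    ((mapObj Φ F).act x) (rhoHom_act Φ F x)).trans
    (aux_exchange (rhoHom Φ G) (tanHom ((SFOver.map Φ).map f)) _ _
      ((mapObj Φ G).act ((Hom.H f).functor.obj x)) ((mapObj Φ F).act x)
      (rhoHom_act Φ G ((Hom.H f).functor.obj x)) (whiskerLeft_map_tanHom_act Φ f x)).symm

/-- The canonical morphisms `Φ (tan F) ⟶ tan (Φ F)` are strong morphisms of weak bialgebras. -/
def RhoStrong : Prop :=
  ∀ {V W : BMCat.{v, u}} (Φ : V ⟶ W) (F : SFOver V),
    IsStrongMorphism (Φ.toSFFunctor.mapPre (tanObj h F).toPre) (tanObj h (mapObj Φ F)).toPre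
      (rhoHom Φ F)

/-- The functor `tan` as a 1-cell of `Cat`. -/
noncomputable def tanCat (V : BMCat.{v, u}) : sfmonOp.obj V ⟶ Cat.of (WBA V) :=
  (tan h V).toCatHom

/-- The canonical morphisms `Φ (tan F) ⟶ tan (Φ F)`, as a 2-cell of `Cat`. -/
noncomputable def rho (hρ : RhoStrong h) (hW : WBA.Preserved.{v, u}) {V W : BMCat.{v, u}}
    (Φ : V ⟶ W) : tanCat h V ≫ (WBA.wba hW).map Φ ⟶ sfmonOp.map Φ ≫ tanCat h W :=
  NatTrans.toCatHom₂
    { app := fun F => ⟨rhoHom Φ F.unop,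
        (hρ Φ F.unop).isWeakMorphism (hW.obj Φ (tanObj h F.unop))⟩
      naturality := fun _ _ f => WBA.Hom.ext (rhoHom_naturality Φ f.unop) }

end SFOver

/-- The components and the structure 2-cells of a lax transformation. -/
def laxComponents {F G : LaxFunctor BMCat.{v, u} Cat.{v, max u (v + 1)}}
    (T : Lax.LaxTrans F G) : Σ' app : ∀ V, F.obj V ⟶ G.obj V,
      ∀ {V W : BMCat.{v, u}} (Φ : V ⟶ W), app V ≫ G.map Φ ⟶ F.map Φ ≫ app W :=
  ⟨T.app, T.naturality⟩

end Tannaka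

namespace Tannaka

open Functor.LaxMonoidal Functor.OplaxMonoidal

section Actions

variable {C : Type u₁} [Category.{v₁} C] [MonoidalCategory C]

/-- The composite `a (b -)` of two actions. -/
def compAct {A B M N P : C} (a : A ⊗ M ⟶ P) (b : B ⊗ N ⟶ M) : (A ⊗ B) ⊗ N ⟶ P :=
  (α_ A B N).hom ≫ A ◁ b ≫ a

lemma tensorHom_whiskerRight_compAct {A A' B B' M N P : C} (f : A' ⟶ A) (g : B' ⟶ B)
    (a : A ⊗ M ⟶ P) (b : B ⊗ N ⟶ M) :
    (f ⊗ₘ g) ▷ N ≫ compAct a b = compAct (f ▷ M ≫ a) (g ▷ N ≫ b) := by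
  simp only [compAct, MonoidalCategory.tensorHom_def, comp_whiskerRight, Category.assoc,
    MonoidalCategory.whiskerLeft_comp, whisker_exchange_assoc, associator_naturality_left_assoc,
    associator_naturality_middle_assoc]

lemma whiskerLeft_compAct {A B M N N' P : C} (a : A ⊗ M ⟶ P) (b : B ⊗ N ⟶ M) (n : N' ⟶ N) :
    (A ⊗ B) ◁ n ≫ compAct a b = compAct a (B ◁ n ≫ b) := by
  simp [compAct]

lemma compAct_comp {A B M N P P' : C} (a : A ⊗ M ⟶ P) (b : B ⊗ N ⟶ M) (p : P ⟶ P') :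
    compAct a b ≫ p = compAct (a ≫ p) b := by
  simp [compAct]

lemma compAct_comp_right {A B M M' N P : C} (a : A ⊗ M ⟶ P) (b : B ⊗ N ⟶ M') (m : M' ⟶ M) :
    compAct a (b ≫ m) = compAct (A ◁ m ≫ a) b := by
  simp [compAct]

lemma compAct_unit_left {B N M : C} (b : B ⊗ N ⟶ M) {P : C} (m : M ⟶ P) :
    (λ_ B).inv ▷ N ≫ compAct ((λ_ M).hom ≫ m) b = b ≫ m := by
  simp [compAct]

lemma compAct_unit_right {A N M P : C} (a : A ⊗ M ⟶ P) (n : N ⟶ M) :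
    (ρ_ A).inv ▷ N ≫ compAct a ((λ_ N).hom ≫ n) = A ◁ n ≫ a := by
  simp [compAct]

lemma unit_compAct {B N M : C} (b : B ⊗ N ⟶ M) :
    compAct (λ_ M).hom b = (λ_ B).hom ▷ N ≫ b := by
  simp [compAct]

lemma compAct_unit {A M P : C} (a : A ⊗ M ⟶ P) :
    compAct a (λ_ M).hom = (ρ_ A).hom ▷ M ≫ a := by
  simp [compAct]

lemma compAct_assoc {A B D M N L P : C} (a : A ⊗ M ⟶ P) (b : B ⊗ N ⟶ M) (d : D ⊗ L ⟶ N) :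
    compAct (compAct a b) d = (α_ A B D).hom ▷ L ≫ compAct a (compAct b d) := by
  simp [compAct]

lemma whiskerRight_whiskerRight_compAct {A A' B M N P : C} (f : A' ⟶ A)
    (a : A ⊗ M ⟶ P) (b : B ⊗ N ⟶ M) :
    f ▷ B ▷ N ≫ compAct a b = compAct (f ▷ M ≫ a) b := by
  simpa only [tensorHom_id, id_whiskerRight, Category.id_comp] using
    tensorHom_whiskerRight_compAct f (𝟙 B) a b

lemma whiskerLeft_whiskerRight_compAct {A B B' M N P : C} (g : B' ⟶ B)
    (a : A ⊗ M ⟶ P) (b : B ⊗ N ⟶ M) :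
    (A ◁ g) ▷ N ≫ compAct a b = compAct a (g ▷ N ≫ b) := by
  simpa only [id_tensorHom, id_whiskerRight, Category.id_comp] using
    tensorHom_whiskerRight_compAct (𝟙 A) g a b

lemma elements_compAct {A B M N P : C} (c : 𝟙_ C ⟶ A) (d : 𝟙_ C ⟶ B) (a : A ⊗ M ⟶ P)
    (b : B ⊗ N ⟶ M) (e : M ⟶ P) (e' : N ⟶ M) (h : c ▷ M ≫ a = (λ_ M).hom ≫ e)
    (h' : d ▷ N ≫ b = (λ_ N).hom ≫ e') :
    ((λ_ (𝟙_ C)).inv ≫ (c ⊗ₘ d)) ▷ N ≫ compAct a b = (λ_ N).hom ≫ e' ≫ e := by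
  rw [comp_whiskerRight_assoc, tensorHom_whiskerRight_compAct, h, h', compAct_unit_left,
    Category.assoc]

lemma scalar_tensorHom {A B B₁ B₂ D M : C} (d : B ⟶ B₁ ⊗ B₂) (s : A ⊗ M ⟶ 𝟙_ C) (u : B₁ ⟶ M)
    (t : B₂ ⊗ D ⟶ 𝟙_ C) :
    (A ◁ d ≫ (α_ _ _ _).inv) ▷ D ≫ (α_ _ _ _).hom ≫ ((A ◁ u ≫ s) ⊗ₘ t) ≫ (λ_ (𝟙_ C)).hom =
      (α_ _ _ _).hom ≫ A ◁ (d ▷ D ≫ (α_ _ _ _).hom ≫ (u ⊗ₘ t) ≫ (ρ_ M).hom) ≫ s := by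
  rw [MonoidalCategory.tensorHom_def', MonoidalCategory.tensorHom_def' u t, unitors_equal,
    Category.assoc, Category.assoc, rightUnitor_naturality, rightUnitor_naturality]
  monoidal

variable [BraidedCategory C]

/-- The tensor product of two actions. -/
def boxAct {A B M N P Q : C} (a : A ⊗ M ⟶ P) (b : B ⊗ N ⟶ Q) :
    (A ⊗ B) ⊗ (M ⊗ N) ⟶ P ⊗ Q :=
  tensorμ A B M N ≫ (a ⊗ₘ b)

section

variable {A A' B B' M M' N N' P P' Q Q' : C}

lemma tensorHom_whiskerRight_boxAct (f : A' ⟶ A) (g : B' ⟶ B) (a : A ⊗ M ⟶ P) (b : B ⊗ N ⟶ Q) :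
    (f ⊗ₘ g) ▷ (M ⊗ N) ≫ boxAct a b = boxAct (f ▷ M ≫ a) (g ▷ N ≫ b) := by
  simp only [boxAct, tensorμ_natural_left_assoc, tensorHom_comp_tensorHom]

lemma whiskerLeft_tensorHom_boxAct (a : A ⊗ M ⟶ P) (b : B ⊗ N ⟶ Q) (m : M' ⟶ M) (n : N' ⟶ N) :
    (A ⊗ B) ◁ (m ⊗ₘ n) ≫ boxAct a b = boxAct (A ◁ m ≫ a) (B ◁ n ≫ b) := by
  simp only [boxAct, tensorμ_natural_right_assoc, tensorHom_comp_tensorHom]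

lemma boxAct_tensorHom (a : A ⊗ M ⟶ P) (b : B ⊗ N ⟶ Q) (p : P ⟶ P') (q : Q ⟶ Q') :
    boxAct a b ≫ (p ⊗ₘ q) = boxAct (a ≫ p) (b ≫ q) := by
  simp [boxAct]

lemma whiskerRight_whiskerRight_boxAct (f : A' ⟶ A) (a : A ⊗ M ⟶ P) (b : B ⊗ N ⟶ Q) :
    (f ▷ B) ▷ (M ⊗ N) ≫ boxAct a b = boxAct (f ▷ M ≫ a) b := by
  simpa only [tensorHom_id, id_whiskerRight, Category.id_comp] using
    tensorHom_whiskerRight_boxAct f (𝟙 B) a b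

lemma whiskerLeft_whiskerRight_boxAct (g : B' ⟶ B) (a : A ⊗ M ⟶ P) (b : B ⊗ N ⟶ Q) :
    (A ◁ g) ▷ (M ⊗ N) ≫ boxAct a b = boxAct a (g ▷ N ≫ b) := by
  simpa only [id_tensorHom, id_whiskerRight, Category.id_comp] using
    tensorHom_whiskerRight_boxAct (𝟙 A) g a b

lemma whiskerLeft_whiskerRight_comp_boxAct (a : A ⊗ M ⟶ P) (b : B ⊗ N ⟶ Q) (m : M' ⟶ M) :
    (A ⊗ B) ◁ (m ▷ N) ≫ boxAct a b = boxAct (A ◁ m ≫ a) b := by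
  simpa only [tensorHom_id, whiskerLeft_id, Category.id_comp] using
    whiskerLeft_tensorHom_boxAct a b m (𝟙 N)

lemma whiskerLeft_whiskerLeft_boxAct (a : A ⊗ M ⟶ P) (b : B ⊗ N ⟶ Q) (n : N' ⟶ N) :
    (A ⊗ B) ◁ (M ◁ n) ≫ boxAct a b = boxAct a (B ◁ n ≫ b) := by
  simpa only [id_tensorHom, whiskerLeft_id, Category.id_comp] using
    whiskerLeft_tensorHom_boxAct a b (𝟙 M) n

lemma boxAct_whiskerRight (a : A ⊗ M ⟶ P) (b : B ⊗ N ⟶ Q) (p : P ⟶ P') :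
    boxAct a b ≫ p ▷ Q = boxAct (a ≫ p) b := by
  simpa only [tensorHom_id, Category.comp_id] using boxAct_tensorHom a b p (𝟙 Q)

lemma boxAct_whiskerLeft (a : A ⊗ M ⟶ P) (b : B ⊗ N ⟶ Q) (q : Q ⟶ Q') :
    boxAct a b ≫ P ◁ q = boxAct a (b ≫ q) := by
  simpa only [id_tensorHom, Category.comp_id] using boxAct_tensorHom a b (𝟙 P) q

lemma boxAct_unit (m : M ⟶ P) (n : N ⟶ Q) :
    (λ_ (𝟙_ C)).inv ▷ (M ⊗ N) ≫ boxAct ((λ_ M).hom ≫ m) ((λ_ N).hom ≫ n) =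
      (λ_ (M ⊗ N)).hom ≫ (m ⊗ₘ n) := by
  rw [tensor_left_unitality]
  simp [boxAct]

lemma boxAct_assoc {D L R : C} (a : A ⊗ M ⟶ P) (b : B ⊗ N ⟶ Q) (d : D ⊗ L ⟶ R) :
    boxAct (boxAct a b) d ≫ (α_ P Q R).hom =
      ((α_ A B D).hom ⊗ₘ (α_ M N L).hom) ≫ boxAct a (boxAct b d) := by
  have h : boxAct (boxAct a b) d = tensorμ (A ⊗ B) D (M ⊗ N) L ≫
      tensorμ A B M N ▷ (D ⊗ L) ≫ ((a ⊗ₘ b) ⊗ₘ d) := by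
    simp only [boxAct, whiskerRight_comp_tensorHom]
  have h' : boxAct a (boxAct b d) = tensorμ A (B ⊗ D) M (N ⊗ L) ≫
      (A ⊗ M) ◁ tensorμ B D N L ≫ (a ⊗ₘ (b ⊗ₘ d)) := by
    simp only [boxAct, whiskerLeft_comp_tensorHom]
  rw [h, h', Category.assoc, Category.assoc, associator_naturality, associator_monoidal_assoc]

lemma compAct_boxAct {D E L K : C} (a : A ⊗ M ⟶ P) (b : B ⊗ N ⟶ Q) (d : D ⊗ L ⟶ M)
    (e : E ⊗ K ⟶ N) : compAct (boxAct a b) (boxAct d e) =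
      tensorμ A B D E ▷ (L ⊗ K) ≫ boxAct (compAct a d) (compAct b e) := by
  simp only [compAct, boxAct, MonoidalCategory.whiskerLeft_comp, Category.assoc,
    tensorμ_natural_right_assoc]
  rw [← tensorHom_comp_tensorHom, ← tensorHom_comp_tensorHom, tensor_associativity_assoc]

end

lemma boxAct_scalar_left {A B N P Q : C} (a : A ⊗ 𝟙_ C ⟶ P) (b : B ⊗ N ⟶ Q) :
    (A ⊗ B) ◁ (λ_ N).inv ≫ boxAct a b = (α_ A B N).hom ≫ (((ρ_ A).inv ≫ a) ⊗ₘ b) := by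
  have h : (A ⊗ B) ◁ (λ_ N).inv ≫ tensorμ A B (𝟙_ C) N =
      (α_ A B N).hom ≫ (ρ_ A).inv ▷ (B ⊗ N) := by
    simp only [tensorμ, braiding_tensorUnit_right]
    monoidal
  rw [boxAct, reassoc_of% h, whiskerRight_comp_tensorHom]

lemma boxAct_scalar_right {A B M P Q : C} (a : A ⊗ M ⟶ P) (b : B ⊗ 𝟙_ C ⟶ Q) :
    (A ⊗ B) ◁ (ρ_ M).inv ≫ boxAct a b = (α_ A B M).hom ≫ A ◁ (β_ B M).hom ≫ (α_ A M B).inv ≫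
      (a ⊗ₘ ((ρ_ B).inv ≫ b)) := by
  have h : (A ⊗ B) ◁ (ρ_ M).inv ≫ tensorμ A B M (𝟙_ C) =
      (α_ A B M).hom ≫ A ◁ (β_ B M).hom ≫ (α_ A M B).inv ≫ (A ⊗ M) ◁ (ρ_ B).inv := by
    simp only [tensorμ]
    monoidal
  rw [boxAct, reassoc_of% h, whiskerLeft_comp_tensorHom]

lemma boxAct_scalar_left_act {A B N P : C} (s : A ⊗ 𝟙_ C ⟶ 𝟙_ C) (b : B ⊗ N ⟶ P) :
    (A ⊗ B) ◁ (λ_ N).inv ≫ boxAct s b ≫ (λ_ P).hom =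
      (((ρ_ A).inv ≫ s) ▷ B ≫ (λ_ B).hom) ▷ N ≫ b := by
  rw [reassoc_of% boxAct_scalar_left s b, MonoidalCategory.tensorHom_def, Category.assoc,
    leftUnitor_naturality]
  monoidal

/-- A scalar that is split off by the inverse braiding. -/
lemma braiding_inv_scalar {A B M P : C} (s : A ⊗ M ⟶ 𝟙_ C) (t : B ⟶ P) :
    (α_ A B M).hom ≫ A ◁ (β_ B M).hom ≫ (α_ A M B).inv ≫ (s ⊗ₘ t) ≫ (λ_ P).hom =
      (β_ B A).inv ▷ M ≫ (α_ B A M).hom ≫ (t ⊗ₘ s) ≫ (ρ_ P).hom := by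
  have h : (α_ A B M).hom ≫ A ◁ (β_ B M).hom ≫ (α_ A M B).inv =
      (β_ B A).inv ▷ M ≫ (α_ B A M).hom ≫ (β_ B (A ⊗ M)).hom := by
    rw [BraidedCategory.braiding_tensor_right_hom]
    simp
  rw [reassoc_of% h, ← BraidedCategory.braiding_naturality_assoc]
  simp

/-- The scalar `s` moved past `M`. -/
lemma braiding_boxAct_scalar_right {A B M N P : C} (a : A ⊗ M ⟶ P) (s : B ⊗ N ⟶ 𝟙_ C) :
    (A ⊗ B) ◁ (β_ N M).hom ≫ boxAct a s ≫ (ρ_ P).hom =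
      (α_ (A ⊗ B) N M).inv ≫ ((α_ A B N).hom ≫ A ◁ s ≫ (ρ_ A).hom) ▷ M ≫ a := by
  have h : (A ⊗ B) ◁ (β_ N M).hom ≫ tensorμ A B M N = (α_ A B (N ⊗ M)).hom ≫
      A ◁ ((α_ B N M).inv ≫ (β_ (B ⊗ N) M).hom) ≫ (α_ A M (B ⊗ N)).inv := by
    rw [BraidedCategory.braiding_tensor_left_hom]
    simp only [tensorμ]
    monoidal
  have h' : (β_ (B ⊗ N) M).hom ≫ M ◁ s = s ▷ M ≫ (β_ (𝟙_ C) M).hom := by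
    simp only [BraidedCategory.braiding_naturality_left]
  rw [boxAct, Category.assoc, reassoc_of% h, tensorHom_def']
  simp only [Category.assoc, MonoidalCategory.whiskerLeft_comp]
  rw [← associator_inv_naturality_right_assoc, ← MonoidalCategory.whiskerLeft_comp_assoc,
    ← MonoidalCategory.whiskerLeft_comp_assoc, Category.assoc, h']
  rw [braiding_tensorUnit_left, rightUnitor_naturality]
  monoidal

lemma boxAct_scalar_right_act {A B M P : C} (a : A ⊗ M ⟶ P) (s : B ⊗ 𝟙_ C ⟶ 𝟙_ C) :
    (A ⊗ B) ◁ (ρ_ M).inv ≫ boxAct a s ≫ (ρ_ P).hom =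
      (A ◁ ((ρ_ B).inv ≫ s) ≫ (ρ_ A).hom) ▷ M ≫ a := by
  have h := (A ⊗ B) ◁ (λ_ M).inv ≫= braiding_boxAct_scalar_right a s
  rw [braiding_tensorUnit_left, MonoidalCategory.whiskerLeft_comp_assoc,
    ← MonoidalCategory.whiskerLeft_comp_assoc, Iso.inv_hom_id, MonoidalCategory.whiskerLeft_id,
    Category.id_comp] at h
  rw [h]
  monoidal

lemma boxAct_scalar_left_comp {A B M N P : C} (s : A ⊗ N ⟶ 𝟙_ C) (b : B ⊗ M ⟶ P) :
    boxAct s b ≫ (λ_ P).hom = (α_ (A ⊗ B) N M).inv ≫ ((α_ A B N).hom ≫ A ◁ (β_ B N).hom ≫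
      (α_ A N B).inv ≫ s ▷ B ≫ (λ_ B).hom) ▷ M ≫ b := by
  rw [boxAct, MonoidalCategory.tensorHom_def, Category.assoc, Category.assoc, leftUnitor_naturality]
  simp only [tensorμ]
  monoidal

lemma element_boxAct_unit {A M P L : C} (c : 𝟙_ C ⟶ A) (a : A ⊗ M ⟶ P) (e : M ⟶ P)
    (h : c ▷ M ≫ a = (λ_ M).hom ≫ e) :
    (c ≫ (ρ_ A).inv) ▷ (M ⊗ L) ≫ boxAct a (λ_ L).hom = (λ_ _).hom ≫ e ▷ L := by
  rw [rightUnitor_inv_naturality, comp_whiskerRight_assoc, whiskerRight_whiskerRight_boxAct, h,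
    ← unitors_inv_equal, ← Category.comp_id (λ_ L).hom, boxAct_unit, tensorHom_id]

lemma element_unit_boxAct {B N Q M : C} (c : 𝟙_ C ⟶ B) (b : B ⊗ N ⟶ Q) (e : N ⟶ Q)
    (h : c ▷ N ≫ b = (λ_ N).hom ≫ e) :
    (c ≫ (λ_ B).inv) ▷ (M ⊗ N) ≫ boxAct (λ_ M).hom b = (λ_ _).hom ≫ M ◁ e := by
  rw [leftUnitor_inv_naturality, comp_whiskerRight_assoc, whiskerLeft_whiskerRight_boxAct, h,
    ← Category.comp_id (λ_ M).hom, boxAct_unit, id_tensorHom]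

lemma element_unit_boxAct_assoc {B D N L Q R M : C} (c : 𝟙_ C ⟶ B ⊗ D) (b : B ⊗ N ⟶ Q)
    (d : D ⊗ L ⟶ R) (e : N ⊗ L ⟶ Q ⊗ R) (h : c ▷ (N ⊗ L) ≫ boxAct b d = (λ_ _).hom ≫ e) :
    (c ≫ (λ_ B).inv ▷ D) ▷ ((M ⊗ N) ⊗ L) ≫ boxAct (boxAct (λ_ M).hom b) d =
      (λ_ _).hom ≫ (α_ M N L).hom ≫ M ◁ e ≫ (α_ M Q R).inv := by
  have k := boxAct_assoc (λ_ M).hom b d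
  rw [← Iso.eq_comp_inv] at k
  have k' : (λ_ B).inv ▷ D ≫ (α_ (𝟙_ C) B D).hom = (λ_ (B ⊗ D)).inv := by simp
  rw [k, MonoidalCategory.tensorHom_def']
  simp only [Category.assoc]
  rw [← whisker_exchange_assoc, ← comp_whiskerRight_assoc, Category.assoc, k',
    reassoc_of% element_unit_boxAct c _ e h, leftUnitor_naturality_assoc]

/-- The element `c₁ ⊗ c₂ d₁ ⊗ d₂` acts by the action of `d` followed by the action of `c`. -/
lemma elements_boxAct_compAct {A B B' D M M' N N' N'' L L' : C} (a : A ⊗ M ⟶ M')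
    (b : B ⊗ N' ⟶ N'') (b' : B' ⊗ N ⟶ N') (d : D ⊗ L ⟶ L') (c : 𝟙_ C ⟶ A ⊗ B)
    (c' : 𝟙_ C ⟶ B' ⊗ D) (e : M ⊗ N' ⟶ M' ⊗ N'') (e' : N ⊗ L ⟶ N' ⊗ L')
    (he : c ▷ (M ⊗ N') ≫ boxAct a b = (λ_ _).hom ≫ e)
    (he' : c' ▷ (N ⊗ L) ≫ boxAct b' d = (λ_ _).hom ≫ e') :
    ((λ_ (𝟙_ C)).inv ≫ (c ⊗ₘ c') ≫ (α_ A B (B' ⊗ D)).hom ≫ A ◁ (α_ B B' D).inv ≫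
      (α_ A (B ⊗ B') D).inv) ▷ ((M ⊗ N) ⊗ L) ≫ boxAct (boxAct a (compAct b b')) d =
    (λ_ _).hom ≫ ((α_ M N L).hom ≫ M ◁ e' ≫ (α_ M N' L').inv) ≫ e ▷ L' := by
  have h₁ : (α_ A B (B' ⊗ D)).hom ≫ A ◁ (α_ B B' D).inv ≫ (α_ A (B ⊗ B') D).inv =
      ((ρ_ (A ⊗ B)).inv ⊗ₘ (λ_ B').inv ▷ D) ≫ tensorμ (A ⊗ B) (𝟙_ C) (𝟙_ C ⊗ B') D ≫
        ((tensorμ A B (𝟙_ C) B' ≫ (ρ_ A).hom ▷ (B ⊗ B')) ⊗ₘ (λ_ D).hom) := by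
    simp only [tensorμ, braiding_tensorUnit_left, braiding_tensorUnit_right]
    monoidal
  have h₂ : (tensorμ (A ⊗ B) (𝟙_ C) (𝟙_ C ⊗ B') D ≫
      ((tensorμ A B (𝟙_ C) B' ≫ (ρ_ A).hom ▷ (B ⊗ B')) ⊗ₘ (λ_ D).hom)) ▷ ((M ⊗ N) ⊗ L) ≫
        boxAct (boxAct a (compAct b b')) d =
      compAct (boxAct (boxAct a b) (λ_ L').hom) (boxAct (boxAct (λ_ M).hom b') d) := by
    rw [compAct_boxAct, compAct_boxAct, compAct_unit, unit_compAct, comp_whiskerRight_assoc,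
      tensorHom_whiskerRight_boxAct, comp_whiskerRight_assoc, whiskerRight_whiskerRight_boxAct]
  rw [h₁, tensorHom_comp_tensorHom_assoc, ← Category.assoc, comp_whiskerRight_assoc, h₂]
  exact elements_compAct _ _ _ _ _ _ (element_boxAct_unit c _ e he)
    (element_unit_boxAct_assoc c' b' d e' he')

/-- The element `c₁ ⊗ d₁ c₂ ⊗ d₂`, where `d₁` is moved past `c₂` by the inverse braiding, acts by
the action of `c` followed by the action of `d`. -/
lemma elements_boxAct_compAct_braided {A B B' D M M' N N' N'' L L' : C} (a : A ⊗ M ⟶ M')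
    (b : B ⊗ N ⟶ N') (b' : B' ⊗ N' ⟶ N'') (d : D ⊗ L ⟶ L') (c : 𝟙_ C ⟶ A ⊗ B)
    (c' : 𝟙_ C ⟶ B' ⊗ D) (e : M ⊗ N ⟶ M' ⊗ N') (e' : N' ⊗ L ⟶ N'' ⊗ L')
    (he : c ▷ (M ⊗ N) ≫ boxAct a b = (λ_ _).hom ≫ e)
    (he' : c' ▷ (N' ⊗ L) ≫ boxAct b' d = (λ_ _).hom ≫ e') :
    ((λ_ (𝟙_ C)).inv ≫ (c ⊗ₘ c') ≫ (α_ A B (B' ⊗ D)).hom ≫ A ◁ ((α_ B B' D).inv ≫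
      (β_ B' B).inv ▷ D) ≫ (α_ A (B' ⊗ B) D).inv) ▷ ((M ⊗ N) ⊗ L) ≫
        boxAct (boxAct a (compAct b' b)) d =
    (λ_ _).hom ≫ e ▷ L ≫ (α_ M' N' L).hom ≫ M' ◁ e' ≫ (α_ M' N'' L').inv := by
  have h₀ : (λ_ (𝟙_ C)).inv ≫ (c ⊗ₘ c') =
      (λ_ (𝟙_ C)).inv ≫ (c' ⊗ₘ c) ≫ (β_ (B' ⊗ D) (A ⊗ B)).hom := by
    rw [BraidedCategory.braiding_naturality, braiding_tensorUnit_left, Category.assoc,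
      Iso.inv_hom_id_assoc, unitors_inv_equal]
  have h₁ : (β_ (B' ⊗ D) (A ⊗ B)).hom ≫ (α_ A B (B' ⊗ D)).hom ≫ A ◁ ((α_ B B' D).inv ≫
      (β_ B' B).inv ▷ D) ≫ (α_ A (B' ⊗ B) D).inv =
      ((λ_ B').inv ▷ D ⊗ₘ (ρ_ (A ⊗ B)).inv) ≫ tensorμ (𝟙_ C ⊗ B') D (A ⊗ B) (𝟙_ C) ≫
        ((tensorμ (𝟙_ C) B' A B ≫ (λ_ A).hom ▷ (B' ⊗ B)) ⊗ₘ (ρ_ D).hom) := by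
    have k : (β_ (B' ⊗ D) (A ⊗ B)).hom ≫ (α_ A B (B' ⊗ D)).hom ≫ A ◁ ((α_ B B' D).inv ≫
        (β_ B' B).inv ▷ D) ≫ (α_ A (B' ⊗ B) D).inv = (α_ B' D (A ⊗ B)).hom ≫
        B' ◁ (β_ D (A ⊗ B)).hom ≫ (α_ B' (A ⊗ B) D).inv ≫ (α_ B' A B).inv ▷ D ≫
        (β_ B' A).hom ▷ B ▷ D ≫ (α_ A B' B).hom ▷ D := by
      rw [BraidedCategory.braiding_tensor_left_hom, BraidedCategory.braiding_tensor_right_hom B']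
      simp
    rw [k]
    simp only [tensorμ]
    monoidal
  have h₂ : (tensorμ (𝟙_ C ⊗ B') D (A ⊗ B) (𝟙_ C) ≫
      ((tensorμ (𝟙_ C) B' A B ≫ (λ_ A).hom ▷ (B' ⊗ B)) ⊗ₘ (ρ_ D).hom)) ▷ ((M ⊗ N) ⊗ L) ≫
        boxAct (boxAct a (compAct b' b)) d =
      compAct (boxAct (boxAct (λ_ M').hom b') d) (boxAct (boxAct a b) (λ_ L).hom) := by
    rw [compAct_boxAct, compAct_boxAct, unit_compAct, compAct_unit, comp_whiskerRight_assoc,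
      tensorHom_whiskerRight_boxAct, comp_whiskerRight_assoc, whiskerRight_whiskerRight_boxAct]
  rw [reassoc_of% h₀, h₁, tensorHom_comp_tensorHom_assoc, ← Category.assoc,
    comp_whiskerRight_assoc, h₂]
  exact elements_compAct _ _ _ _ _ _ (element_unit_boxAct_assoc c' b' d e' he')
    (element_boxAct_unit c _ e he)

end Actions

section

variable {C : Type u₁} [Category.{v₁} C] [MonoidalCategory C] [BraidedCategory C]

/-- The action of the first factor of `A ⊗ B`. -/
def actLeft {A M P : C} (a : A ⊗ M ⟶ P) (B : C) : (A ⊗ B) ⊗ M ⟶ P ⊗ B :=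
  (α_ A B M).hom ≫ A ◁ (β_ B M).hom ≫ (α_ A M B).inv ≫ a ▷ B

/-- The action of the second factor of `A ⊗ B`. -/
def actRight {B N Q : C} (A : C) (b : B ⊗ N ⟶ Q) : (A ⊗ B) ⊗ N ⟶ A ⊗ Q :=
  (α_ A B N).hom ≫ A ◁ b

lemma actLeft_eq {A M P : C} (a : A ⊗ M ⟶ P) (B : C) :
    actLeft a B = (β_ B A).inv ▷ M ≫ actRight B a ≫ (β_ B P).hom := by
  have h : (α_ A B M).hom ≫ A ◁ (β_ B M).hom ≫ (α_ A M B).inv =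
      (β_ B A).inv ▷ M ≫ (α_ B A M).hom ≫ (β_ B (A ⊗ M)).hom := by
    rw [BraidedCategory.braiding_tensor_right_hom]
    simp
  rw [actLeft, reassoc_of% h, actRight, Category.assoc, BraidedCategory.braiding_naturality_right]

lemma actLeft_actRight {A B M N P Q : C} (a : A ⊗ M ⟶ P) (b : B ⊗ N ⟶ Q) :
    actLeft a B ▷ N ≫ actRight P b = (α_ _ _ _).hom ≫ boxAct a b := by
  rw [boxAct, MonoidalCategory.tensorHom_def]
  simp only [actLeft, actRight, tensorμ]
  monoidal

lemma actRight_boxAct {A B D M N P Q : C} (b : B ⊗ M ⟶ P) (d : D ⊗ N ⟶ Q) :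
    actRight A (boxAct b d) = (α_ _ _ _).inv ≫ actRight A (actLeft b D) ▷ N ≫
      (α_ A P D).inv ▷ N ≫ actRight (A ⊗ P) d ≫ (α_ A P Q).hom := by
  rw [boxAct, MonoidalCategory.tensorHom_def]
  simp only [actLeft, actRight, tensorμ]
  monoidal

end

namespace SFOver

variable {V : BMCat.{v, u}} (F : SFOver V)

section

variable (G : V ⥤ V) [PreservesLimits G]

/-- The image of the end `tan F` under a continuous functor is a limit. -/
noncomputable def isLimitMapTan :
    IsLimit (Multifork.map (limit.cone (multicospanIndexEnd F.endFunctor).multicospan) G) :=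
  Multifork.isLimitMapOfPreserves _ G (limit.isLimit _)

lemma map_tanπ_hom_ext {X : V} {f g : X ⟶ G.obj F.tanX}
    (h : ∀ x, f ≫ G.map (F.tanπ x) = g ≫ G.map (F.tanπ x)) : f = g :=
  Multifork.IsLimit.hom_ext (F.isLimitMapTan G) h

lemma exists_map_tanπ {X : V}
    (a : ∀ x, X ⟶ G.obj (F.F.functor.obj x ⊗ (F.F.functor.obj x)ᘁ))
    (ha : ∀ ⦃x y : F.A⦄ (f : x ⟶ y), a x ≫ G.map (F.F.functor.map f ▷ (F.F.functor.obj x)ᘁ) =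
      a y ≫ G.map (F.F.functor.obj y ◁ (F.F.functor.map f)ᘁ)) :
    ∃ l : X ⟶ G.obj F.tanX, ∀ x, l ≫ G.map (F.tanπ x) = a x :=
  ⟨Multifork.IsLimit.lift (F.isLimitMapTan G) a (fun f => ha f.hom),
    fun x => Multifork.IsLimit.fac (F.isLimitMapTan G) a (fun f => ha f.hom) x⟩

end

lemma actRight_act {X Y : V} (f : X ⟶ Y ⊗ F.tanX) (x : F.A) :
    f ▷ F.F.functor.obj x ≫ actRight Y (F.act x) =
      (tensorRightHomEquiv X (F.F.functor.obj x) (F.F.functor.obj x)ᘁ _).symm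
        (f ≫ Y ◁ F.tanπ x ≫ (α_ _ _ _).inv) := by
  have h := tensorRightHomEquiv_tensor (Y := F.F.functor.obj x) (Y' := (F.F.functor.obj x)ᘁ)
    (F.tanπ x) (𝟙 Y)
  rw [id_tensorHom, id_tensorHom] at h
  rw [tensorRightHomEquiv_symm_naturality, h]
  rfl

lemma actRight_hom_ext {X Y : V} {f g : X ⟶ Y ⊗ F.tanX}
    (h : ∀ x, f ▷ F.F.functor.obj x ≫ actRight Y (F.act x) =
      g ▷ F.F.functor.obj x ≫ actRight Y (F.act x)) : f = g := by
  refine F.map_tanπ_hom_ext (tensorLeft Y) fun x => ?_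
  have := h x
  rw [actRight_act, actRight_act, EmbeddingLike.apply_eq_iff_eq, ← Category.assoc,
    ← Category.assoc, cancel_mono] at this
  exact this

lemma exists_actRight {X Y : V} (a : ∀ x, X ⊗ F.F.functor.obj x ⟶ Y ⊗ F.F.functor.obj x)
    (ha : ∀ ⦃x y : F.A⦄ (f : x ⟶ y),
      X ◁ F.F.functor.map f ≫ a y = a x ≫ Y ◁ F.F.functor.map f) :
    ∃ l : X ⟶ Y ⊗ F.tanX, ∀ x, l ▷ F.F.functor.obj x ≫ actRight Y (F.act x) = a x := by
  obtain ⟨l, hl⟩ := F.exists_map_tanπ (tensorLeft Y)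
    (fun x => tensorRightHomEquiv X (F.F.functor.obj x) (F.F.functor.obj x)ᘁ _ (a x) ≫
      (α_ _ _ _).hom) (by
      intro x y f
      change _ ≫ Y ◁ _ = _ ≫ Y ◁ _
      rw [Category.assoc, Category.assoc, ← associator_naturality_middle,
        ← associator_naturality_right, ← Category.assoc, ← Category.assoc]
      congr 1
      rw [← tensorRightHomEquiv_naturality, ← Equiv.eq_symm_apply,
        tensorRightHomEquiv_symm_comp_mate, Equiv.symm_apply_apply, ha])
  refine ⟨l, fun x => ?_⟩
  have := hl x
  change _ ≫ Y ◁ _ = _ at this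
  rw [actRight_act, reassoc_of% this, Iso.hom_inv_id, Category.comp_id, Equiv.symm_apply_apply]

lemma actRight_actLeft_hom_ext {X Y Z : V} {f g : X ⟶ Y ⊗ (F.tanX ⊗ Z)}
    (h : ∀ x, f ▷ F.F.functor.obj x ≫ actRight Y (actLeft (F.act x) Z) =
      g ▷ F.F.functor.obj x ≫ actRight Y (actLeft (F.act x) Z)) : f = g := by
  rw [← cancel_mono (Y ◁ (β_ Z F.tanX).inv ≫ (α_ Y Z F.tanX).inv)]
  refine F.actRight_hom_ext fun x => ?_
  have k (f : X ⟶ Y ⊗ (F.tanX ⊗ Z)) :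
      (f ≫ Y ◁ (β_ Z F.tanX).inv ≫ (α_ Y Z F.tanX).inv) ▷ F.F.functor.obj x ≫
        actRight (Y ⊗ Z) (F.act x) =
      (f ▷ F.F.functor.obj x ≫ actRight Y (actLeft (F.act x) Z)) ≫
        Y ◁ (β_ Z (F.F.functor.obj x)).inv ≫ (α_ Y Z (F.F.functor.obj x)).inv := by
    have k' : actRight Y (actLeft (F.act x) Z) ≫ Y ◁ (β_ Z (F.F.functor.obj x)).inv =
        (α_ _ _ _).hom ≫ Y ◁ ((β_ Z F.tanX).inv ▷ F.F.functor.obj x ≫ actRight Z (F.act x)) := by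
      rw [actRight, Category.assoc, ← MonoidalCategory.whiskerLeft_comp, actLeft_eq,
        Category.assoc, Category.assoc, Iso.hom_inv_id, Category.comp_id]
    rw [Category.assoc, reassoc_of% k']
    simp [actRight]
  rw [k, k, h]

lemma actLeft_hom_ext {X Z : V} {f g : X ⟶ F.tanX ⊗ Z}
    (h : ∀ x, f ▷ F.F.functor.obj x ≫ actLeft (F.act x) Z =
      g ▷ F.F.functor.obj x ≫ actLeft (F.act x) Z) : f = g := by
  rw [← cancel_mono (β_ Z F.tanX).inv]
  refine F.actRight_hom_ext fun x => ?_
  have := h x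
  rw [actLeft_eq, ← comp_whiskerRight_assoc, ← comp_whiskerRight_assoc, ← Category.assoc,
    ← Category.assoc, cancel_mono] at this
  exact this

lemma exists_actLeft {X Z : V} (a : ∀ x, X ⊗ F.F.functor.obj x ⟶ F.F.functor.obj x ⊗ Z)
    (ha : ∀ ⦃x y : F.A⦄ (f : x ⟶ y),
      X ◁ F.F.functor.map f ≫ a y = a x ≫ F.F.functor.map f ▷ Z) :
    ∃ l : X ⟶ F.tanX ⊗ Z, ∀ x, l ▷ F.F.functor.obj x ≫ actLeft (F.act x) Z = a x := by
  obtain ⟨l, hl⟩ := F.exists_actRight (fun x => a x ≫ (β_ Z (F.F.functor.obj x)).inv) (by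
    intro x y f
    rw [reassoc_of% ha f, BraidedCategory.braiding_inv_naturality_left, Category.assoc])
  refine ⟨l ≫ (β_ Z F.tanX).hom, fun x => ?_⟩
  rw [actLeft_eq, ← comp_whiskerRight_assoc, Category.assoc, Iso.hom_inv_id, Category.comp_id,
    reassoc_of% hl x, Iso.inv_hom_id, Category.comp_id]

lemma boxAct_hom_ext {X : V} {f g : X ⟶ F.tanX ⊗ F.tanX}
    (h : ∀ x y, f ▷ (F.F.functor.obj x ⊗ F.F.functor.obj y) ≫ boxAct (F.act x) (F.act y) =
      g ▷ (F.F.functor.obj x ⊗ F.F.functor.obj y) ≫ boxAct (F.act x) (F.act y)) : f = g := by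
  refine F.actLeft_hom_ext fun x => F.actRight_hom_ext fun y => ?_
  rw [comp_whiskerRight_assoc, comp_whiskerRight_assoc, actLeft_actRight,
    associator_naturality_left_assoc, associator_naturality_left_assoc, h]

lemma boxAct_boxAct_hom_ext {X : V} {f g : X ⟶ F.tanX ⊗ (F.tanX ⊗ F.tanX)}
    (h : ∀ x y z,
      f ▷ (F.F.functor.obj x ⊗ (F.F.functor.obj y ⊗ F.F.functor.obj z)) ≫
        boxAct (F.act x) (boxAct (F.act y) (F.act z)) =
      g ▷ (F.F.functor.obj x ⊗ (F.F.functor.obj y ⊗ F.F.functor.obj z)) ≫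
        boxAct (F.act x) (boxAct (F.act y) (F.act z))) : f = g := by
  refine F.actLeft_hom_ext fun x => F.actRight_actLeft_hom_ext fun y => ?_
  rw [← cancel_mono (α_ _ _ _).inv]
  refine F.actRight_hom_ext fun z => ?_
  rw [← cancel_epi (α_ _ _ _).inv, ← cancel_mono (α_ _ _ _).hom]
  have k (f : X ⟶ F.tanX ⊗ (F.tanX ⊗ F.tanX)) :
      ((α_ (X ⊗ F.F.functor.obj x) (F.F.functor.obj y) (F.F.functor.obj z)).inv ≫
        (((f ▷ F.F.functor.obj x ≫ actLeft (F.act x) (F.tanX ⊗ F.tanX)) ▷ F.F.functor.obj y ≫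
          actRight (F.F.functor.obj x) (actLeft (F.act y) F.tanX)) ≫ (α_ _ _ _).inv) ▷
            F.F.functor.obj z ≫ actRight (F.F.functor.obj x ⊗ F.F.functor.obj y) (F.act z)) ≫
        (α_ _ _ _).hom =
      (α_ _ _ _).hom ≫ f ▷ (F.F.functor.obj x ⊗ (F.F.functor.obj y ⊗ F.F.functor.obj z)) ≫
        boxAct (F.act x) (boxAct (F.act y) (F.act z)) := by
    rw [← associator_naturality_left_assoc, ← actLeft_actRight, actRight_boxAct]
    simp
  rw [k, k, h]

lemma boxAct_boxAct_hom_ext' {X : V} {f g : X ⟶ (F.tanX ⊗ F.tanX) ⊗ F.tanX}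
    (h : ∀ x y z,
      f ▷ ((F.F.functor.obj x ⊗ F.F.functor.obj y) ⊗ F.F.functor.obj z) ≫
        boxAct (boxAct (F.act x) (F.act y)) (F.act z) =
      g ▷ ((F.F.functor.obj x ⊗ F.F.functor.obj y) ⊗ F.F.functor.obj z) ≫
        boxAct (boxAct (F.act x) (F.act y)) (F.act z)) : f = g := by
  rw [← cancel_mono (α_ _ _ _).hom]
  refine F.boxAct_boxAct_hom_ext fun x y z => ?_
  have := boxAct_assoc (F.act x) (F.act y) (F.act z)
  rw [MonoidalCategory.tensorHom_def, Category.assoc] at this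
  rw [← cancel_epi (X ◁ (α_ _ _ _).hom), comp_whiskerRight_assoc, comp_whiskerRight_assoc,
    whisker_exchange_assoc, whisker_exchange_assoc, ← this, reassoc_of% h, this,
    ← whisker_exchange_assoc, ← whisker_exchange_assoc]

lemma existsUnique_boxAct {X : V} (b : ∀ x y, X ⊗ (F.F.functor.obj x ⊗ F.F.functor.obj y) ⟶
      F.F.functor.obj x ⊗ F.F.functor.obj y)
    (hb : ∀ ⦃x x' y y' : F.A⦄ (f : x ⟶ x') (g : y ⟶ y'),
      X ◁ (F.F.functor.map f ⊗ₘ F.F.functor.map g) ≫ b x' y' =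
        b x y ≫ (F.F.functor.map f ⊗ₘ F.F.functor.map g)) :
    ∃! l : X ⟶ F.tanX ⊗ F.tanX, ∀ x y,
      l ▷ (F.F.functor.obj x ⊗ F.F.functor.obj y) ≫ boxAct (F.act x) (F.act y) = b x y := by
  have hr (x : F.A) ⦃y y' : F.A⦄ (g : y ⟶ y') : X ◁ F.F.functor.obj x ◁ F.F.functor.map g ≫
      b x y' = b x y ≫ F.F.functor.obj x ◁ F.F.functor.map g := by
    simpa using hb (𝟙 x) g
  have hl (y : F.A) ⦃x x' : F.A⦄ (f : x ⟶ x') : X ◁ F.F.functor.map f ▷ F.F.functor.obj y ≫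
      b x' y = b x y ≫ F.F.functor.map f ▷ F.F.functor.obj y := by
    simpa using hb f (𝟙 y)
  choose c hc using fun x => F.exists_actRight (fun y => (α_ X _ _).hom ≫ b x y)
    (fun y y' g => by simp [hr])
  obtain ⟨l, hl'⟩ := F.exists_actLeft c (fun x x' f => F.actRight_hom_ext fun y => by
    have k : F.F.functor.map f ▷ F.tanX ▷ F.F.functor.obj y ≫
        actRight (F.F.functor.obj x') (F.act y) = actRight (F.F.functor.obj x) (F.act y) ≫
          F.F.functor.map f ▷ F.F.functor.obj y := by
      simp [actRight, whisker_exchange]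
    rw [comp_whiskerRight_assoc, hc, comp_whiskerRight_assoc, k, reassoc_of% hc x y, ← hl,
      associator_naturality_middle_assoc])
  refine ⟨l, fun x y => ?_, fun l' hl'' => F.boxAct_hom_ext fun x y => ?_⟩
  · rw [← cancel_epi (α_ _ _ _).hom, ← associator_naturality_left_assoc, ← actLeft_actRight,
      ← comp_whiskerRight_assoc, hl', hc]
  · rw [hl'']
    rw [← cancel_epi (α_ _ _ _).hom, ← associator_naturality_left_assoc, ← actLeft_actRight,
      ← comp_whiskerRight_assoc, hl', hc]

end SFOver

namespace SFFunctor

variable {C : Type u₁} [Category.{v₁} C] [MonoidalCategory C]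
  {D : Type u₂} [Category.{v₂} D] [MonoidalCategory D] (F : SFFunctor C D)

lemma frobenius_split_right (x y z : C) :
    (α_ _ _ _).hom ≫ F.functor.obj x ◁ (μ F.functor y z ≫ δ F.functor y z) ≫ (α_ _ _ _).inv ≫
      (μ F.functor x y ≫ δ F.functor x y) ▷ F.functor.obj z =
    μ F.functor x y ▷ F.functor.obj z ≫ μ F.functor (x ⊗ y) z ≫
      δ F.functor (x ⊗ y) z ≫ δ F.functor x y ▷ F.functor.obj z := by
  have h := F.frobenius_right x y z
  simp only [MonoidalCategory.whiskerLeft_comp, comp_whiskerRight, Category.assoc]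
  rw [reassoc_of% h, ← Functor.LaxMonoidal.associativity_assoc, ← Functor.map_comp_assoc,
    Iso.hom_inv_id, CategoryTheory.Functor.map_id, Category.id_comp]

lemma frobenius_split_left (x y z : C) :
    (μ F.functor x y ≫ δ F.functor x y) ▷ F.functor.obj z ≫ (α_ _ _ _).hom ≫
      F.functor.obj x ◁ (μ F.functor y z ≫ δ F.functor y z) ≫ (α_ _ _ _).inv =
    μ F.functor x y ▷ F.functor.obj z ≫ μ F.functor (x ⊗ y) z ≫
      δ F.functor (x ⊗ y) z ≫ δ F.functor x y ▷ F.functor.obj z := by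
  have h := F.frobenius_left x y z
  simp only [MonoidalCategory.whiskerLeft_comp, comp_whiskerRight, Category.assoc]
  rw [reassoc_of% h, Functor.OplaxMonoidal.associativity_inv, ← Functor.map_comp_assoc,
    Iso.hom_inv_id, CategoryTheory.Functor.map_id, Category.id_comp]

end SFFunctor

namespace SFOver

variable {V : BMCat.{v, u}} (F : SFOver V)

theorem existsUnique_isComul : ∃! Δ, F.IsComul Δ := by
  have h := F.existsUnique_boxAct
    (fun x y => F.tanX ◁ μ F.F.functor x y ≫ F.act (x ⊗ y) ≫ δ F.F.functor x y) (by
      intro x x' y y' f g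
      rw [← MonoidalCategory.whiskerLeft_comp_assoc, μ_natural,
        MonoidalCategory.whiskerLeft_comp_assoc, reassoc_of% F.act_naturality (f ⊗ₘ g),
        ← δ_natural, Category.assoc, Category.assoc])
  exact h

lemma tanMul_act (x : F.A) :
    F.tanMul ▷ F.F.functor.obj x ≫ F.act x = compAct (F.act x) (F.act x) :=
  F.lift_act _ _ x

lemma tanOne_act (x : F.A) : F.tanOne ▷ F.F.functor.obj x ≫ F.act x = (λ_ _).hom :=
  F.lift_act _ _ x

lemma tanMul_assoc : F.tanMul ▷ F.tanX ≫ F.tanMul =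
    (α_ _ _ _).hom ≫ F.tanX ◁ F.tanMul ≫ F.tanMul := by
  refine F.tan_hom_ext fun x => ?_
  simp only [comp_whiskerRight, Category.assoc]
  rw [tanMul_act, whiskerRight_whiskerRight_compAct, whiskerLeft_whiskerRight_compAct, tanMul_act,
    compAct_assoc]

lemma tanOne_mul : F.tanOne ▷ F.tanX ≫ F.tanMul = (λ_ _).hom := by
  refine F.tan_hom_ext fun x => ?_
  rw [comp_whiskerRight_assoc, tanMul_act, whiskerRight_whiskerRight_compAct, tanOne_act,
    unit_compAct]

lemma tanMul_one : F.tanX ◁ F.tanOne ≫ F.tanMul = (ρ_ _).hom := by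
  refine F.tan_hom_ext fun x => ?_
  rw [comp_whiskerRight_assoc, tanMul_act, whiskerLeft_whiskerRight_compAct, tanOne_act,
    compAct_unit]

/-- The action of `tan F` on the unit of `F`. -/
noncomputable def evalUnit : F.tanX ⟶ F.F.functor.obj (𝟙_ F.A) :=
  (ρ_ _).inv ≫ F.tanX ◁ ε F.F.functor ≫ F.act (𝟙_ F.A)

lemma tanCounit_eq : F.tanCounit = F.evalUnit ≫ η F.F.functor := by
  simp [tanCounit, evalUnit]

lemma tanMul_evalUnit : F.tanMul ≫ F.evalUnit = F.tanX ◁ F.evalUnit ≫ F.act (𝟙_ F.A) := by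
  rw [evalUnit, rightUnitor_inv_naturality_assoc, ← whisker_exchange_assoc, tanMul_act]
  simp [compAct]

lemma tanMul_tanCounit : F.tanMul ≫ F.tanCounit =
    F.tanX ◁ F.evalUnit ≫ F.act (𝟙_ F.A) ≫ η F.F.functor := by
  rw [tanCounit_eq, ← Category.assoc, tanMul_evalUnit, Category.assoc]

section

variable {F} {Δ : F.tanX ⟶ F.tanX ⊗ F.tanX}

lemma IsComul.act (hΔ : F.IsComul Δ) (x y : F.A) :
    Δ ▷ (F.F.functor.obj x ⊗ F.F.functor.obj y) ≫ boxAct (F.act x) (F.act y) =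
      F.tanX ◁ μ F.F.functor x y ≫ F.act (x ⊗ y) ≫ δ F.F.functor x y :=
  hΔ x y

lemma IsComul.one_act (hΔ : F.IsComul Δ) (x y : F.A) :
    (F.tanOne ≫ Δ) ▷ (F.F.functor.obj x ⊗ F.F.functor.obj y) ≫ boxAct (F.act x) (F.act y) =
      (λ_ _).hom ≫ μ F.F.functor x y ≫ δ F.F.functor x y := by
  rw [comp_whiskerRight_assoc, hΔ.act, ← whisker_exchange_assoc, reassoc_of% tanOne_act,
    leftUnitor_naturality_assoc]

lemma IsComul.comul_assoc (hΔ : F.IsComul Δ) :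
    Δ ≫ Δ ▷ F.tanX ≫ (α_ _ _ _).hom = Δ ≫ F.tanX ◁ Δ := by
  refine F.boxAct_boxAct_hom_ext fun x y z => ?_
  have h₁ : (Δ ≫ Δ ▷ F.tanX) ▷
      ((F.F.functor.obj x ⊗ F.F.functor.obj y) ⊗ F.F.functor.obj z) ≫
        boxAct (boxAct (F.act x) (F.act y)) (F.act z) =
      F.tanX ◁ (μ F.F.functor x y ▷ F.F.functor.obj z ≫ μ F.F.functor (x ⊗ y) z) ≫
        F.act ((x ⊗ y) ⊗ z) ≫ δ F.F.functor (x ⊗ y) z ≫ δ F.F.functor x y ▷ F.F.functor.obj z := by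
    rw [comp_whiskerRight_assoc, whiskerRight_whiskerRight_boxAct, hΔ.act,
      ← whiskerLeft_whiskerRight_comp_boxAct, ← boxAct_whiskerRight, ← whisker_exchange_assoc,
      reassoc_of% hΔ.act, MonoidalCategory.whiskerLeft_comp_assoc]
  have h₂ : (Δ ≫ F.tanX ◁ Δ) ▷
      (F.F.functor.obj x ⊗ (F.F.functor.obj y ⊗ F.F.functor.obj z)) ≫
        boxAct (F.act x) (boxAct (F.act y) (F.act z)) =
      F.tanX ◁ (F.F.functor.obj x ◁ μ F.F.functor y z ≫ μ F.F.functor x (y ⊗ z)) ≫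
        F.act (x ⊗ (y ⊗ z)) ≫ δ F.F.functor x (y ⊗ z) ≫
          F.F.functor.obj x ◁ δ F.F.functor y z := by
    rw [comp_whiskerRight_assoc, whiskerLeft_whiskerRight_boxAct, hΔ.act,
      ← whiskerLeft_whiskerLeft_boxAct, ← boxAct_whiskerLeft, ← whisker_exchange_assoc,
      reassoc_of% hΔ.act, MonoidalCategory.whiskerLeft_comp_assoc]
  have k := boxAct_assoc (F.act x) (F.act y) (F.act z)
  rw [MonoidalCategory.tensorHom_def, Category.assoc] at k
  rw [h₂, ← cancel_epi (F.tanX ◁ (α_ _ _ _).hom), ← Category.assoc Δ, comp_whiskerRight_assoc,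
    whisker_exchange_assoc, whisker_exchange_assoc, ← k, reassoc_of% h₁,
    ← MonoidalCategory.whiskerLeft_comp_assoc, ← Functor.LaxMonoidal.associativity,
    Functor.OplaxMonoidal.associativity, ← reassoc_of% F.act_naturality (α_ x y z).hom]
  simp only [MonoidalCategory.whiskerLeft_comp, Category.assoc]

lemma IsComul.counit_comul (hΔ : F.IsComul Δ) : Δ ≫ F.tanCounit ▷ F.tanX = (λ_ _).inv := by
  rw [← cancel_mono (λ_ _).hom, Iso.inv_hom_id, Category.assoc]
  refine F.tan_hom_ext fun x => ?_
  rw [comp_whiskerRight_assoc, tanCounit, ← boxAct_scalar_left_act,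
    ← reassoc_of% whiskerLeft_whiskerRight_comp_boxAct, ← reassoc_of% boxAct_whiskerRight,
    ← whisker_exchange_assoc, ← whisker_exchange_assoc, reassoc_of% hΔ.act,
    ← MonoidalCategory.whiskerLeft_comp_assoc, ← MonoidalCategory.whiskerLeft_comp_assoc,
    Category.assoc, Functor.LaxMonoidal.left_unitality_inv, reassoc_of% F.act_naturality,
    Functor.OplaxMonoidal.left_unitality_hom, ← Functor.map_comp, Iso.inv_hom_id,
    CategoryTheory.Functor.map_id, Category.comp_id, id_whiskerRight, Category.id_comp]

lemma IsComul.comul_counit (hΔ : F.IsComul Δ) : Δ ≫ F.tanX ◁ F.tanCounit = (ρ_ _).inv := by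
  rw [← cancel_mono (ρ_ _).hom, Iso.inv_hom_id, Category.assoc]
  refine F.tan_hom_ext fun x => ?_
  rw [comp_whiskerRight_assoc, tanCounit, ← boxAct_scalar_right_act,
    ← reassoc_of% whiskerLeft_whiskerLeft_boxAct, ← reassoc_of% boxAct_whiskerLeft,
    ← whisker_exchange_assoc, ← whisker_exchange_assoc, reassoc_of% hΔ.act,
    ← MonoidalCategory.whiskerLeft_comp_assoc, ← MonoidalCategory.whiskerLeft_comp_assoc,
    Category.assoc, Functor.LaxMonoidal.right_unitality_inv, reassoc_of% F.act_naturality,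
    Functor.OplaxMonoidal.right_unitality_hom, ← Functor.map_comp, Iso.inv_hom_id,
    CategoryTheory.Functor.map_id, Category.comp_id, id_whiskerRight, Category.id_comp]

lemma IsComul.mul_comul (hΔ : F.IsComul Δ) : F.tanMul ≫ Δ = (Δ ⊗ₘ Δ) ≫ tensorμ _ _ _ _ ≫
    (F.tanMul ⊗ₘ F.tanMul) := by
  refine F.boxAct_hom_ext fun x y => ?_
  have hs := F.F.separable x y
  rw [comp_whiskerRight_assoc, hΔ.act, ← whisker_exchange_assoc, reassoc_of% tanMul_act,
    comp_whiskerRight_assoc, comp_whiskerRight_assoc, tensorHom_whiskerRight_boxAct, tanMul_act,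
    tanMul_act, ← compAct_boxAct, tensorHom_whiskerRight_compAct, hΔ.act, compAct_comp,
    whiskerLeft_compAct, ← Category.assoc _ _ (δ F.F.functor x y),
    compAct_comp_right _ _ (δ F.F.functor x y), Category.assoc,
    ← MonoidalCategory.whiskerLeft_comp_assoc, hs, MonoidalCategory.whiskerLeft_id,
    Category.id_comp]

lemma IsComul.comulOne_comul_act (hΔ : F.IsComul Δ) (x y z : F.A) :
    ((F.tanOne ≫ Δ) ≫ Δ ▷ F.tanX) ▷
      ((F.F.functor.obj x ⊗ F.F.functor.obj y) ⊗ F.F.functor.obj z) ≫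
        boxAct (boxAct (F.act x) (F.act y)) (F.act z) =
    (λ_ _).hom ≫ μ F.F.functor x y ▷ F.F.functor.obj z ≫ μ F.F.functor (x ⊗ y) z ≫
      δ F.F.functor (x ⊗ y) z ≫ δ F.F.functor x y ▷ F.F.functor.obj z := by
  rw [comp_whiskerRight_assoc, whiskerRight_whiskerRight_boxAct, hΔ.act,
    ← whiskerLeft_whiskerRight_comp_boxAct, ← boxAct_whiskerRight, ← whisker_exchange_assoc,
    reassoc_of% hΔ.one_act, leftUnitor_naturality_assoc]

lemma IsComul.weak_unit (hΔ : F.IsComul Δ) : (F.tanOne ≫ Δ) ≫ Δ ▷ F.tanX =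
    (λ_ (𝟙_ V)).inv ≫ ((F.tanOne ≫ Δ) ⊗ₘ (F.tanOne ≫ Δ)) ≫ (α_ _ _ _).hom ≫
      F.tanX ◁ ((α_ _ _ _).inv ≫ F.tanMul ▷ F.tanX) ≫ (α_ _ _ _).inv := by
  refine F.boxAct_boxAct_hom_ext' fun x y z => ?_
  have h : (λ_ (𝟙_ V)).inv ≫ ((F.tanOne ≫ Δ) ⊗ₘ (F.tanOne ≫ Δ)) ≫ (α_ _ _ _).hom ≫
      F.tanX ◁ ((α_ _ _ _).inv ≫ F.tanMul ▷ F.tanX) ≫ (α_ _ _ _).inv =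
      ((λ_ (𝟙_ V)).inv ≫ ((F.tanOne ≫ Δ) ⊗ₘ (F.tanOne ≫ Δ)) ≫ (α_ _ _ _).hom ≫
        F.tanX ◁ (α_ _ _ _).inv ≫ (α_ _ _ _).inv) ≫ (F.tanX ◁ F.tanMul) ▷ F.tanX := by
    simp only [MonoidalCategory.whiskerLeft_comp, Category.assoc,
      associator_inv_naturality_middle]
  rw [hΔ.comulOne_comul_act, h, comp_whiskerRight_assoc, whiskerRight_whiskerRight_boxAct,
    whiskerLeft_whiskerRight_boxAct, tanMul_act,
    elements_boxAct_compAct _ _ _ _ _ _ _ _ (hΔ.one_act x y) (hΔ.one_act y z),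
    Category.assoc, Category.assoc, F.F.frobenius_split_right]

lemma IsComul.weak_unit_braided (hΔ : F.IsComul Δ) : (F.tanOne ≫ Δ) ≫ Δ ▷ F.tanX =
    (λ_ (𝟙_ V)).inv ≫ ((F.tanOne ≫ Δ) ⊗ₘ (F.tanOne ≫ Δ)) ≫ (α_ _ _ _).hom ≫
      F.tanX ◁ ((α_ _ _ _).inv ≫ ((β_ F.tanX F.tanX).inv ≫ F.tanMul) ▷ F.tanX) ≫
        (α_ _ _ _).inv := by
  refine F.boxAct_boxAct_hom_ext' fun x y z => ?_
  have h : (λ_ (𝟙_ V)).inv ≫ ((F.tanOne ≫ Δ) ⊗ₘ (F.tanOne ≫ Δ)) ≫ (α_ _ _ _).hom ≫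
      F.tanX ◁ ((α_ _ _ _).inv ≫ ((β_ F.tanX F.tanX).inv ≫ F.tanMul) ▷ F.tanX) ≫
        (α_ _ _ _).inv =
      ((λ_ (𝟙_ V)).inv ≫ ((F.tanOne ≫ Δ) ⊗ₘ (F.tanOne ≫ Δ)) ≫ (α_ _ _ _).hom ≫
        F.tanX ◁ ((α_ _ _ _).inv ≫ (β_ F.tanX F.tanX).inv ▷ F.tanX) ≫ (α_ _ _ _).inv) ≫
          (F.tanX ◁ F.tanMul) ▷ F.tanX := by
    simp only [MonoidalCategory.whiskerLeft_comp, Category.assoc, comp_whiskerRight,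
      associator_inv_naturality_middle, associator_inv_naturality_middle_assoc]
  rw [hΔ.comulOne_comul_act, h, comp_whiskerRight_assoc, whiskerRight_whiskerRight_boxAct,
    whiskerLeft_whiskerRight_boxAct, tanMul_act,
    elements_boxAct_compAct_braided _ _ _ _ _ _ _ _ (hΔ.one_act x y) (hΔ.one_act y z),
    F.F.frobenius_split_left]

lemma IsComul.comul_evalUnit (hΔ : F.IsComul Δ) : Δ ▷ F.tanX ≫ (α_ _ _ _).hom ≫
    (F.evalUnit ⊗ₘ (F.tanMul ≫ F.tanCounit)) ≫ (ρ_ _).hom = F.tanMul ≫ F.evalUnit := by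
  have h := boxAct_scalar_left (F.tanX ◁ ε F.F.functor ≫ F.act (𝟙_ F.A))
    (F.tanX ◁ F.evalUnit ≫ F.act (𝟙_ F.A))
  rw [← whiskerLeft_tensorHom_boxAct] at h
  rw [tanMul_tanCounit, ← Category.assoc (F.tanX ◁ F.evalUnit), ← tensorHom_comp_whiskerLeft,
    Category.assoc]
  change _ ≫ _ ≫ (((ρ_ _).inv ≫ F.tanX ◁ ε F.F.functor ≫ F.act (𝟙_ F.A)) ⊗ₘ _) ≫ _ = _
  rw [← reassoc_of% h, ← whisker_exchange_assoc, ← whisker_exchange_assoc, reassoc_of% hΔ.act,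
    ← MonoidalCategory.whiskerLeft_comp_assoc, ← MonoidalCategory.whiskerLeft_comp_assoc,
    Category.assoc, ε_tensorHom_comp_μ, leftUnitor_naturality_assoc, Iso.inv_hom_id_assoc,
    MonoidalCategory.whiskerLeft_comp_assoc, reassoc_of% F.act_naturality,
    Functor.OplaxMonoidal.right_unitality_hom, ← Functor.map_comp, ← unitors_equal,
    Iso.inv_hom_id, CategoryTheory.Functor.map_id, Category.comp_id, tanMul_evalUnit]

lemma IsComul.comul_braiding_evalUnit (hΔ : F.IsComul Δ) :
    (Δ ≫ (β_ _ _).inv) ▷ F.tanX ≫ (α_ _ _ _).hom ≫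
    (F.evalUnit ⊗ₘ (F.tanMul ≫ F.tanCounit)) ≫ (ρ_ _).hom = F.tanMul ≫ F.evalUnit := by
  have h := boxAct_scalar_right (F.tanX ◁ F.evalUnit ≫ F.act (𝟙_ F.A))
    (F.tanX ◁ ε F.F.functor ≫ F.act (𝟙_ F.A))
  rw [← whiskerLeft_tensorHom_boxAct] at h
  rw [tanMul_tanCounit, comp_whiskerRight_assoc, ← braiding_inv_scalar,
    ← Category.assoc (F.tanX ◁ F.evalUnit), ← tensorHom_comp_whiskerRight, Category.assoc]
  change _ ≫ _ ≫ _ ≫ _ ≫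
    (_ ⊗ₘ ((ρ_ _).inv ≫ F.tanX ◁ ε F.F.functor ≫ F.act (𝟙_ F.A))) ≫ _ = _
  rw [← reassoc_of% h, ← whisker_exchange_assoc, ← whisker_exchange_assoc, reassoc_of% hΔ.act,
    ← MonoidalCategory.whiskerLeft_comp_assoc, ← MonoidalCategory.whiskerLeft_comp_assoc,
    Category.assoc, tensorHom_ε_comp_μ, rightUnitor_naturality_assoc, Iso.inv_hom_id_assoc,
    MonoidalCategory.whiskerLeft_comp_assoc, reassoc_of% F.act_naturality,
    Functor.OplaxMonoidal.left_unitality_hom, ← Functor.map_comp, unitors_equal,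
    Iso.inv_hom_id, CategoryTheory.Functor.map_id, Category.comp_id, tanMul_evalUnit]

lemma weak_counit_of_evalUnit (d : F.tanX ⟶ F.tanX ⊗ F.tanX)
    (h : d ▷ F.tanX ≫ (α_ _ _ _).hom ≫ (F.evalUnit ⊗ₘ (F.tanMul ≫ F.tanCounit)) ≫ (ρ_ _).hom =
      F.tanMul ≫ F.evalUnit) :
    F.tanMul ▷ F.tanX ≫ F.tanMul ≫ F.tanCounit =
      (F.tanX ◁ d ≫ (α_ _ _ _).inv) ▷ F.tanX ≫ (α_ _ _ _).hom ≫
        ((F.tanMul ≫ F.tanCounit) ⊗ₘ (F.tanMul ≫ F.tanCounit)) ≫ (λ_ (𝟙_ V)).hom := by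
  have k := F.tanMul_tanCounit
  conv_lhs => rw [reassoc_of% F.tanMul_assoc, k, ← MonoidalCategory.whiskerLeft_comp_assoc, ← h]
  generalize F.tanMul ≫ F.tanCounit = t at k ⊢
  rw [← scalar_tensorHom, ← k]

lemma IsComul.isWeakBialgebra (hΔ : F.IsComul Δ) : (F.tanPre Δ).IsWeakBialgebra where
  mul_assoc := F.tanMul_assoc
  one_mul := F.tanOne_mul
  mul_one := F.tanMul_one
  comul_assoc := hΔ.comul_assoc
  counit_comul := hΔ.counit_comul
  comul_counit := hΔ.comul_counit
  mul_comul := hΔ.mul_comul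
  weak_unit := hΔ.weak_unit
  weak_unit_braided := hΔ.weak_unit_braided
  weak_counit := weak_counit_of_evalUnit _ hΔ.comul_evalUnit
  weak_counit_braided := weak_counit_of_evalUnit _ hΔ.comul_braiding_evalUnit

end

end SFOver

section

variable {C : Type u₁} [Category.{v₁} C] [MonoidalCategory C]

lemma element_left_act {A T T' M P : C} (c : 𝟙_ C ⟶ A) (g : A ⊗ T ⟶ T') (a : T' ⊗ M ⟶ P) :
    ((λ_ T).inv ≫ c ▷ T ≫ g) ▷ M ≫ a =
      (λ_ (T ⊗ M)).inv ≫ c ▷ (T ⊗ M) ≫ (α_ A T M).inv ≫ g ▷ M ≫ a := by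
  monoidal

lemma element_right_act {A T T' M P : C} (c : 𝟙_ C ⟶ A) (g : T ⊗ A ⟶ T') (a : T' ⊗ M ⟶ P) :
    ((ρ_ T).inv ≫ T ◁ c ≫ g) ▷ M ≫ a =
      T ◁ ((λ_ M).inv ≫ c ▷ M) ≫ (α_ T A M).inv ≫ g ▷ M ≫ a := by
  monoidal

lemma scalar_left_act {A B D M N Q : C} (u : B ⟶ M) (s : A ⊗ M ⟶ 𝟙_ C) (b : D ⊗ N ⟶ Q) :
    (α_ A (B ⊗ D) N).inv ≫ ((α_ A B D).inv ≫ (A ◁ u ≫ s) ▷ D ≫ (λ_ D).hom) ▷ N ≫ b =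
      A ◁ ((α_ B D N).hom ≫ (u ⊗ₘ b)) ≫ (α_ A M Q).inv ≫ s ▷ Q ≫ (λ_ Q).hom := by
  rw [MonoidalCategory.tensorHom_def]
  calc
    _ = 𝟙 _ ⊗≫ A ◁ u ▷ D ▷ N ⊗≫ (s ▷ (D ⊗ N) ≫ 𝟙_ C ◁ b) ⊗≫ 𝟙 _ := by monoidal
    _ = _ := by rw [← whisker_exchange]; monoidal

variable [BraidedCategory C]

lemma braiding_scalar_right_act {A B D N Q : C} (t : A ⊗ D ⟶ 𝟙_ C) (b : B ⊗ N ⟶ Q) :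
    (α_ A (B ⊗ D) N).inv ≫ ((α_ A B D).inv ≫ (β_ A B).hom ▷ D ≫ (α_ B A D).hom ≫
      B ◁ t ≫ (ρ_ B).hom) ▷ N ≫ b =
    A ◁ ((α_ B D N).hom ≫ B ◁ (β_ D N).hom ≫ (α_ B N D).inv ≫ b ▷ D) ≫ (α_ A Q D).inv ≫
      (β_ A Q).hom ▷ D ≫ (α_ Q A D).hom ≫ Q ◁ t ≫ (ρ_ Q).hom := by
  have h₁ : A ◁ (b ▷ D) ≫ (α_ A Q D).inv ≫ (β_ A Q).hom ▷ D ≫ (α_ Q A D).hom ≫ Q ◁ t ≫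
      (ρ_ Q).hom = (α_ A (B ⊗ N) D).inv ≫ (β_ A (B ⊗ N)).hom ▷ D ≫ (α_ (B ⊗ N) A D).hom ≫
        (B ⊗ N) ◁ t ≫ (ρ_ (B ⊗ N)).hom ≫ b := by
    rw [← rightUnitor_naturality, whisker_exchange_assoc, ← associator_naturality_left_assoc,
      ← comp_whiskerRight_assoc, ← BraidedCategory.braiding_naturality_right,
      comp_whiskerRight_assoc, associator_inv_naturality_middle_assoc]
  have h₂ : (β_ (A ⊗ D) N).hom ≫ N ◁ t = t ▷ N ≫ (λ_ N).hom ≫ (ρ_ N).inv := by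
    rw [← BraidedCategory.braiding_naturality_left, braiding_tensorUnit_left]
  simp only [MonoidalCategory.whiskerLeft_comp, Category.assoc, h₁]
  rw [BraidedCategory.braiding_tensor_right_hom]
  symm
  calc
    _ = 𝟙 _ ⊗≫ ((A ⊗ B) ◁ (β_ D N).hom ≫ (β_ A B).hom ▷ (N ⊗ D)) ⊗≫
        B ◁ ((β_ A N).hom ▷ D ⊗≫ N ◁ t) ⊗≫ b := by monoidal
    _ = 𝟙 _ ⊗≫ (β_ A B).hom ▷ D ▷ N ⊗≫ B ◁ ((α_ _ _ _).hom ≫ A ◁ (β_ D N).hom ≫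
        (α_ _ _ _).inv ≫ (β_ A N).hom ▷ D ≫ (α_ _ _ _).hom ≫ N ◁ t) ⊗≫ b := by
          rw [whisker_exchange]; monoidal
    _ = 𝟙 _ ⊗≫ (β_ A B).hom ▷ D ▷ N ⊗≫ B ◁ (t ▷ N ≫ (λ_ N).hom ≫ (ρ_ N).inv) ⊗≫ b := by
          rw [← h₂, BraidedCategory.braiding_tensor_left_hom]; simp only [Category.assoc]
    _ = _ := by monoidal

lemma scalar_right_act {A B D M N Q : C} (u : D ⟶ M) (s : A ⊗ M ⟶ 𝟙_ C) (b : B ⊗ N ⟶ Q) :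
    (α_ A (B ⊗ D) N).inv ≫ ((α_ A B D).inv ≫ (β_ A B).hom ▷ D ≫ (α_ B A D).hom ≫
      B ◁ (A ◁ u ≫ s) ≫ (ρ_ B).hom) ▷ N ≫ b =
    A ◁ ((α_ B D N).hom ≫ B ◁ (β_ D N).hom ≫ (α_ B N D).inv ≫ (b ⊗ₘ u)) ≫ (α_ A Q M).inv ≫
      (β_ A Q).hom ▷ M ≫ (α_ Q A M).hom ≫ Q ◁ s ≫ (ρ_ Q).hom := by
  have h : Q ◁ (A ◁ u) = (α_ Q A D).inv ≫ (Q ⊗ A) ◁ u ≫ (α_ Q A M).hom := by simp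
  rw [braiding_scalar_right_act, MonoidalCategory.tensorHom_def,
    MonoidalCategory.whiskerLeft_comp Q, h]
  simp only [MonoidalCategory.whiskerLeft_comp, Category.assoc, Iso.hom_inv_id_assoc]
  rw [← whisker_exchange_assoc, associator_inv_naturality_right_assoc]

end

namespace SFOver

variable {V : BMCat.{v, u}} {F : SFOver V} {Δ : F.tanX ⟶ F.tanX ⊗ F.tanX}

lemma IsComul.idemS_act (hΔ : F.IsComul Δ) (x : F.A) :
    (F.tanPre Δ).idemS ▷ F.F.functor.obj x ≫ F.act x =
      (β_ F.tanX (F.F.functor.obj x)).hom ≫ F.F.functor.obj x ◁ F.evalUnit ≫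
        μ F.F.functor x (𝟙_ F.A) ≫ F.F.functor.map (ρ_ x).hom := by
  change ((λ_ F.tanX).inv ≫ (F.tanOne ≫ Δ) ▷ F.tanX ≫ (α_ _ _ _).hom ≫
    F.tanX ◁ (F.tanMul ≫ F.tanCounit) ≫ (ρ_ _).hom) ▷ F.F.functor.obj x ≫ F.act x = _
  rw [element_left_act, ← braiding_boxAct_scalar_right, tanMul_tanCounit,
    ← reassoc_of% whiskerLeft_whiskerLeft_boxAct, ← reassoc_of% boxAct_whiskerLeft,
    ← whisker_exchange_assoc, ← whisker_exchange_assoc, reassoc_of% hΔ.one_act,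
    leftUnitor_naturality_assoc, leftUnitor_naturality_assoc, Iso.inv_hom_id_assoc,
    Functor.OplaxMonoidal.right_unitality_hom]

lemma IsComul.idemT_act (hΔ : F.IsComul Δ) (x : F.A) :
    (F.tanPre Δ).idemT ▷ F.F.functor.obj x ≫ F.act x =
      F.evalUnit ▷ F.F.functor.obj x ≫ μ F.F.functor (𝟙_ F.A) x ≫
        F.F.functor.map (λ_ x).hom := by
  change ((λ_ F.tanX).inv ≫ (F.tanOne ≫ Δ) ▷ F.tanX ≫ (α_ _ _ _).hom ≫
    F.tanX ◁ (β_ _ _).hom ≫ (α_ _ _ _).inv ≫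
      (F.tanMul ≫ F.tanCounit) ▷ F.tanX ≫ (λ_ _).hom) ▷ F.F.functor.obj x ≫ F.act x = _
  rw [element_left_act, ← boxAct_scalar_left_comp, tanMul_tanCounit,
    ← reassoc_of% whiskerLeft_whiskerRight_comp_boxAct, ← reassoc_of% boxAct_whiskerRight,
    ← whisker_exchange_assoc, reassoc_of% hΔ.one_act,
    leftUnitor_naturality_assoc, Iso.inv_hom_id_assoc,
    Functor.OplaxMonoidal.left_unitality_hom]

lemma IsComul.idemZ_act (hΔ : F.IsComul Δ) (x : F.A) :
    (F.tanPre Δ).idemZ ▷ F.F.functor.obj x ≫ F.act x =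
      F.tanX ◁ (F.F.functor.map (λ_ x).inv ≫ δ F.F.functor (𝟙_ F.A) x) ≫ (α_ _ _ _).inv ≫
        (F.act (𝟙_ F.A) ≫ η F.F.functor) ▷ F.F.functor.obj x ≫ (λ_ _).hom := by
  change ((ρ_ F.tanX).inv ≫ F.tanX ◁ (F.tanOne ≫ Δ) ≫ (α_ _ _ _).inv ≫
    (F.tanMul ≫ F.tanCounit) ▷ F.tanX ≫ (λ_ _).hom) ▷ F.F.functor.obj x ≫ F.act x = _
  rw [element_right_act, tanMul_tanCounit, scalar_left_act, evalUnit, ← boxAct_scalar_left,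
    ← whiskerLeft_whiskerRight_comp_boxAct, ← MonoidalCategory.whiskerLeft_comp_assoc,
    Category.assoc, ← whisker_exchange_assoc, ← whisker_exchange_assoc, hΔ.one_act,
    leftUnitor_naturality_assoc, leftUnitor_naturality_assoc, Iso.inv_hom_id_assoc,
    Functor.LaxMonoidal.left_unitality_inv_assoc]

lemma IsComul.idemR_act (hΔ : F.IsComul Δ) (x : F.A) :
    (F.tanPre Δ).idemR ▷ F.F.functor.obj x ≫ F.act x =
      F.tanX ◁ (F.F.functor.map (ρ_ x).inv ≫ δ F.F.functor x (𝟙_ F.A)) ≫ (α_ _ _ _).inv ≫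
        (β_ F.tanX (F.F.functor.obj x)).hom ▷ F.F.functor.obj (𝟙_ F.A) ≫ (α_ _ _ _).hom ≫
          F.F.functor.obj x ◁ (F.act (𝟙_ F.A) ≫ η F.F.functor) ≫ (ρ_ _).hom := by
  change ((ρ_ F.tanX).inv ≫ F.tanX ◁ (F.tanOne ≫ Δ) ≫ (α_ _ _ _).inv ≫
    (β_ _ _).hom ▷ F.tanX ≫ (α_ _ _ _).hom ≫
      F.tanX ◁ (F.tanMul ≫ F.tanCounit) ≫ (ρ_ _).hom) ▷ F.F.functor.obj x ≫ F.act x = _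
  rw [element_right_act, tanMul_tanCounit, scalar_right_act, evalUnit, ← boxAct_scalar_right,
    ← whiskerLeft_whiskerLeft_boxAct, ← MonoidalCategory.whiskerLeft_comp_assoc,
    Category.assoc, ← whisker_exchange_assoc, ← whisker_exchange_assoc, hΔ.one_act,
    leftUnitor_naturality_assoc, leftUnitor_naturality_assoc, Iso.inv_hom_id_assoc,
    Functor.LaxMonoidal.right_unitality_inv_assoc]

end SFOver

section

variable {C : Type u₁} [Category.{v₁} C] [MonoidalCategory C]

lemma scalar_left_natural {T T' M M' N N' : C} (g : T' ⟶ T) (a : M' ⟶ M) (b : N' ⟶ N)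
    (s : T ⊗ M ⟶ 𝟙_ C) :
    T' ◁ (a ⊗ₘ b) ≫ g ▷ (M ⊗ N) ≫ (α_ T M N).inv ≫ s ▷ N ≫ (λ_ N).hom =
      (α_ T' M' N').inv ≫ (T' ◁ a ≫ g ▷ M ≫ s) ▷ N' ≫ (λ_ N').hom ≫ b := by
  rw [← leftUnitor_naturality, ← whisker_exchange_assoc, MonoidalCategory.tensorHom_def']
  monoidal

lemma scalar_right_natural [BraidedCategory C] {T T' M M' N N' : C} (g : T' ⟶ T) (a : M' ⟶ M)
    (b : N' ⟶ N) (s : T ⊗ M ⟶ 𝟙_ C) :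
    T' ◁ (b ⊗ₘ a) ≫ g ▷ (N ⊗ M) ≫ (α_ T N M).inv ≫ (β_ T N).hom ▷ M ≫ (α_ N T M).hom ≫
      N ◁ s ≫ (ρ_ N).hom =
    (α_ T' N' M').inv ≫ (β_ T' N').hom ▷ M' ≫ (α_ N' T' M').hom ≫
      N' ◁ (T' ◁ a ≫ g ▷ M ≫ s) ≫ (ρ_ N').hom ≫ b := by
  have h₁ : T' ◁ (b ⊗ₘ a) ≫ g ▷ (N ⊗ M) ≫ (α_ T N M).inv =
      (α_ T' N' M').inv ≫ ((g ⊗ₘ b) ⊗ₘ a) := by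
    rw [← associator_inv_naturality, MonoidalCategory.tensorHom_def' g, Category.assoc]
  have h₂ : ((g ⊗ₘ b) ⊗ₘ a) ≫ (β_ T N).hom ▷ M =
      (β_ T' N').hom ▷ M' ≫ ((b ⊗ₘ g) ⊗ₘ a) := by
    rw [tensorHom_comp_whiskerRight, whiskerRight_comp_tensorHom,
      BraidedCategory.braiding_naturality]
  have h₃ : ((b ⊗ₘ g) ⊗ₘ a) ≫ (α_ N T M).hom = (α_ N' T' M').hom ≫
      N' ◁ (T' ◁ a ≫ g ▷ M) ≫ b ▷ (T ⊗ M) := by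
    rw [associator_naturality, MonoidalCategory.tensorHom_def' b, MonoidalCategory.tensorHom_def' g]
  rw [reassoc_of% h₁, reassoc_of% h₂, reassoc_of% h₃, ← whisker_exchange_assoc,
    rightUnitor_naturality]
  simp only [MonoidalCategory.whiskerLeft_comp, Category.assoc]

end

namespace SFOver

variable {V : BMCat.{v, u}} {F G : SFOver V} (f : F ⟶ G)

/-- The components of the isomorphism that is part of a morphism of `sfmon ⫽ V`. -/
noncomputable def comparison (x : F.A) :
    G.F.functor.obj ((Hom.H f).functor.obj x) ⟶ F.F.functor.obj x :=
  (Hom.iso f).hom.app x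

instance (x : F.A) : IsIso (comparison f x) :=
  inferInstanceAs (IsIso ((Hom.iso f).hom.app x))

lemma comparison_naturality {x y : F.A} (g : x ⟶ y) :
    G.F.functor.map ((Hom.H f).functor.map g) ≫ comparison f y =
      comparison f x ≫ F.F.functor.map g :=
  (Hom.iso f).hom.naturality g

lemma comparison_unit : ε G.F.functor ≫ G.F.functor.map (ε (Hom.H f).functor) ≫
    comparison f (𝟙_ F.A) = ε F.F.functor := by
  have h := (Hom.bimonoidal f).unit
  rw [comp_ε, Category.assoc] at h
  exact h

lemma comparison_tensor (x y : F.A) : μ G.F.functor _ _ ≫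
    G.F.functor.map (μ (Hom.H f).functor x y) ≫ comparison f (x ⊗ y) =
      (comparison f x ⊗ₘ comparison f y) ≫ μ F.F.functor x y := by
  have h := (Hom.bimonoidal f).tensor x y
  rw [comp_μ, Category.assoc] at h
  exact h

lemma comparison_counit : comparison f (𝟙_ F.A) ≫ η F.F.functor =
    G.F.functor.map (η (Hom.H f).functor) ≫ η G.F.functor := by
  have h := (Hom.bimonoidal f).counit
  rw [comp_η] at h
  exact h

lemma comparison_cotensor (x y : F.A) : comparison f (x ⊗ y) ≫ δ F.F.functor x y =
    G.F.functor.map (δ (Hom.H f).functor x y) ≫ δ G.F.functor _ _ ≫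
      (comparison f x ⊗ₘ comparison f y) := by
  have h := (Hom.bimonoidal f).cotensor x y
  rw [comp_δ, Category.assoc] at h
  exact h

lemma comparison_tanHom_act (x : F.A) :
    G.tanX ◁ comparison f x ≫ tanHom f ▷ F.F.functor.obj x ≫ F.act x =
      G.act ((Hom.H f).functor.obj x) ≫ comparison f x :=
  whiskerLeft_iso_tanHom_act f x

lemma comparison_hom_ext {X : V} {l l' : X ⟶ F.tanX}
    (h : ∀ x, X ◁ comparison f x ≫ l ▷ F.F.functor.obj x ≫ F.act x =
      X ◁ comparison f x ≫ l' ▷ F.F.functor.obj x ≫ F.act x) : l = l' :=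
  F.tan_hom_ext fun x => (cancel_epi (X ◁ comparison f x)).1 (h x)

lemma tanHom_evalUnit : tanHom f ≫ F.evalUnit =
    G.evalUnit ≫ G.F.functor.map (ε (Hom.H f).functor) ≫ comparison f (𝟙_ F.A) := by
  rw [evalUnit, evalUnit, rightUnitor_inv_naturality_assoc, ← whisker_exchange_assoc,
    ← comparison_unit f, ← Category.assoc (ε G.F.functor), MonoidalCategory.whiskerLeft_comp_assoc,
    comparison_tanHom_act, MonoidalCategory.whiskerLeft_comp_assoc,
    reassoc_of% G.act_naturality]
  simp only [Category.assoc]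

lemma comparison_rightUnit (x : F.A) :
    (comparison f x ⊗ₘ (G.F.functor.map (ε (Hom.H f).functor) ≫ comparison f (𝟙_ F.A))) ≫
      μ F.F.functor x (𝟙_ F.A) ≫ F.F.functor.map (ρ_ x).hom =
    μ G.F.functor ((Hom.H f).functor.obj x) (𝟙_ G.A) ≫
      G.F.functor.map (ρ_ ((Hom.H f).functor.obj x)).hom ≫ comparison f x := by
  rw [← whiskerLeft_comp_tensorHom_assoc, ← reassoc_of% comparison_tensor, ← comparison_naturality,
    μ_natural_right_assoc, Functor.LaxMonoidal.right_unitality]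
  simp only [Functor.map_comp, Category.assoc]

lemma comparison_leftUnit (x : F.A) :
    ((G.F.functor.map (ε (Hom.H f).functor) ≫ comparison f (𝟙_ F.A)) ⊗ₘ comparison f x) ≫
      μ F.F.functor (𝟙_ F.A) x ≫ F.F.functor.map (λ_ x).hom =
    μ G.F.functor (𝟙_ G.A) ((Hom.H f).functor.obj x) ≫
      G.F.functor.map (λ_ ((Hom.H f).functor.obj x)).hom ≫ comparison f x := by
  rw [← whiskerRight_comp_tensorHom_assoc, ← reassoc_of% comparison_tensor, ← comparison_naturality,
    μ_natural_left_assoc, Functor.LaxMonoidal.left_unitality]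
  simp only [Functor.map_comp, Category.assoc]

lemma comparison_rightCounit (x : F.A) :
    comparison f x ≫ F.F.functor.map (ρ_ x).inv ≫ δ F.F.functor x (𝟙_ F.A) =
    G.F.functor.map ((Hom.H f).functor.map (ρ_ x).inv ≫ δ (Hom.H f).functor x (𝟙_ F.A)) ≫
      δ G.F.functor _ _ ≫ (comparison f x ⊗ₘ comparison f (𝟙_ F.A)) := by
  rw [← reassoc_of% comparison_naturality, comparison_cotensor, Functor.map_comp_assoc]

lemma comparison_leftCounit (x : F.A) :
    comparison f x ≫ F.F.functor.map (λ_ x).inv ≫ δ F.F.functor (𝟙_ F.A) x =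
    G.F.functor.map ((Hom.H f).functor.map (λ_ x).inv ≫ δ (Hom.H f).functor (𝟙_ F.A) x) ≫
      δ G.F.functor _ _ ≫ (comparison f (𝟙_ F.A) ⊗ₘ comparison f x) := by
  rw [← reassoc_of% comparison_naturality, comparison_cotensor, Functor.map_comp_assoc]

lemma comparison_act_counit : G.tanX ◁ comparison f (𝟙_ F.A) ≫
    tanHom f ▷ F.F.functor.obj (𝟙_ F.A) ≫ F.act (𝟙_ F.A) ≫ η F.F.functor =
      G.tanX ◁ G.F.functor.map (η (Hom.H f).functor) ≫ G.act (𝟙_ G.A) ≫ η G.F.functor := by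
  rw [reassoc_of% comparison_tanHom_act, comparison_counit, reassoc_of% G.act_naturality]

variable {Δ : F.tanX ⟶ F.tanX ⊗ F.tanX} {Δ' : G.tanX ⟶ G.tanX ⊗ G.tanX}

lemma comp_tanHom_eq {i : G.tanX ⟶ G.tanX} {j : F.tanX ⟶ F.tanX}
    {a : ∀ x : F.A, G.tanX ⊗ G.F.functor.obj ((Hom.H f).functor.obj x) ⟶
      G.F.functor.obj ((Hom.H f).functor.obj x)}
    {b : ∀ x : F.A, F.tanX ⊗ F.F.functor.obj x ⟶ F.F.functor.obj x}
    (hi : ∀ x, i ▷ _ ≫ G.act ((Hom.H f).functor.obj x) = a x)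
    (hj : ∀ x, j ▷ _ ≫ F.act x = b x)
    (h : ∀ x, a x ≫ comparison f x = G.tanX ◁ comparison f x ≫ tanHom f ▷ _ ≫ b x) :
    i ≫ tanHom f = tanHom f ≫ j := by
  refine comparison_hom_ext f fun x => ?_
  rw [comp_whiskerRight_assoc, comp_whiskerRight_assoc, whisker_exchange_assoc,
    comparison_tanHom_act, reassoc_of% hi, hj, h]

lemma tanHom_idemS (hΔ : F.IsComul Δ) (hΔ' : G.IsComul Δ') :
    (G.tanPre Δ').idemS ≫ tanHom f = tanHom f ≫ (F.tanPre Δ).idemS := by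
  refine comp_tanHom_eq f (fun x => hΔ'.idemS_act _) hΔ.idemS_act fun x => ?_
  rw [BraidedCategory.braiding_naturality_left_assoc,
    BraidedCategory.braiding_naturality_right_assoc, ← MonoidalCategory.whiskerLeft_comp_assoc,
    tanHom_evalUnit, MonoidalCategory.whiskerLeft_comp_assoc, ← whisker_exchange_assoc,
    ← MonoidalCategory.tensorHom_def_assoc, comparison_rightUnit, Category.assoc, Category.assoc,
    Category.assoc]

lemma tanHom_idemT (hΔ : F.IsComul Δ) (hΔ' : G.IsComul Δ') :
    (G.tanPre Δ').idemT ≫ tanHom f = tanHom f ≫ (F.tanPre Δ).idemT := by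
  refine comp_tanHom_eq f (fun x => hΔ'.idemT_act _) hΔ.idemT_act fun x => ?_
  rw [← comp_whiskerRight_assoc, tanHom_evalUnit, comp_whiskerRight_assoc, whisker_exchange_assoc,
    ← MonoidalCategory.tensorHom_def'_assoc, comparison_leftUnit, Category.assoc, Category.assoc]

lemma tanHom_idemZ (hΔ : F.IsComul Δ) (hΔ' : G.IsComul Δ') :
    (G.tanPre Δ').idemZ ≫ tanHom f = tanHom f ≫ (F.tanPre Δ).idemZ := by
  refine comp_tanHom_eq f (fun x => hΔ'.idemZ_act _) hΔ.idemZ_act fun x => ?_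
  rw [← whisker_exchange_assoc, ← MonoidalCategory.whiskerLeft_comp_assoc, comparison_leftCounit,
    ← Category.assoc (G.F.functor.map _), MonoidalCategory.whiskerLeft_comp_assoc _ _ (_ ⊗ₘ _),
    scalar_left_natural, comparison_act_counit, comp_whiskerRight_assoc (_ ◁ _),
    ← associator_inv_naturality_middle_assoc, ← MonoidalCategory.whiskerLeft_comp_assoc,
    Category.assoc (G.F.functor.map _), δ_natural_left, ← Functor.map_comp_assoc,
    Category.assoc ((Hom.H f).functor.map _), ← Functor.OplaxMonoidal.left_unitality]
  simp only [Category.assoc]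

lemma tanHom_idemR (hΔ : F.IsComul Δ) (hΔ' : G.IsComul Δ') :
    (G.tanPre Δ').idemR ≫ tanHom f = tanHom f ≫ (F.tanPre Δ).idemR := by
  refine comp_tanHom_eq f (fun x => hΔ'.idemR_act _) hΔ.idemR_act fun x => ?_
  rw [← whisker_exchange_assoc, ← MonoidalCategory.whiskerLeft_comp_assoc, comparison_rightCounit,
    ← Category.assoc (G.F.functor.map _), MonoidalCategory.whiskerLeft_comp_assoc _ _ (_ ⊗ₘ _),
    scalar_right_natural, comparison_act_counit, MonoidalCategory.whiskerLeft_comp_assoc _ (_ ◁ _),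
    ← associator_naturality_right_assoc, ← whisker_exchange_assoc,
    ← associator_inv_naturality_right_assoc, ← MonoidalCategory.whiskerLeft_comp_assoc,
    Category.assoc (G.F.functor.map _), δ_natural_right, ← Functor.map_comp_assoc,
    Category.assoc ((Hom.H f).functor.map _), ← Functor.OplaxMonoidal.right_unitality]
  simp only [Category.assoc]

lemma tanMul_tanHom : G.tanMul ≫ tanHom f = (tanHom f ⊗ₘ tanHom f) ≫ F.tanMul := by
  refine comparison_hom_ext f fun x => ?_
  rw [comp_whiskerRight_assoc, comp_whiskerRight_assoc, whisker_exchange_assoc,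
    comparison_tanHom_act, reassoc_of% tanMul_act, tanMul_act, tensorHom_whiskerRight_compAct,
    whiskerLeft_compAct, comparison_tanHom_act, compAct_comp_right, comparison_tanHom_act,
    compAct_comp]

lemma tanOne_tanHom : G.tanOne ≫ tanHom f = F.tanOne := by
  refine comparison_hom_ext f fun x => ?_
  rw [comp_whiskerRight_assoc, whisker_exchange_assoc, comparison_tanHom_act,
    reassoc_of% tanOne_act, tanOne_act, leftUnitor_naturality]

lemma comul_tanHom_act (hΔ' : G.IsComul Δ') (x y : F.A) :
    G.tanX ◁ (comparison f x ⊗ₘ comparison f y) ≫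
      (Δ' ≫ (tanHom f ⊗ₘ tanHom f)) ▷ _ ≫ boxAct (F.act x) (F.act y) =
    G.tanX ◁ μ G.F.functor _ _ ≫ G.act _ ≫ δ G.F.functor _ _ ≫
      (comparison f x ⊗ₘ comparison f y) := by
  rw [comp_whiskerRight_assoc, whisker_exchange_assoc, tensorHom_whiskerRight_boxAct,
    whiskerLeft_tensorHom_boxAct, comparison_tanHom_act, comparison_tanHom_act,
    ← boxAct_tensorHom, reassoc_of% hΔ'.act]

lemma comparison_boxAct_hom_ext {X : V} {l l' : X ⟶ F.tanX ⊗ F.tanX}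
    (h : ∀ x y, X ◁ (comparison f x ⊗ₘ comparison f y) ≫ l ▷ _ ≫ boxAct (F.act x) (F.act y) =
      X ◁ (comparison f x ⊗ₘ comparison f y) ≫ l' ▷ _ ≫ boxAct (F.act x) (F.act y)) : l = l' :=
  F.boxAct_hom_ext fun x y => (cancel_epi (X ◁ (comparison f x ⊗ₘ comparison f y))).1 (h x y)

lemma tanHom_comul_act (hΔ : F.IsComul Δ) (x y : F.A) :
    G.tanX ◁ (comparison f x ⊗ₘ comparison f y) ≫ (tanHom f ≫ Δ) ▷ _ ≫
      boxAct (F.act x) (F.act y) =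
    G.tanX ◁ μ G.F.functor _ _ ≫ G.act _ ≫ G.F.functor.map (μ (Hom.H f).functor x y) ≫
      comparison f (x ⊗ y) ≫ δ F.F.functor x y := by
  rw [comp_whiskerRight_assoc, hΔ.act, ← whisker_exchange_assoc,
    ← MonoidalCategory.whiskerLeft_comp_assoc, ← comparison_tensor,
    MonoidalCategory.whiskerLeft_comp_assoc, MonoidalCategory.whiskerLeft_comp_assoc,
    reassoc_of% comparison_tanHom_act, reassoc_of% G.act_naturality]

lemma tanHom_comul_left (hΔ : F.IsComul Δ) (hΔ' : G.IsComul Δ') : tanHom f ≫ Δ =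
    (λ_ G.tanX).inv ≫ ((F.tanOne ≫ Δ) ⊗ₘ (Δ' ≫ (tanHom f ⊗ₘ tanHom f))) ≫
      tensorμ _ _ _ _ ≫ (F.tanMul ⊗ₘ F.tanMul) := by
  refine comparison_boxAct_hom_ext f fun x y => ?_
  have hs := G.F.separable ((Hom.H f).functor.obj x) ((Hom.H f).functor.obj y)
  rw [tanHom_comul_act f hΔ, comp_whiskerRight_assoc (λ_ G.tanX).inv, comp_whiskerRight_assoc,
    comp_whiskerRight_assoc (tensorμ _ _ _ _), tensorHom_whiskerRight_boxAct, tanMul_act,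
    tanMul_act, ← compAct_boxAct, tensorHom_whiskerRight_compAct, hΔ.one_act, compAct_unit_left,
    Category.assoc, reassoc_of% comul_tanHom_act f hΔ', ← reassoc_of% comparison_tensor,
    reassoc_of% hs]

lemma tanHom_comul_right (hΔ : F.IsComul Δ) (hΔ' : G.IsComul Δ') : tanHom f ≫ Δ =
    (ρ_ G.tanX).inv ≫ ((Δ' ≫ (tanHom f ⊗ₘ tanHom f)) ⊗ₘ (F.tanOne ≫ Δ)) ≫
      tensorμ _ _ _ _ ≫ (F.tanMul ⊗ₘ F.tanMul) := by
  refine comparison_boxAct_hom_ext f fun x y => ?_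
  have hs := G.F.separable ((Hom.H f).functor.obj x) ((Hom.H f).functor.obj y)
  rw [tanHom_comul_act f hΔ, comp_whiskerRight_assoc (ρ_ G.tanX).inv, comp_whiskerRight_assoc,
    comp_whiskerRight_assoc (tensorμ _ _ _ _), tensorHom_whiskerRight_boxAct, tanMul_act,
    tanMul_act, ← compAct_boxAct, tensorHom_whiskerRight_compAct, hΔ.one_act, compAct_unit_right,
    ← MonoidalCategory.whiskerLeft_comp_assoc, ← reassoc_of% comparison_tensor, comparison_cotensor]
  simp only [MonoidalCategory.whiskerLeft_comp_assoc]
  rw [comul_tanHom_act f hΔ', ← MonoidalCategory.whiskerLeft_comp_assoc _ (δ _ _ _), hs,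
    MonoidalCategory.whiskerLeft_id, Category.id_comp, reassoc_of% G.act_naturality,
    reassoc_of% G.act_naturality]

lemma isWeakMorphism_tanHom (hΔ : F.IsComul Δ) (hΔ' : G.IsComul Δ') :
    PreBialgebra.IsWeakMorphism (G.tanPre Δ') (F.tanPre Δ) (tanHom f) where
  idemS := tanHom_idemS f hΔ hΔ'
  idemZ := tanHom_idemZ f hΔ hΔ'
  idemT := tanHom_idemT f hΔ hΔ'
  idemR := tanHom_idemR f hΔ hΔ'
  map_mul := tanMul_tanHom f
  map_one := tanOne_tanHom f
  comul_left := tanHom_comul_left f hΔ hΔ'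
  comul_right := tanHom_comul_right f hΔ hΔ'

theorem tanWellDefined : TanWellDefined.{v, u} where
  comul F := F.existsUnique_isComul
  weakBialgebra _ _ hΔ := hΔ.isWeakBialgebra
  weakMorphism f _ hΔ _ hΔ' := isWeakMorphism_tanHom f hΔ hΔ'

end SFOver

section

variable {C : Type u₁} [Category.{v₁} C] [MonoidalCategory C] [BraidedCategory C]

lemma whiskerLeft_braiding_eq (X Y Z : C) :
    (α_ X Y Z).hom ≫ X ◁ (β_ Y Z).hom ≫ (α_ X Z Y).inv =
      (β_ Y X).inv ▷ Z ≫ (α_ Y X Z).hom ≫ (β_ Y (X ⊗ Z)).hom := by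
  rw [BraidedCategory.braiding_tensor_right_hom]
  simp

lemma braiding_whiskerRight_eq (X Y Z : C) :
    (α_ X Y Z).inv ≫ (β_ X Y).hom ▷ Z ≫ (α_ Y X Z).hom =
      X ◁ (β_ Z Y).inv ≫ (α_ X Z Y).inv ≫ (β_ (X ⊗ Z) Y).hom := by
  rw [BraidedCategory.braiding_tensor_left_hom]
  simp

end

namespace SFFunctor

variable {C : Type u₁} [Category.{v₁} C] [MonoidalCategory C]
  {D : Type u₂} [Category.{v₂} D] [MonoidalCategory D] (Φ : SFFunctor C D)

lemma unit_tensorHom_μ {A X Y : C} (c : 𝟙_ C ⟶ A) (g : X ⟶ Y) :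
    (λ_ (Φ.functor.obj X)).inv ≫ ((ε Φ.functor ≫ Φ.functor.map c) ⊗ₘ Φ.functor.map g) ≫
      μ Φ.functor A Y = Φ.functor.map ((λ_ X).inv ≫ (c ⊗ₘ g)) := by
  rw [← whiskerRight_comp_tensorHom_assoc, μ_natural,
    Functor.LaxMonoidal.left_unitality_inv_assoc, ← Functor.map_comp]

lemma tensorHom_unit_μ {A X Y : C} (c : 𝟙_ C ⟶ A) (g : X ⟶ Y) :
    (ρ_ (Φ.functor.obj X)).inv ≫ (Φ.functor.map g ⊗ₘ (ε Φ.functor ≫ Φ.functor.map c)) ≫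
      μ Φ.functor Y A = Φ.functor.map ((ρ_ X).inv ≫ (g ⊗ₘ c)) := by
  rw [← whiskerLeft_comp_tensorHom_assoc, μ_natural,
    Functor.LaxMonoidal.right_unitality_inv_assoc, ← Functor.map_comp]

lemma δ_counit_left {X Y : C} (s : Y ⟶ 𝟙_ C) :
    δ Φ.functor Y X ≫ (Φ.functor.map s ≫ η Φ.functor) ▷ Φ.functor.obj X ≫ (λ_ _).hom =
      Φ.functor.map (s ▷ X ≫ (λ_ X).hom) := by
  rw [comp_whiskerRight_assoc, δ_natural_left_assoc, Functor.OplaxMonoidal.left_unitality_hom,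
    ← Functor.map_comp]

lemma δ_counit_right {X Y : C} (s : Y ⟶ 𝟙_ C) :
    δ Φ.functor X Y ≫ Φ.functor.obj X ◁ (Φ.functor.map s ≫ η Φ.functor) ≫ (ρ_ _).hom =
      Φ.functor.map (X ◁ s ≫ (ρ_ X).hom) := by
  rw [MonoidalCategory.whiskerLeft_comp_assoc, δ_natural_right_assoc,
    Functor.OplaxMonoidal.right_unitality_hom, ← Functor.map_comp]

lemma δ_tensorHom_δ_μ (X Y Z W : C) :
    (δ Φ.functor X Y ⊗ₘ δ Φ.functor Z W) ≫ (α_ _ _ _).hom ≫ Φ.functor.obj X ◁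
      ((α_ _ _ _).inv ≫ μ Φ.functor Y Z ▷ Φ.functor.obj W) ≫ (α_ _ _ _).inv =
    μ Φ.functor (X ⊗ Y) (Z ⊗ W) ≫
      Φ.functor.map ((α_ _ _ _).inv ≫ (α_ X Y Z).hom ▷ W) ≫
        δ Φ.functor (X ⊗ Y ⊗ Z) W ≫ δ Φ.functor X (Y ⊗ Z) ▷ Φ.functor.obj W := by
  have h₁ := Φ.frobenius_left X Y Z
  have h₂ := Φ.frobenius_right (X ⊗ Y) Z W
  have key : ∀ {A B E G H K L : D} (d : A ⟶ B ⊗ E) (d' : G ⟶ H ⊗ K) (m : E ⊗ H ⟶ L),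
      (d ⊗ₘ d') ≫ (α_ B E (H ⊗ K)).hom ≫ B ◁ ((α_ E H K).inv ≫ m ▷ K) ≫ (α_ B L K).inv =
      A ◁ d' ≫ (α_ A H K).inv ≫ (d ▷ H ≫ (α_ B E H).hom ≫ B ◁ m) ▷ K := by
    intros
    rw [MonoidalCategory.tensorHom_def']
    monoidal
  rw [key, h₁, comp_whiskerRight, comp_whiskerRight, reassoc_of% h₂, δ_natural_left_assoc]
  simp only [Functor.map_comp, Category.assoc]

lemma δ_μ_tensorHom_μ (X Y Z W : C) :
    (Φ.functor.obj X ◁ δ Φ.functor Y Z ≫ (α_ _ _ _).inv) ▷ Φ.functor.obj W ≫ (α_ _ _ _).hom ≫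
      (μ Φ.functor X Y ⊗ₘ μ Φ.functor Z W) =
    μ Φ.functor X (Y ⊗ Z) ▷ Φ.functor.obj W ≫ μ Φ.functor (X ⊗ Y ⊗ Z) W ≫
      Φ.functor.map ((α_ X Y Z).inv ▷ W ≫ (α_ _ _ _).hom) ≫ δ Φ.functor (X ⊗ Y) (Z ⊗ W) := by
  have h₁ := Φ.frobenius_right X Y Z
  have h₂ := Φ.frobenius_left (X ⊗ Y) Z W
  have key : ∀ {A B E G H K L : D} (d : A ⟶ B ⊗ E) (m : G ⊗ B ⟶ H) (m' : E ⊗ K ⟶ L),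
      (G ◁ d ≫ (α_ G B E).inv) ▷ K ≫ (α_ (G ⊗ B) E K).hom ≫ (m ⊗ₘ m') =
      (G ◁ d ≫ (α_ G B E).inv ≫ m ▷ E) ▷ K ≫ (α_ H E K).hom ≫ H ◁ m' := by
    intros
    rw [MonoidalCategory.tensorHom_def]
    monoidal
  rw [key, h₁, comp_whiskerRight_assoc, comp_whiskerRight_assoc, h₂, μ_natural_left_assoc]
  simp only [Functor.map_comp, Category.assoc]

lemma map_weak_unit {X Y Z W U : C} (c : 𝟙_ C ⟶ X ⊗ Y) (c' : 𝟙_ C ⟶ Z ⊗ W) (m : Y ⊗ Z ⟶ U) :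
    (λ_ (𝟙_ D)).inv ≫ ((ε Φ.functor ≫ Φ.functor.map c ≫ δ Φ.functor X Y) ⊗ₘ
      (ε Φ.functor ≫ Φ.functor.map c' ≫ δ Φ.functor Z W)) ≫ (α_ _ _ _).hom ≫
        Φ.functor.obj X ◁ ((α_ _ _ _).inv ≫
          (μ Φ.functor Y Z ≫ Φ.functor.map m) ▷ Φ.functor.obj W) ≫ (α_ _ _ _).inv =
    ε Φ.functor ≫ Φ.functor.map ((λ_ (𝟙_ C)).inv ≫ (c ⊗ₘ c') ≫ (α_ _ _ _).hom ≫
      X ◁ ((α_ _ _ _).inv ≫ m ▷ W) ≫ (α_ _ _ _).inv) ≫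
        δ Φ.functor (X ⊗ U) W ≫ δ Φ.functor X U ▷ Φ.functor.obj W := by
  have h₁ : (λ_ (𝟙_ D)).inv ≫ ((ε Φ.functor ≫ Φ.functor.map c ≫ δ Φ.functor X Y) ⊗ₘ
      (ε Φ.functor ≫ Φ.functor.map c' ≫ δ Φ.functor Z W)) =
      ε Φ.functor ≫ (λ_ _).inv ≫ ((ε Φ.functor ≫ Φ.functor.map c) ⊗ₘ Φ.functor.map c') ≫
        (δ Φ.functor X Y ⊗ₘ δ Φ.functor Z W) := by
    rw [leftUnitor_inv_naturality_assoc, whiskerLeft_comp_tensorHom_assoc,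
      tensorHom_comp_tensorHom, Category.assoc, Category.assoc]
  have h₂ : Φ.functor.obj X ◁ ((α_ _ _ _).inv ≫
      (μ Φ.functor Y Z ≫ Φ.functor.map m) ▷ Φ.functor.obj W) ≫ (α_ _ _ _).inv =
      (Φ.functor.obj X ◁ ((α_ _ _ _).inv ≫ μ Φ.functor Y Z ▷ Φ.functor.obj W) ≫
        (α_ _ _ _).inv) ≫ (Φ.functor.obj X ◁ Φ.functor.map m) ▷ Φ.functor.obj W := by
    monoidal
  have h₃ := Φ.δ_tensorHom_δ_μ X Y Z W
  have h₄ : (c ⊗ₘ c') ≫ (α_ _ _ _).hom ≫ X ◁ ((α_ _ _ _).inv ≫ m ▷ W) ≫ (α_ _ _ _).inv =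
      (c ⊗ₘ c') ≫ ((α_ _ _ _).inv ≫ (α_ X Y Z).hom ▷ W) ≫ (X ◁ m) ▷ W := by
    monoidal
  rw [reassoc_of% h₁, h₂, Category.assoc, reassoc_of% h₃, reassoc_of% Φ.unit_tensorHom_μ c c', h₄,
    ← comp_whiskerRight, δ_natural_right, comp_whiskerRight, δ_natural_left_assoc]
  simp only [Functor.map_comp, Category.assoc]

lemma map_weak_counit {X Y Z W U : C} (s : X ⊗ Y ⟶ 𝟙_ C) (t : Z ⊗ W ⟶ 𝟙_ C) (d : U ⟶ Y ⊗ Z) :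
    (Φ.functor.obj X ◁ (Φ.functor.map d ≫ δ Φ.functor Y Z) ≫ (α_ _ _ _).inv) ▷
      Φ.functor.obj W ≫ (α_ _ _ _).hom ≫
        ((μ Φ.functor X Y ≫ Φ.functor.map s ≫ η Φ.functor) ⊗ₘ
          (μ Φ.functor Z W ≫ Φ.functor.map t ≫ η Φ.functor)) ≫ (λ_ (𝟙_ D)).hom =
    μ Φ.functor X U ▷ Φ.functor.obj W ≫ μ Φ.functor (X ⊗ U) W ≫ Φ.functor.map
      ((X ◁ d ≫ (α_ _ _ _).inv) ▷ W ≫ (α_ _ _ _).hom ≫ (s ⊗ₘ t) ≫ (λ_ (𝟙_ C)).hom) ≫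
        η Φ.functor := by
  have h₃ := Φ.δ_μ_tensorHom_μ X Y Z W
  have h₁ : ((μ Φ.functor X Y ≫ Φ.functor.map s ≫ η Φ.functor) ⊗ₘ
      (μ Φ.functor Z W ≫ Φ.functor.map t ≫ η Φ.functor)) ≫ (λ_ (𝟙_ D)).hom =
      (μ Φ.functor X Y ⊗ₘ μ Φ.functor Z W) ≫ (Φ.functor.map s ⊗ₘ Φ.functor.map t) ≫
        η Φ.functor ▷ _ ≫ (λ_ _).hom ≫ η Φ.functor := by
    rw [← leftUnitor_naturality, ← MonoidalCategory.tensorHom_def_assoc,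
      tensorHom_comp_tensorHom_assoc, tensorHom_comp_tensorHom_assoc]
    simp only [Category.assoc]
  have h₂ : (Φ.functor.obj X ◁ (Φ.functor.map d ≫ δ Φ.functor Y Z) ≫ (α_ _ _ _).inv) ▷
      Φ.functor.obj W = (Φ.functor.obj X ◁ Φ.functor.map d) ▷ Φ.functor.obj W ≫
        (Φ.functor.obj X ◁ δ Φ.functor Y Z ≫ (α_ _ _ _).inv) ▷ Φ.functor.obj W := by
    simp only [comp_whiskerRight, MonoidalCategory.whiskerLeft_comp, Category.assoc]
  rw [h₁, h₂, Category.assoc, reassoc_of% h₃, ← comp_whiskerRight_assoc, μ_natural_right,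
    comp_whiskerRight_assoc, μ_natural_left_assoc, δ_natural_assoc,
    reassoc_of% Functor.OplaxMonoidal.left_unitality_hom Φ.functor (𝟙_ C)]
  simp only [Functor.map_comp, Category.assoc, comp_whiskerRight]

variable [BraidedCategory C] [BraidedCategory D]

/-- A separable Frobenius functor is braided as a monoidal and as a comonoidal functor. -/
structure IsBraided : Prop where
  μ_braiding (X Y : C) : μ Φ.functor X Y ≫ Φ.functor.map (β_ X Y).hom =
    (β_ (Φ.functor.obj X) (Φ.functor.obj Y)).hom ≫ μ Φ.functor Y X
  braiding_δ (X Y : C) : Φ.functor.map (β_ X Y).hom ≫ δ Φ.functor Y X =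
    δ Φ.functor X Y ≫ (β_ (Φ.functor.obj X) (Φ.functor.obj Y)).hom

namespace IsBraided

variable {Φ}

lemma braiding_inv_μ (hΦ : Φ.IsBraided) (X Y : C) :
    (β_ (Φ.functor.obj X) (Φ.functor.obj Y)).inv ≫ μ Φ.functor X Y =
    μ Φ.functor Y X ≫ Φ.functor.map (β_ X Y).inv := by
  rw [Iso.inv_comp_eq, ← reassoc_of% hΦ.μ_braiding, ← Functor.map_comp, Iso.hom_inv_id,
    CategoryTheory.Functor.map_id, Category.comp_id]

lemma δ_braiding_inv (hΦ : Φ.IsBraided) (X Y : C) :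
    δ Φ.functor Y X ≫ (β_ (Φ.functor.obj X) (Φ.functor.obj Y)).inv =
      Φ.functor.map (β_ X Y).inv ≫ δ Φ.functor X Y := by
  rw [Iso.comp_inv_eq, Category.assoc, ← hΦ.braiding_δ, ← Functor.map_comp_assoc, Iso.inv_hom_id,
    CategoryTheory.Functor.map_id, Category.id_comp]

lemma δ_braiding_μ (hΦ : Φ.IsBraided) (X Y Z : C) :
    δ Φ.functor X Y ▷ Φ.functor.obj Z ≫ (α_ _ _ _).hom ≫
      Φ.functor.obj X ◁ (β_ (Φ.functor.obj Y) (Φ.functor.obj Z)).hom ≫ (α_ _ _ _).inv ≫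
        μ Φ.functor X Z ▷ Φ.functor.obj Y =
    μ Φ.functor (X ⊗ Y) Z ≫
      Φ.functor.map ((α_ X Y Z).hom ≫ X ◁ (β_ Y Z).hom ≫ (α_ X Z Y).inv) ≫
        δ Φ.functor (X ⊗ Z) Y := by
  have h₁ := whiskerLeft_braiding_eq (Φ.functor.obj X) (Φ.functor.obj Y) (Φ.functor.obj Z)
  have h₂ := Φ.frobenius_left Y X Z
  rw [reassoc_of% h₁, whiskerLeft_braiding_eq, ← comp_whiskerRight_assoc,
    hΦ.δ_braiding_inv, comp_whiskerRight_assoc, ← BraidedCategory.braiding_naturality_right,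
    reassoc_of% h₂, μ_natural_left_assoc, ← hΦ.braiding_δ]
  simp only [Functor.map_comp, Category.assoc]

lemma δ_braiding_μ' (hΦ : Φ.IsBraided) (X Y Z : C) :
    Φ.functor.obj X ◁ δ Φ.functor Y Z ≫ (α_ _ _ _).inv ≫
      (β_ (Φ.functor.obj X) (Φ.functor.obj Y)).hom ▷ Φ.functor.obj Z ≫ (α_ _ _ _).hom ≫
        Φ.functor.obj Y ◁ μ Φ.functor X Z =
    μ Φ.functor X (Y ⊗ Z) ≫
      Φ.functor.map ((α_ X Y Z).inv ≫ (β_ X Y).hom ▷ Z ≫ (α_ Y X Z).hom) ≫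
        δ Φ.functor Y (X ⊗ Z) := by
  have h₁ := braiding_whiskerRight_eq (Φ.functor.obj X) (Φ.functor.obj Y) (Φ.functor.obj Z)
  have h₂ := Φ.frobenius_right X Z Y
  rw [reassoc_of% h₁, braiding_whiskerRight_eq, ← MonoidalCategory.whiskerLeft_comp_assoc,
    hΦ.δ_braiding_inv,
    MonoidalCategory.whiskerLeft_comp_assoc,
    ← BraidedCategory.braiding_naturality_left, reassoc_of% h₂, μ_natural_right_assoc,
    ← hΦ.braiding_δ]
  simp only [Functor.map_comp, Category.assoc]

lemma δ_tensorμ (hΦ : Φ.IsBraided) (X Y Z W : C) :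
    δ Φ.functor X Y ▷ (Φ.functor.obj Z ⊗ Φ.functor.obj W) ≫ tensorμ _ _ _ _ ≫
      (μ Φ.functor X Z ⊗ₘ μ Φ.functor Y W) =
    Φ.functor.obj (X ⊗ Y) ◁ μ Φ.functor Z W ≫ μ Φ.functor (X ⊗ Y) (Z ⊗ W) ≫
      Φ.functor.map (tensorμ X Y Z W) ≫ δ Φ.functor (X ⊗ Z) (Y ⊗ W) := by
  have key : ∀ {A B E G H K L : D} (d : A ⟶ B ⊗ E) (m : B ⊗ G ⟶ K) (m' : E ⊗ H ⟶ L),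
      d ▷ (G ⊗ H) ≫ tensorμ B E G H ≫ (m ⊗ₘ m') = (α_ A G H).inv ≫
        (d ▷ G ≫ (α_ B E G).hom ≫ B ◁ (β_ E G).hom ≫ (α_ B G E).inv ≫ m ▷ E) ▷ H ≫
          (α_ K E H).hom ≫ K ◁ m' := by
    intros
    rw [MonoidalCategory.tensorHom_def, tensorμ]
    monoidal
  have h₁ := Φ.frobenius_left (X ⊗ Z) Y W
  have h₂ : (α_ (X ⊗ Y) Z W).inv ≫ ((α_ X Y Z).hom ≫ X ◁ (β_ Y Z).hom ≫ (α_ X Z Y).inv) ▷ W ≫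
      (α_ (X ⊗ Z) Y W).hom = tensorμ X Y Z W := by
    rw [tensorμ]
    monoidal
  rw [key, hΦ.δ_braiding_μ, comp_whiskerRight_assoc, comp_whiskerRight_assoc, h₁,
    μ_natural_left_assoc, ← h₂, Functor.map_comp_assoc, Functor.map_comp_assoc,
    ← Functor.LaxMonoidal.associativity_inv_assoc]

lemma δ_tensorHom_δ_tensorμ (hΦ : Φ.IsBraided) (X Y Z W : C) :
    (δ Φ.functor X Y ⊗ₘ δ Φ.functor Z W) ≫ tensorμ _ _ _ _ ≫
      (μ Φ.functor X Z ⊗ₘ μ Φ.functor Y W) =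
    μ Φ.functor (X ⊗ Y) (Z ⊗ W) ≫ Φ.functor.map (tensorμ X Y Z W) ≫
      δ Φ.functor (X ⊗ Z) (Y ⊗ W) := by
  have hs := Φ.separable Z W
  rw [MonoidalCategory.tensorHom_def'_assoc, hΦ.δ_tensorμ,
    ← MonoidalCategory.whiskerLeft_comp_assoc, hs, MonoidalCategory.whiskerLeft_id,
    Category.id_comp]

end IsBraided

end SFFunctor

namespace SFFunctor

open PreBialgebra

variable {C : Type u₁} [Category.{v₁} C] [MonoidalCategory C]
  {D : Type u₂} [Category.{v₂} D] [MonoidalCategory D] (Φ : SFFunctor C D)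

lemma mapPre_comulOne (B : PreBialgebra C) : (Φ.mapPre B).comulOne =
    ε Φ.functor ≫ Φ.functor.map B.comulOne ≫ δ Φ.functor B.X B.X := by
  simp only [comulOne, Functor.map_comp, Category.assoc]

lemma mapPre_counitMul (B : PreBialgebra C) : (Φ.mapPre B).counitMul =
    μ Φ.functor B.X B.X ≫ Φ.functor.map B.counitMul ≫ η Φ.functor := by
  simp only [counitMul, Functor.map_comp, Category.assoc]

lemma mapPre_comulOne_comul (B : PreBialgebra C) :
    (Φ.mapPre B).comulOne ≫ (Φ.mapPre B).comul ▷ (Φ.mapPre B).X =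
      ε Φ.functor ≫ Φ.functor.map (B.comulOne ≫ B.comul ▷ B.X) ≫
        δ Φ.functor (B.X ⊗ B.X) B.X ≫ δ Φ.functor B.X B.X ▷ Φ.functor.obj B.X := by
  rw [mapPre_comulOne, comp_whiskerRight]
  simp only [Category.assoc, Functor.map_comp, δ_natural_left_assoc]

lemma mapPre_mul_counitMul (B : PreBialgebra C) :
    (Φ.mapPre B).mul ▷ (Φ.mapPre B).X ≫ (Φ.mapPre B).counitMul =
      μ Φ.functor B.X B.X ▷ Φ.functor.obj B.X ≫ μ Φ.functor (B.X ⊗ B.X) B.X ≫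
        Φ.functor.map (B.mul ▷ B.X ≫ B.counitMul) ≫ η Φ.functor := by
  rw [mapPre_counitMul, comp_whiskerRight]
  simp only [Category.assoc, Functor.map_comp, μ_natural_left_assoc]

lemma mapPre_idemS (B : PreBialgebra C) : (Φ.mapPre B).idemS = Φ.functor.map B.idemS := by
  have h := Φ.frobenius_left B.X B.X B.X
  rw [idemS, mapPre_comulOne, mapPre_counitMul, MonoidalCategory.whiskerLeft_comp_assoc,
    comp_whiskerRight_assoc, comp_whiskerRight_assoc, reassoc_of% h, δ_counit_right,
    μ_natural_left_assoc, Functor.LaxMonoidal.left_unitality_inv_assoc]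
  simp only [← Functor.map_comp, idemS]

lemma mapPre_idemZ (B : PreBialgebra C) : (Φ.mapPre B).idemZ = Φ.functor.map B.idemZ := by
  have h := Φ.frobenius_right B.X B.X B.X
  rw [idemZ, mapPre_comulOne, mapPre_counitMul, comp_whiskerRight_assoc,
    MonoidalCategory.whiskerLeft_comp_assoc, MonoidalCategory.whiskerLeft_comp_assoc,
    reassoc_of% h, δ_counit_left, μ_natural_right_assoc,
    Functor.LaxMonoidal.right_unitality_inv_assoc]
  simp only [← Functor.map_comp, idemZ]

variable [BraidedCategory C] [BraidedCategory D]

namespace IsBraided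

variable {Φ}

lemma mapPre_mul₂ (hΦ : Φ.IsBraided) (B : PreBialgebra C) :
    (δ Φ.functor B.X B.X ⊗ₘ δ Φ.functor B.X B.X) ≫ (Φ.mapPre B).mul₂ =
      μ Φ.functor (B.X ⊗ B.X) (B.X ⊗ B.X) ≫ Φ.functor.map B.mul₂ ≫ δ Φ.functor B.X B.X := by
  rw [mul₂, mul₂, ← tensorHom_comp_tensorHom, reassoc_of% hΦ.δ_tensorHom_δ_tensorμ, δ_natural,
    Functor.map_comp_assoc]

lemma isWeakBialgebra_mapPre (hΦ : Φ.IsBraided) {B : PreBialgebra C} (hB : B.IsWeakBialgebra) :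
    (Φ.mapPre B).IsWeakBialgebra where
  mul_assoc := by
    simp only [comp_whiskerRight, MonoidalCategory.whiskerLeft_comp, Category.assoc,
      μ_natural_left_assoc, μ_natural_right_assoc, ← Functor.map_comp, hB.mul_assoc]
    simp only [Functor.map_comp, Functor.LaxMonoidal.associativity_assoc]
  one_mul := by
    rw [comp_whiskerRight_assoc, μ_natural_left_assoc, ← Functor.map_comp, hB.one_mul,
      Functor.LaxMonoidal.left_unitality]
  mul_one := by
    rw [MonoidalCategory.whiskerLeft_comp_assoc, μ_natural_right_assoc, ← Functor.map_comp,
      hB.mul_one, Functor.LaxMonoidal.right_unitality]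
  comul_assoc := by
    simp only [comp_whiskerRight, MonoidalCategory.whiskerLeft_comp, Category.assoc,
      δ_natural_left_assoc, δ_natural_right_assoc]
    rw [Functor.OplaxMonoidal.associativity]
    simp only [← Functor.map_comp_assoc, hB.comul_assoc]
  counit_comul := by
    rw [comp_whiskerRight, Category.assoc, δ_natural_left_assoc, ← Functor.map_comp_assoc,
      hB.counit_comul, Functor.OplaxMonoidal.left_unitality]
  comul_counit := by
    rw [MonoidalCategory.whiskerLeft_comp, Category.assoc, δ_natural_right_assoc,
      ← Functor.map_comp_assoc, hB.comul_counit, Functor.OplaxMonoidal.right_unitality]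
  mul_comul := by
    rw [← tensorHom_comp_tensorHom, Category.assoc, Category.assoc, hΦ.mapPre_mul₂, μ_natural_assoc,
      ← Functor.map_comp_assoc, ← Functor.map_comp_assoc, hB.mul_comul]
  weak_unit := by
    rw [mapPre_comulOne_comul, mapPre_comulOne, map_weak_unit, hB.weak_unit]
  weak_unit_braided := by
    rw [mapPre_comulOne_comul, mapPre_comulOne, reassoc_of% hΦ.braiding_inv_μ, ← Functor.map_comp,
      map_weak_unit, hB.weak_unit_braided]
  weak_counit := by
    rw [mapPre_mul_counitMul, mapPre_counitMul, map_weak_counit, hB.weak_counit]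
  weak_counit_braided := by
    rw [mapPre_mul_counitMul, mapPre_counitMul, Category.assoc, hΦ.δ_braiding_inv,
      ← Functor.map_comp_assoc, map_weak_counit, hB.weak_counit_braided]

lemma mapPre_idemT (hΦ : Φ.IsBraided) (B : PreBialgebra C) :
    (Φ.mapPre B).idemT = Φ.functor.map B.idemT := by
  have h := hΦ.δ_braiding_μ B.X B.X B.X
  rw [idemT, mapPre_comulOne, mapPre_counitMul, comp_whiskerRight_assoc (μ _ _ _),
    comp_whiskerRight_assoc, comp_whiskerRight_assoc, reassoc_of% h, δ_counit_left,
    μ_natural_left_assoc, Functor.LaxMonoidal.left_unitality_inv_assoc]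
  simp only [← Functor.map_comp, idemT, Category.assoc]

lemma mapPre_idemR (hΦ : Φ.IsBraided) (B : PreBialgebra C) :
    (Φ.mapPre B).idemR = Φ.functor.map B.idemR := by
  have h := hΦ.δ_braiding_μ' B.X B.X B.X
  rw [idemR, mapPre_comulOne, mapPre_counitMul,
    MonoidalCategory.whiskerLeft_comp_assoc _ (μ _ _ _),
    MonoidalCategory.whiskerLeft_comp_assoc, MonoidalCategory.whiskerLeft_comp_assoc,
    reassoc_of% h, δ_counit_right, μ_natural_right_assoc,
    Functor.LaxMonoidal.right_unitality_inv_assoc]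
  simp only [← Functor.map_comp, idemR, Category.assoc]

lemma isWeakMorphism_map (hΦ : Φ.IsBraided) {H J : PreBialgebra C} {f : H.X ⟶ J.X}
    (hf : IsWeakMorphism H J f) :
    IsWeakMorphism (Φ.mapPre H) (Φ.mapPre J) (Φ.functor.map f) where
  idemS := by
    rw [mapPre_idemS, mapPre_idemS, ← Functor.map_comp, ← Functor.map_comp, hf.idemS]
  idemZ := by
    rw [mapPre_idemZ, mapPre_idemZ, ← Functor.map_comp, ← Functor.map_comp, hf.idemZ]
  idemT := by
    rw [hΦ.mapPre_idemT, hΦ.mapPre_idemT, ← Functor.map_comp, ← Functor.map_comp, hf.idemT]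
  idemR := by
    rw [hΦ.mapPre_idemR, hΦ.mapPre_idemR, ← Functor.map_comp, ← Functor.map_comp, hf.idemR]
  map_mul := by
    rw [Category.assoc, ← Functor.map_comp, hf.map_mul, μ_natural_assoc, Functor.map_comp]
  map_one := by rw [Category.assoc, ← Functor.map_comp, hf.map_one]
  comul_left := by
    rw [mapPre_comulOne, Category.assoc, δ_natural, ← Category.assoc (ε Φ.functor),
      ← Functor.map_comp_assoc, ← Functor.map_comp_assoc, ← tensorHom_comp_tensorHom,
      Category.assoc, hΦ.mapPre_mul₂, reassoc_of% Φ.unit_tensorHom_μ, ← Functor.map_comp_assoc,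
      hf.comul_left, Category.assoc]
  comul_right := by
    rw [mapPre_comulOne, Category.assoc, δ_natural, ← Category.assoc (ε Φ.functor),
      ← Functor.map_comp_assoc, ← Functor.map_comp_assoc, ← tensorHom_comp_tensorHom,
      Category.assoc, hΦ.mapPre_mul₂, reassoc_of% Φ.tensorHom_unit_μ, ← Functor.map_comp_assoc,
      hf.comul_right, Category.assoc]

end IsBraided

end SFFunctor

lemma BMCat.Hom.isBraided {V W : BMCat.{v, u}} (Φ : BMCat.Hom V W) : Φ.toSFFunctor.IsBraided :=
  ⟨Φ.braided_μ, Φ.braided_δ⟩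

theorem WBA.preserved : WBA.Preserved.{v, u} where
  obj Φ B := (BMCat.Hom.isBraided Φ).isWeakBialgebra_mapPre B.isWeakBialgebra
  map Φ _ _ f := (BMCat.Hom.isBraided Φ).isWeakMorphism_map f.isWeakMorphism

namespace SFFunctor

variable {C : Type u₁} [Category.{v₁} C] [MonoidalCategory C]
  {D : Type u₂} [Category.{v₂} D] [MonoidalCategory D] (Φ : SFFunctor C D)

lemma map_compAct {A B M N P : C} (a : A ⊗ M ⟶ P) (b : B ⊗ N ⟶ M) :
    compAct (μ Φ.functor A M ≫ Φ.functor.map a) (μ Φ.functor B N ≫ Φ.functor.map b) =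
      μ Φ.functor A B ▷ Φ.functor.obj N ≫ μ Φ.functor (A ⊗ B) N ≫
        Φ.functor.map (compAct a b) := by
  simp only [compAct, MonoidalCategory.whiskerLeft_comp, Category.assoc, μ_natural_right_assoc,
    Functor.map_comp, Functor.LaxMonoidal.associativity_assoc]

lemma IsBraided.map_boxAct [BraidedCategory C] [BraidedCategory D] {Φ : SFFunctor C D}
    (hΦ : Φ.IsBraided) {A B M N P Q : C} (a : A ⊗ M ⟶ P) (b : B ⊗ N ⟶ Q) :
    δ Φ.functor A B ▷ (Φ.functor.obj M ⊗ Φ.functor.obj N) ≫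
      boxAct (μ Φ.functor A M ≫ Φ.functor.map a) (μ Φ.functor B N ≫ Φ.functor.map b) =
    Φ.functor.obj (A ⊗ B) ◁ μ Φ.functor M N ≫ μ Φ.functor (A ⊗ B) (M ⊗ N) ≫
      Φ.functor.map (boxAct a b) ≫ δ Φ.functor P Q := by
  rw [boxAct, boxAct, ← tensorHom_comp_tensorHom, reassoc_of% hΦ.δ_tensorμ, δ_natural,
    Functor.map_comp_assoc]

end SFFunctor

namespace SFOver

variable {V W : BMCat.{v, u}} (Φ : V ⟶ W) (F : SFOver V)

lemma mul_rhoHom : (μ Φ.functor F.tanX F.tanX ≫ Φ.functor.map F.tanMul) ≫ rhoHom Φ F =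
    (rhoHom Φ F ⊗ₘ rhoHom Φ F) ≫ (mapObj Φ F).tanMul := by
  refine (mapObj Φ F).tan_hom_ext fun x => ?_
  have h := rhoHom_act Φ F x
  have h₂ := Φ.toSFFunctor.map_compAct (F.act x) (F.act x)
  rw [comp_whiskerRight_assoc, comp_whiskerRight_assoc, comp_whiskerRight_assoc, tanMul_act,
    tensorHom_whiskerRight_compAct]
  refine (congrArg (fun k => _ ≫ _ ≫ k) h).trans
    (Eq.trans ?_ (congrArg₂ compAct h h).symm)
  rw [h₂]
  change _ ≫ Φ.functor.map F.tanMul ▷ Φ.functor.obj (F.F.functor.obj x) ≫ _ = _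
  rw [μ_natural_left_assoc, ← Functor.map_comp, tanMul_act]
  rfl

lemma one_rhoHom : (ε Φ.functor ≫ Φ.functor.map F.tanOne) ≫ rhoHom Φ F =
    (mapObj Φ F).tanOne := by
  refine (mapObj Φ F).tan_hom_ext fun x => ?_
  rw [comp_whiskerRight_assoc, comp_whiskerRight_assoc, tanOne_act]
  refine (congrArg (fun k => _ ≫ _ ≫ k) (rhoHom_act Φ F x)).trans ?_
  change _ ≫ Φ.functor.map F.tanOne ▷ Φ.functor.obj (F.F.functor.obj x) ≫ _ = _
  rw [μ_natural_left_assoc, ← Functor.map_comp, tanOne_act]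
  exact (Functor.LaxMonoidal.left_unitality Φ.functor (F.F.functor.obj x)).symm

lemma rhoHom_tanCounit : rhoHom Φ F ≫ (mapObj Φ F).tanCounit =
    Φ.functor.map F.tanCounit ≫ η Φ.functor := by
  have h : (mapObj Φ F).tanCounit = (ρ_ _).inv ≫ (mapObj Φ F).tanX ◁ (ε Φ.functor ≫
      Φ.functor.map (ε F.F.functor)) ≫ (mapObj Φ F).act (𝟙_ F.A) ≫
        Φ.functor.map (η F.F.functor) ≫ η Φ.functor := rfl
  rw [h, rightUnitor_inv_naturality_assoc, ← whisker_exchange_assoc,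
    reassoc_of% rhoHom_act Φ F (𝟙_ F.A), MonoidalCategory.whiskerLeft_comp_assoc,
    μ_natural_right_assoc, Functor.LaxMonoidal.right_unitality_inv_assoc, tanCounit]
  simp only [Functor.map_comp, Category.assoc]

variable {F} {Δ : F.tanX ⟶ F.tanX ⊗ F.tanX}
  {Δ' : (mapObj Φ F).tanX ⟶ (mapObj Φ F).tanX ⊗ (mapObj Φ F).tanX}

lemma rhoHom_comul (hΔ : F.IsComul Δ) (hΔ' : (mapObj Φ F).IsComul Δ') :
    rhoHom Φ F ≫ Δ' = (Φ.functor.map Δ ≫ δ Φ.functor F.tanX F.tanX) ≫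
      (rhoHom Φ F ⊗ₘ rhoHom Φ F) := by
  refine (mapObj Φ F).boxAct_hom_ext fun x y => ?_
  have h : Δ' ▷ (Φ.functor.obj (F.F.functor.obj x) ⊗ Φ.functor.obj (F.F.functor.obj y)) ≫
      boxAct ((mapObj Φ F).act x) ((mapObj Φ F).act y) =
    (mapObj Φ F).tanX ◁ (μ Φ.functor _ _ ≫ Φ.functor.map (μ F.F.functor x y)) ≫
      (mapObj Φ F).act (x ⊗ y) ≫ Φ.functor.map (δ F.F.functor x y) ≫ δ Φ.functor _ _ :=
    hΔ'.act x y
  change _ ▷ (Φ.functor.obj (F.F.functor.obj x) ⊗ Φ.functor.obj (F.F.functor.obj y)) ≫ _ =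
    _ ▷ (Φ.functor.obj (F.F.functor.obj x) ⊗ Φ.functor.obj (F.F.functor.obj y)) ≫ _
  have hb := (BMCat.Hom.isBraided Φ).map_boxAct (F.act x) (F.act y)
  have k := (tensorHom_whiskerRight_boxAct (rhoHom Φ F) (rhoHom Φ F) ((mapObj Φ F).act x)
    ((mapObj Φ F).act y)).trans (congrArg₂ boxAct (rhoHom_act Φ F x) (rhoHom_act Φ F y))
  rw [comp_whiskerRight_assoc, h, ← whisker_exchange_assoc, reassoc_of% rhoHom_act Φ F (x ⊗ y),
    comp_whiskerRight_assoc, comp_whiskerRight_assoc]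
  refine Eq.trans ?_ (congrArg (fun t => _ ≫ _ ≫ t) k).symm
  rw [hb, ← whisker_exchange_assoc, μ_natural_left_assoc, ← Functor.map_comp_assoc _ (Δ ▷ _),
    hΔ.act, MonoidalCategory.whiskerLeft_comp_assoc, μ_natural_right_assoc]
  simp only [Functor.map_comp, Category.assoc]

theorem rhoStrong (h : TanWellDefined.{v, u}) : RhoStrong h := fun Φ F =>
  { map_mul := mul_rhoHom Φ F
    map_one := one_rhoHom Φ F
    map_comul := rhoHom_comul Φ (h.comul F).choose_spec.1 (h.comul _).choose_spec.1
    map_counit := rhoHom_tanCounit Φ F }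

end SFOver

namespace SFOver

lemma rhoHom_whisker {V W : BMCat.{v, u}} {Φ Ψ : V ⟶ W} (τ : Φ ⟶ Ψ) (F : SFOver V) :
    rhoHom Φ F ≫ tanHom (whisker τ F) = τ.nat.app F.tanX ≫ rhoHom Ψ F := by
  refine ext_of_iso (whisker τ F) fun x => ?_
  have h₁ := whiskerLeft_iso_tanHom_act (whisker τ F) x
  rw [whisker_iso_app] at h₁ ⊢
  refine (aux_exchange (rhoHom Φ F) (tanHom (whisker τ F)) (τ.nat.app (F.F.functor.obj x)) _ _ _
    (rhoHom_act Φ F x) h₁).trans ?_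
  have h₂ := τ.bimonoidal.tensor F.tanX (F.F.functor.obj x)
  have h₃ := τ.nat.naturality (F.act x)
  rw [Category.assoc, h₃, reassoc_of% h₂, MonoidalCategory.tensorHom_def', Category.assoc]
  refine congrArg (_ ≫ ·) ((congrArg (_ ≫ ·) (rhoHom_act Ψ F x).symm).trans ?_)
  exact (comp_whiskerRight_assoc _ _ _ _).symm

lemma rhoHom_id (V : BMCat.{v, u}) (F : SFOver V) :
    rhoHom (𝟙 V) F = tanHom (mapIdIso V F).hom := by
  refine ext_of_iso (mapIdIso V F).hom fun x => ?_
  have h := whiskerLeft_iso_tanHom_act (mapIdIso V F).hom x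
  refine Eq.trans ?_ h.symm
  rw [mapIdIso_hom_iso_app]
  refine (congrArg (_ ≫ ·) (rhoHom_act (𝟙 V) F x)).trans ?_
  change F.tanX ◁ 𝟙 (F.F.functor.obj x) ≫ 𝟙 (F.tanX ⊗ F.F.functor.obj x) ≫ F.act x =
    F.act x ≫ 𝟙 (F.F.functor.obj x)
  rw [MonoidalCategory.whiskerLeft_id, Category.id_comp, Category.id_comp, Category.comp_id]

lemma rhoHom_comp {U V W : BMCat.{v, u}} (Φ : U ⟶ V) (Ψ : V ⟶ W) (F : SFOver U) :
    rhoHom (Φ ≫ Ψ) F = Ψ.functor.map (rhoHom Φ F) ≫ rhoHom Ψ (mapObj Φ F) ≫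
      tanHom (mapCompIso Φ Ψ F).hom := by
  refine ext_of_iso (mapCompIso Φ Ψ F).hom fun x => ?_
  have h := whiskerLeft_iso_tanHom_act (mapCompIso Φ Ψ F).hom x
  rw [mapCompIso_hom_iso_app] at h ⊢
  have h₁ := aux_exchange (rhoHom Ψ (mapObj Φ F)) (tanHom (mapCompIso Φ Ψ F).hom)
    (𝟙 (Ψ.functor.obj (Φ.functor.obj (F.F.functor.obj x)))) _ _ _
    (rhoHom_act Ψ (mapObj Φ F) x) h
  refine Eq.trans ?_ (aux_exchange (Ψ.functor.map (rhoHom Φ F)) (rhoHom Ψ (mapObj Φ F) ≫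
      tanHom (mapCompIso Φ Ψ F).hom) (𝟙 (Ψ.functor.obj (Φ.functor.obj (F.F.functor.obj x)))) _ _ _
    rfl h₁).symm
  refine (congrArg (_ ≫ ·) (rhoHom_act (Φ ≫ Ψ) F x)).trans
    (Eq.trans ?_ (Category.comp_id _).symm)
  have h₂ := rhoHom_act Φ F x
  change _ ◁ 𝟙 (Ψ.functor.obj (Φ.functor.obj (F.F.functor.obj x))) ≫
    (μ Ψ.functor (Φ.functor.obj F.tanX) (Φ.functor.obj (F.F.functor.obj x)) ≫
      Ψ.functor.map (μ Φ.functor F.tanX (F.F.functor.obj x))) ≫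
      Ψ.functor.map (Φ.functor.map (F.act x)) =
    Ψ.functor.map (rhoHom Φ F) ▷ Ψ.functor.obj (Φ.functor.obj (F.F.functor.obj x)) ≫
      μ Ψ.functor (mapObj Φ F).tanX (Φ.functor.obj (F.F.functor.obj x)) ≫
        Ψ.functor.map ((mapObj Φ F).act x)
  rw [MonoidalCategory.whiskerLeft_id, Category.id_comp, μ_natural_left_assoc,
    Category.assoc, ← Functor.map_comp, ← Functor.map_comp, h₂]

/-- The functors `tan` and the canonical morphisms `Φ (tan F) ⟶ tan (Φ F)` form a lax natural
transformation. -/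
noncomputable def tanLaxTrans (hT : TanWellDefined.{v, u}) (hW : WBA.Preserved.{v, u})
    (hρ : RhoStrong hT) : Lax.LaxTrans sfmonOp.{v, u}.toLax (WBA.wba hW).toLax where
  app := tanCat hT
  naturality := rho hT hρ hW
  naturality_naturality τ := by
    ext F
    exact WBA.Hom.ext (rhoHom_whisker τ F.unop)
  naturality_id V := by
    ext F
    exact WBA.Hom.ext ((Category.id_comp _).trans ((rhoHom_id V F.unop).trans
      ((Category.id_comp _).trans (Category.id_comp _)).symm))
  naturality_comp Φ Ψ := by
    ext F
    refine WBA.Hom.ext ((Category.id_comp _).trans ((rhoHom_comp Φ Ψ F.unop).trans ?_))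
    refine Eq.trans ?_ (Category.id_comp _).symm
    refine congrArg (_ ≫ ·) ?_
    refine Eq.trans ?_ (Category.id_comp _).symm
    refine congrArg (_ ≫ ·) ?_
    exact (Category.id_comp _).symm

end SFOver

end Tannaka

theorem proposition9 :
    ∃ (hT : Tannaka.SFOver.TanWellDefined.{v, u}) (hW : Tannaka.WBA.Preserved.{v, u})
      (hρ : Tannaka.SFOver.RhoStrong hT)
      (T : CategoryTheory.Lax.LaxTrans Tannaka.SFOver.sfmonOp.{v, u}.toLax
        (Tannaka.WBA.wba hW).toLax),
      Tannaka.laxComponents T = ⟨Tannaka.SFOver.tanCat hT, Tannaka.SFOver.rho hT hρ hW⟩ :=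
  ⟨Tannaka.SFOver.tanWellDefined, Tannaka.WBA.preserved, Tannaka.SFOver.rhoStrong _,
    Tannaka.SFOver.tanLaxTrans _ _ (Tannaka.SFOver.rhoStrong _), rfl⟩
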